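/- Theorem 4 (scaling law with local CSIR). Fix real numbers $\alpha>2$, $R_{\rm d}>1$, $c>0$. Network model of density $\lambda>0$: the transmitters ${\bf x}_0,{\bf x}_1,\dots$ form a homogeneous Poisson point process of density $\lambda$ on $\mathbb{R}^2$; the receiver of link $k$ is ${\bf y}_k={\bf x}_k+{\bf o}_k$, where the ${\bf o}_k$ are i.i.d. uniform on the annulus $\{1\le\|{\bf o}\|\le R_{\rm d}\}$, and it has $N_{\rm r}$ antennas; the entries of the fading vectors ${\bf h}_{k,\ell}\in\mathbb{C}^{N_{\rm r}}$ from transmitter $\ell$ to receiver $k$ are i.i.d. $\mathcal{CN}(0,1)$; locations, offsets and fading are independent. Put $d_{k,\ell}=\|{\bf y}_k-{\bf x}_\ell\|$. Receiver $k$ applies zero-forcing successive interference cancellation (ZF-SIC) to its $L=N_{\rm r}-1$ nearest interferers $k_1,\dots,k_L$ (the $L$ labels $j\neq k$ with the smallest $d_{k,j}$, in increasing order of $d_{k,j}$): it takes a QR decomposition $[{\bf h}_{k,k},{\bf h}_{k,k_1},\dots,{\bf h}_{k,k_L}]={\bf Q}_k{\bf R}_k$ with ${\bf Q}_k$ unitary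 and ${\bf R}_k$ upper triangular. In the interference-limited regime (noise neglected, $1/{\rm SNR}=0$) its SINR is $$\mathrm{SINR}^{\rm sic}_k=\frac{|{\bf R}_k(1,1)|^2\,d_{k,k}^{-\alpha}}{\sum_{j\notin\{k,k_1,\dots,k_L\}}|({\bf Q}_k^*{\bf h}_{k,j})(1)|^2\,d_{k,j}^{-\alpha}} .$$ The sum spectral efficiency per unit area is $$C_\Sigma^{\rm sic}=\lambda\,\mathbb{E}^{o}\bigl[\log_2(1+\mathrm{SINR}^{\rm sic}_k)\bigr]=\frac1{|\mathcal A|}\,\mathbb{E}\Bigl[\sum_{k:\,{\bf x}_k\in\mathcal A}\log_2(1+\mathrm{SINR}^{\rm sic}_k)\Bigr],$$ where $\mathbb{E}^o$ is the Palm expectation and $\mathcal A$ is any Borel set with $0<|\mathcal A|<\infty$. Let $\beta\ge 0$ and $N_{\rm r}=c\lambda^\beta$, rounded to a positive integer (that is, $N_{\rm r}\ge1$ is an integer with $|N_{\rm r}-c\lambda^\beta|<1$). Then, as $\lambda\to\infty$, $$\frac{C_\Sigma^{\rm sic}}{\lambda}=\Theta\Bigl(\log_2\bigl(1+\lambda^{\frac{\alpha}{2}(\beta-1)}\bigr)\Bigr),$$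 that is, there are positive constants $k_1,k_2,\lambda_0$, depending only on $\alpha,R_{\rm d},c,\beta$, such that for all $\lambda\ge\lambda_0$ the left-hand side lies between $k_1$ and $k_2$ times $\log_2(1+\lambda^{\frac{\alpha}{2}(\beta-1)})$. In particular, with linearly many antennas ($N_{\rm r}=c\lambda$, rounded in the same way) the growth is linear: $C_\Sigma^{\rm sic}=\Theta(\lambda)$. -/

import Mathlib

open MeasureTheory ProbabilityTheory
open scoped ENNReal NNReal

noncomputable section

/-- The Euclidean plane. -/
abbrev Plane : Type := EuclideanSpace ℝ (Fin 2)

/-- The number of points of the labelled configuration `x` (a sequence) that lie in `B`. -/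
def pointCount (x : ℕ → Plane) (B : Set Plane) : ℕ∞ := {k : ℕ | x k ∈ B}.encard

/-- The random points `X 0, X 1, …` form a homogeneous Poisson point process of density `lam` on the
plane: the number of points in a Borel set of finite area is Poisson with mean `lam` times the area,
and the numbers of points in finitely many disjoint such sets are independent. -/
structure IsHomogeneousPPP {Ω : Type*} [MeasurableSpace Ω] (P : Measure Ω) (lam : ℝ)
    (X : ℕ → Ω → Plane) : Prop where
  measurable : ∀ k, Measurable (X k)
  law_count : ∀ B : Set Plane, MeasurableSet B → volume B ≠ ∞ → ∀ n : ℕ,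
    P {ω | pointCount (fun k => X k ω) B = (n : ℕ∞)}
      = poissonMeasure (lam * (volume B).toReal).toNNReal {n}
  indep_count : ∀ (m : ℕ) (B : Fin m → Set Plane),
    (∀ i, MeasurableSet (B i)) → (∀ i, volume (B i) ≠ ∞) →
    Pairwise (fun i j => Disjoint (B i) (B j)) →
    iIndepFun (fun i ω => pointCount (fun k => X k ω) (B i)) P

/-- The annulus centred at the origin with inner radius `1` and outer radius `Rd`. -/
def annulus (Rd : ℝ) : Set Plane := {x | 1 ≤ ‖x‖ ∧ ‖x‖ ≤ Rd}

/-- The circularly symmetric complex Gaussian law `𝒞𝒩(0, 1)`: independent real and imaginary parts,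
both centred real Gaussian of variance `1 / 2`. -/
def stdComplexGaussian : Measure ℂ :=
  ((gaussianReal 0 (1 / 2)).prod (gaussianReal 0 (1 / 2))).map (fun p : ℝ × ℝ => ⟨p.1, p.2⟩)

/-- The network on a probability space: the transmitters `tx k` form a homogeneous Poisson process
of density `lam`; the receiver of link `k` is at `tx k + offset k`, the offsets being i.i.d. uniform
on the annulus; `h k l` is the fading vector from transmitter `l` to the `N` antennas of
receiver `k`, all its entries (for all `k`, `l`) being i.i.d. `𝒞𝒩(0, 1)`. Transmitter locations,
offsets and fading are independent of one another. -/
structure LinkNetwork {Ω : Type*} [MeasurableSpace Ω] (P : Measure Ω) (lam Rd : ℝ) (N : ℕ) where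
  tx : ℕ → Ω → Plane
  offset : ℕ → Ω → Plane
  h : ℕ → ℕ → Ω → Fin N → ℂ
  ppp : IsHomogeneousPPP P lam tx
  measurable_offset : ∀ k, Measurable (offset k)
  law_offset : ∀ k, P.map (offset k) = cond volume (annulus Rd)
  indep_offset : iIndepFun offset P
  measurable_h : ∀ k l, Measurable (h k l)
  law_h : ∀ k l i, P.map (fun ω => h k l ω i) = stdComplexGaussian
  indep_h : iIndepFun (fun (p : ℕ × ℕ × Fin N) ω => h p.1 p.2.1 ω p.2.2) P
  indep_tx_marks : IndepFun (fun ω k => tx k ω)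
    (fun ω => ((fun k => offset k ω), (fun k l => h k l ω))) P
  indep_offset_h : IndepFun (fun ω k => offset k ω) (fun ω k l => h k l ω) P

namespace LinkNetwork

variable {Ω : Type*} [MeasurableSpace Ω] {P : Measure Ω} {lam Rd : ℝ} {N : ℕ}

/-- Location of the receiver of link `k`. -/
def rx (net : LinkNetwork P lam Rd N) (k : ℕ) (ω : Ω) : Plane := net.tx k ω + net.offset k ω

/-- Distance from transmitter `l` to receiver `k`. -/
def d (net : LinkNetwork P lam Rd N) (k l : ℕ) (ω : Ω) : ℝ := dist (net.rx k ω) (net.tx l ω)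

/-- The interferer of link `k` that has exactly `ℓ` interferers of link `k` strictly closer to
receiver `k` (so `ℓ = 0` is the nearest interferer, `ℓ = 1` the second nearest, and so on).
Almost surely there is exactly one for every `ℓ`. -/
def nearest (net : LinkNetwork P lam Rd N) (k ℓ : ℕ) (ω : Ω) : ℕ :=
  sInf {j : ℕ | j ≠ k ∧ {i : ℕ | i ≠ k ∧ net.d k i ω < net.d k j ω}.encard = (ℓ : ℕ∞)}

/-- The set of the `L` nearest interferers of link `k`. -/
def cancelled (net : LinkNetwork P lam Rd N) (L k : ℕ) (ω : Ω) : Set ℕ :=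
  {j | ∃ ℓ : ℕ, ℓ < L ∧ j = net.nearest k ℓ ω}

/-- The `N × (1 + L)` channel matrix known to receiver `k`: its first column is the direct channel,
the others are the channels of the `L` nearest interferers in order of increasing distance. -/
def channelMatrix (net : LinkNetwork P lam Rd N) (L k : ℕ) (ω : Ω) :
    Matrix (Fin N) (Fin (L + 1)) ℂ :=
  Matrix.of fun i c =>
    (Fin.cons (net.h k k ω) (fun ℓ : Fin L => net.h k (net.nearest k ℓ ω) ω) :
      Fin (L + 1) → Fin N → ℂ) c i

end LinkNetwork

/-- `H = Q R` with `Q` unitary and `R` upper triangular. -/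
def IsQRDecomposition {N M : ℕ} (H : Matrix (Fin N) (Fin M) ℂ) (Q : Matrix (Fin N) (Fin N) ℂ)
    (R : Matrix (Fin N) (Fin M) ℂ) : Prop :=
  Q ∈ Matrix.unitaryGroup (Fin N) ℂ ∧ (∀ (i : Fin N) (j : Fin M), (j : ℕ) < (i : ℕ) → R i j = 0) ∧
    H = Q * R

/-- ZF-SIC receivers that cancel their `L` nearest interferers: every receiver uses some QR
decomposition of its channel matrix. -/
structure ZFSIC {Ω : Type*} [MeasurableSpace Ω] {P : Measure Ω} {lam Rd : ℝ} {N : ℕ}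
    (net : LinkNetwork P lam Rd N) (L : ℕ) where
  Q : ℕ → Ω → Matrix (Fin N) (Fin N) ℂ
  R : ℕ → Ω → Matrix (Fin N) (Fin (L + 1)) ℂ
  isQR : ∀ k ω, IsQRDecomposition (net.channelMatrix L k ω) (Q k ω) (R k ω)

namespace ZFSIC

variable {Ω : Type*} [MeasurableSpace Ω] {P : Measure Ω} {lam Rd : ℝ} {N L : ℕ} [NeZero N]
  {net : LinkNetwork P lam Rd N}

/-- Fading power of the direct link, `|R(1,1)|²`. -/
def signalGain (rec : ZFSIC net L) (k : ℕ) (ω : Ω) : ℝ := ‖rec.R k ω 0 0‖ ^ 2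

/-- Fading power of the link from transmitter `j` after ZF-SIC: the squared modulus of the first
entry of `Q* h`. -/
def interferenceGain (rec : ZFSIC net L) (k j : ℕ) (ω : Ω) : ℝ :=
  ‖((rec.Q k ω).conjTranspose.mulVec (net.h k j ω)) 0‖ ^ 2

open Classical in
/-- Aggregated power at receiver `k` of the interferers that are not cancelled (almost surely a
convergent series). -/
def interference (rec : ZFSIC net L) (α : ℝ) (k : ℕ) (ω : Ω) : ℝ :=
  ∑' j : ℕ, if j = k ∨ j ∈ net.cancelled L k ω then 0
    else rec.interferenceGain k j ω * net.d k j ω ^ (-α)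

/-- Instantaneous SINR of receiver `k`, where `invSNR = 1 / SNR`. -/
def sinr (rec : ZFSIC net L) (α invSNR : ℝ) (k : ℕ) (ω : Ω) : ℝ :=
  rec.signalGain k ω * net.d k k ω ^ (-α) / (rec.interference α k ω + invSNR)

end ZFSIC

/-- Palm expectation `𝔼ᵒ` of the nonnegative quantities `f k` attached to the links: the mean sum of
`f k` over the links whose transmitter lies in the window `A`, divided by the mean number
`lam * |A|` of such links. -/
def palmExpectation {Ω : Type*} [MeasurableSpace Ω] {P : Measure Ω} {lam Rd : ℝ} {N : ℕ}
    (net : LinkNetwork P lam Rd N) (A : Set Plane) (f : ℕ → Ω → ℝ≥0∞) : ℝ≥0∞ :=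
  (∫⁻ ω, ∑' k : ℕ, (net.tx k ⁻¹' A).indicator (f k) ω ∂P) / (ENNReal.ofReal lam * volume A)

/-- Sum spectral efficiency per unit area of ZF-SIC,
`lam * 𝔼ᵒ[log₂ (1 + SINR)]`. -/
def sumSpectralEfficiency {Ω : Type*} [MeasurableSpace Ω] {P : Measure Ω} {lam Rd : ℝ} {N L : ℕ}
    [NeZero N] {net : LinkNetwork P lam Rd N} (rec : ZFSIC net L) (α invSNR : ℝ)
    (A : Set Plane) : ℝ≥0∞ :=
  ENNReal.ofReal lam *
    palmExpectation net A (fun k ω => ENNReal.ofReal (Real.logb 2 (1 + rec.sinr α invSNR k ω)))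

end

/-!
A receiver that decodes its own stream first uses a unit vector `q₁` proportional to its direct
channel `h`: the first column of `H = Q R` reads `h = R(1,1) q₁`. Hence `|R(1,1)|² = ‖h‖²` is of
order `N`, and each residual interferer `g` is seen through the gain `|⟨h, g⟩|² / ‖h‖²`, which has
mean one and is independent of `h`. Cancelling the `N - 1` nearest interferers clears a disc of
radius `ρ` with `lam ρ² ≍ N`; the interference from outside has power `lam ρ ^ (2 - α)`, since
`α > 2`. So the SINR is of order `N / (lam ρ ^ (2 - α)) ≍ (N / lam) ^ (α / 2)`, and
`N ≍ lam ^ β` gives `lam ^ (α / 2 * (β - 1))`. Two estimates make this precise.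

*Upper bound.* The logarithm is concave, so it suffices to bound the Palm mean of the SINR
(`LinkNetwork.tsum_lintegral_sinr_le`). If at least `4 N` interferers lie within distance `r`, then
`3 N` of them are not cancelled, and the SINR is at most `r ^ α ‖h‖² / ∑ gains`. By the inequality
of arithmetic and geometric means, the mean of `1 / ∑ gains` over `m ≥ 3` interferers is `O(1 / m)`,
because a Gaussian variable has a finite moment of order `-2/3` (`lintegral_inv_sum_sq_le`). It is
exponentially unlikely that there are fewer than `4 N` interferers within distance `2 ^ i * r`,
where `r² = 8 N / lam` (`IsHomogeneousPPP.lintegral_tsum_few_le`).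

*Lower bound.* For each link, the events that `‖h‖²` is much smaller than `N`, that there are `N`
interferers within distance `ρ`, and that the interference from outside that disc is much larger
than its mean are controlled by Markov's inequality under the Palm law
(`LinkNetwork.tsum_lintegral_badness_le`). Together they remove at most half of the links; the
remaining ones have a SINR of the expected order (`ZFSIC.le_sinr_of_badness_lt`).

Palm means are handled without Palm calculus. First moments of sums over interferers come from the
second factorial moment measure of the Poisson process, which is `lam²` times Lebesgue measure
(`IsHomogeneousPPP.factorial_moment`); the exponential bound comes from a partition of the plane into
small cells and the independence of the counts inside and outside of a cell.
-/

/-! ### Linear statistics of complex Gaussian vectors -/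

/-- Grouping a doubly indexed independent family by its first index gives independent families. -/
lemma iIndepFun_group {Ω ι κ E : Type*} [MeasurableSpace Ω] {P : Measure Ω}
    [IsProbabilityMeasure P] [MeasurableSpace E] {X : ι → κ → Ω → E}
    (mX : ∀ i j, Measurable (X i j)) (hX : iIndepFun (fun (p : ι × κ) ω => X p.1 p.2 ω) P) :
    iIndepFun (fun i ω j => X i j ω) P := by
  have : ∀ i j, IsProbabilityMeasure (P.map (X i j)) :=
    fun i j ↦ Measure.isProbabilityMeasure_map (mX i j).aemeasurable
  have h1 := (iIndepFun_iff_map_fun_eq_infinitePi_map (by fun_prop)).1 hX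
  rw [iIndepFun_iff_map_fun_eq_infinitePi_map (by fun_prop)]
  have h2 := Measure.infinitePi_map_curry (fun i j => P.map (X i j))
  have h3 : ∀ i, P.map (fun ω j => X i j ω) = Measure.infinitePi (fun j => P.map (X i j)) := by
    intro i
    refine (iIndepFun_iff_map_fun_eq_infinitePi_map (by fun_prop)).1 ?_
    exact hX.precomp (g := fun j => (i, j)) (fun a b h => by simpa using h)
  simp_rw [h3]
  rw [← h2, ← h1, Measure.map_map (by fun_prop) (by fun_prop)]
  rfl

/-- Real linear forms of a standard complex Gaussian variable are Gaussian. -/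
lemma map_stdComplexGaussian_linear (a b : ℝ) :
    stdComplexGaussian.map (fun z => a * z.re + b * z.im)
      = gaussianReal 0 ((a ^ 2 + b ^ 2) / 2).toNNReal := by
  have hm : Measurable (fun p : ℝ × ℝ => (⟨p.1, p.2⟩ : ℂ)) :=
    Complex.measurableEquivRealProd.symm.measurable
  rw [stdComplexGaussian, Measure.map_map (by fun_prop) hm]
  have hind : IndepFun (fun p : ℝ × ℝ => a * p.1) (fun p : ℝ × ℝ => b * p.2)
      ((gaussianReal 0 (1 / 2)).prod (gaussianReal 0 (1 / 2))) :=
    indepFun_prod (X := fun x : ℝ => a * x) (Y := fun x : ℝ => b * x) (by fun_prop) (by fun_prop)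
  have h1 : ((gaussianReal 0 (1 / 2)).prod (gaussianReal 0 (1 / 2))).map
      (fun p : ℝ × ℝ => a * p.1) = gaussianReal (a * 0) (.mk (a ^ 2) (sq_nonneg _) * (1 / 2)) := by
    rw [← gaussianReal_map_const_mul]
    have h := Measure.map_fst_prod (μ := gaussianReal 0 (1 / 2)) (ν := gaussianReal 0 (1 / 2))
    rw [measure_univ, one_smul] at h
    conv_rhs => rw [← h]
    rw [Measure.map_map (by fun_prop) (by fun_prop)]
    rfl
  have h2 : ((gaussianReal 0 (1 / 2)).prod (gaussianReal 0 (1 / 2))).map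
      (fun p : ℝ × ℝ => b * p.2) = gaussianReal (b * 0) (.mk (b ^ 2) (sq_nonneg _) * (1 / 2)) := by
    rw [← gaussianReal_map_const_mul]
    have h := Measure.map_snd_prod (μ := gaussianReal 0 (1 / 2)) (ν := gaussianReal 0 (1 / 2))
    rw [measure_univ, one_smul] at h
    conv_rhs => rw [← h]
    rw [Measure.map_map (by fun_prop) (by fun_prop)]
    rfl
  have := gaussianReal_add_gaussianReal_of_indepFun hind h1 h2
  refine Eq.trans ?_ (this.trans ?_)
  · rfl
  · congr 1
    · simp
    · ext
      rw [Real.coe_toNNReal _ (by positivity)]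
      simp
      ring

instance : IsProbabilityMeasure stdComplexGaussian :=
  Measure.isProbabilityMeasure_map
    (Complex.measurableEquivRealProd.symm.measurable.aemeasurable)

/-- Sums of independent centred real Gaussian variables. -/
lemma map_sum_gaussianReal {Ω ι : Type*} [MeasurableSpace Ω] {P : Measure Ω}
    [IsProbabilityMeasure P] {X : ι → Ω → ℝ} (hm : ∀ i, Measurable (X i)) (hX : iIndepFun X P)
    {v : ι → ℝ} (hv : ∀ i, 0 ≤ v i) (hl : ∀ i, P.map (X i) = gaussianReal 0 (v i).toNNReal)
    (s : Finset ι) :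
    P.map (fun ω => ∑ i ∈ s, X i ω) = gaussianReal 0 (∑ i ∈ s, v i).toNNReal := by
  classical
  induction s using Finset.induction_on with
  | empty => simp [Measure.map_const]
  | insert j s hj ih =>
    have h := gaussianReal_add_gaussianReal_of_indepFun
      (hX.indepFun_finsetSum_of_notMem hm hj).symm (hl j) (by simpa [← Finset.sum_apply] using ih)
    have e : (fun ω => ∑ i ∈ insert j s, X i ω) = X j + ∑ i ∈ s, X i := by
      ext ω; simp [Finset.sum_insert hj]
    rw [e, h, add_zero, Finset.sum_insert hj,
      Real.toNNReal_add (hv j) (Finset.sum_nonneg fun i _ => hv i)]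

/-- The Hermitian product of `v` and `h`. -/
noncomputable def herm {N : ℕ} (v h : Fin N → ℂ) : ℂ := ∑ i, star (v i) * h i

/-- The squared Euclidean norm. -/
noncomputable def nsq {N : ℕ} (v : Fin N → ℂ) : ℝ := ∑ i, ‖v i‖ ^ 2

@[fun_prop]
lemma Measurable.herm {β : Type*} [MeasurableSpace β] {N : ℕ} {f g : β → Fin N → ℂ}
    (hf : Measurable f) (hg : Measurable g) : Measurable (fun b => herm (f b) (g b)) := by
  unfold _root_.herm; fun_prop

@[fun_prop]
lemma Measurable.nsq {β : Type*} [MeasurableSpace β] {N : ℕ} {f : β → Fin N → ℂ}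
    (hf : Measurable f) : Measurable (fun b => nsq (f b)) := by
  unfold _root_.nsq; fun_prop

lemma nsq_nonneg {N : ℕ} (v : Fin N → ℂ) : 0 ≤ nsq v := Finset.sum_nonneg fun _ _ => by positivity

/-- Entries that are independent standard complex Gaussian variables. -/
structure IsGaussianVector {Ω : Type*} [MeasurableSpace Ω] (P : Measure Ω) {N : ℕ}
    (g : Ω → Fin N → ℂ) : Prop where
  meas : Measurable g
  law : ∀ i, P.map (fun ω => g ω i) = stdComplexGaussian
  indep : iIndepFun (fun i ω => g ω i) P

section
variable {Ω : Type*} [MeasurableSpace Ω] {P : Measure Ω} [IsProbabilityMeasure P] {N : ℕ}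
  {g : Ω → Fin N → ℂ}

lemma IsGaussianVector.map_re_herm (hg : IsGaussianVector P g) (v : Fin N → ℂ) :
    P.map (fun ω => (herm v (g ω)).re) = gaussianReal 0 (nsq v / 2).toNNReal := by
  have hm := hg.meas
  have hmi : ∀ i, Measurable (fun ω => g ω i) := fun i => by fun_prop
  have h1 := map_sum_gaussianReal (P := P)
    (X := fun i ω => (v i).re * (g ω i).re + (v i).im * (g ω i).im)
    (v := fun i => ((v i).re ^ 2 + (v i).im ^ 2) / 2) (fun i => by fun_prop)
    (hg.indep.comp (fun i z => (v i).re * z.re + (v i).im * z.im) (fun i => by fun_prop))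
    (fun i => by positivity)
    (fun i => by
      rw [← map_stdComplexGaussian_linear, ← hg.law i, Measure.map_map (by fun_prop) (by fun_prop)]
      rfl) Finset.univ
  have e : nsq v / 2 = ∑ i, ((v i).re ^ 2 + (v i).im ^ 2) / 2 := by
    rw [nsq, Finset.sum_div]
    refine Finset.sum_congr rfl fun i _ => ?_
    rw [← Complex.normSq_eq_norm_sq, Complex.normSq_apply]; ring
  rw [e, ← h1]
  congr 1
  ext ω
  simp [herm]

lemma IsGaussianVector.map_im_herm (hg : IsGaussianVector P g) (v : Fin N → ℂ) :
    P.map (fun ω => (herm v (g ω)).im) = gaussianReal 0 (nsq v / 2).toNNReal := by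
  have := hg.map_re_herm (fun i => Complex.I * v i)
  have e : nsq (fun i => Complex.I * v i) = nsq v := by simp [nsq]
  rw [e] at this
  rw [← this]
  congr 1
  ext ω
  simp only [herm, Complex.re_sum, Complex.im_sum]
  refine Finset.sum_congr rfl fun i _ => ?_
  simp
  ring

end

/-! ### Gaussian moments and the mean of an inverse interference power -/

lemma lintegral_sq_gaussianReal (v : ℝ≥0) :
    ∫⁻ x, ENNReal.ofReal (x ^ 2) ∂(gaussianReal 0 v) = v := by
  have hi : Integrable (fun x : ℝ => x ^ 2) (gaussianReal 0 v) := by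
    have := (memLp_id_gaussianReal (μ := 0) (v := v) 2).integrable_sq
    simpa using this
  rw [← ofReal_integral_eq_lintegral_ofReal hi (ae_of_all _ fun x => sq_nonneg x)]
  have h := variance_fun_id_gaussianReal (μ := 0) (v := v)
  rw [variance_eq_integral (by fun_prop)] at h
  simp only [integral_id_gaussianReal, sub_zero] at h
  rw [h, ENNReal.ofReal_coe_nnreal]

/-- The moment of order `-2/3` of a centred Gaussian variable of variance `1 / 2`. The order `-1`
would be the first one for which the moment is infinite. -/
noncomputable def negMoment : ℝ≥0∞ :=
  ∫⁻ x, (ENNReal.ofReal (x ^ 2))⁻¹ ^ (1 / 3 : ℝ) ∂(gaussianReal 0 (1 / 2))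

lemma negMoment_lt_top : negMoment < ∞ := by
  have hpdf : ∀ x : ℝ, gaussianPDF 0 (1 / 2) x ≤ 1 := by
    intro x
    rw [gaussianPDF, gaussianPDFReal]
    rw [← ENNReal.ofReal_one]
    apply ENNReal.ofReal_le_ofReal
    have h1 : (√(2 * Real.pi * ((1 / 2 : ℝ≥0) : ℝ)))⁻¹ ≤ 1 := by
      apply inv_le_one_of_one_le₀
      rw [Real.one_le_sqrt]
      have := Real.pi_gt_three
      push_cast
      linarith
    have h2 : Real.exp (-(x - 0) ^ 2 / (2 * ((1 / 2 : ℝ≥0) : ℝ))) ≤ 1 := by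
      rw [Real.exp_le_one_iff]
      have := sq_nonneg x
      push_cast
      simpa using this
    calc _ ≤ (1 : ℝ) * 1 := mul_le_mul h1 h2 (Real.exp_pos _).le zero_le_one
      _ = 1 := one_mul 1
  have hm : Measurable (fun x : ℝ => (ENNReal.ofReal (x ^ 2))⁻¹ ^ (1 / 3 : ℝ)) := by fun_prop
  have hle : ∀ᵐ x : ℝ ∂(gaussianReal 0 (1 / 2)), (ENNReal.ofReal (x ^ 2))⁻¹ ^ (1 / 3 : ℝ)
      ≤ 1 + (Metric.ball (0 : ℝ) 1).indicator (fun x => ‖‖x‖ ^ (-(2 / 3 : ℝ))‖ₑ) x := by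
    have := nullSingletonClass_gaussianReal (μ := 0) (v := 1 / 2) (by norm_num)
    filter_upwards [measure_eq_zero_iff_ae_notMem.1
      (measure_singleton (μ := gaussianReal 0 (1 / 2)) (0 : ℝ))] with x hx
    have hx0 : x ≠ 0 := by simpa using hx
    have hxp : 0 < |x| := abs_pos.2 hx0
    have e : (ENNReal.ofReal (x ^ 2))⁻¹ ^ (1 / 3 : ℝ) = ENNReal.ofReal (|x| ^ (-(2 / 3 : ℝ))) := by
      rw [← ENNReal.ofReal_inv_of_pos (by positivity), ENNReal.ofReal_rpow_of_pos (by positivity)]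
      congr 1
      rw [← sq_abs, ← Real.rpow_natCast |x| 2, ← Real.rpow_neg hxp.le, ← Real.rpow_mul hxp.le]
      norm_num
    rw [e]
    by_cases hb : x ∈ Metric.ball (0 : ℝ) 1
    · rw [Set.indicator_of_mem hb, Real.enorm_eq_ofReal (by positivity), Real.norm_eq_abs]
      exact le_add_self
    · rw [Set.indicator_of_notMem hb, add_zero, ← ENNReal.ofReal_one]
      apply ENNReal.ofReal_le_ofReal
      apply Real.rpow_le_one_of_one_le_of_nonpos _ (by norm_num)
      simpa using hb
  have hint : IntegrableOn (fun x : ℝ => ‖x‖ ^ (-(2 / 3 : ℝ))) (Metric.ball 0 1) := by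
    refine integrableOn_ball_of_norm_le_rpow (C := 1) (α := 2 / 3) (by simp) (by norm_num) ?_
      (Measurable.pow_const (by fun_prop) _).aestronglyMeasurable
    filter_upwards with x
    rw [one_mul, Real.norm_of_nonneg (by positivity)]
  have hmi : Measurable ((Metric.ball (0 : ℝ) 1).indicator (fun x : ℝ => ‖‖x‖ ^ (-(2 / 3 : ℝ))‖ₑ)) :=
    Measurable.indicator (by fun_prop) measurableSet_ball
  calc negMoment ≤ ∫⁻ x, (1 + (Metric.ball (0 : ℝ) 1).indicator
        (fun x => ‖‖x‖ ^ (-(2 / 3 : ℝ))‖ₑ) x) ∂(gaussianReal 0 (1 / 2)) := lintegral_mono_ae hle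
    _ = 1 + ∫⁻ x, (Metric.ball (0 : ℝ) 1).indicator
        (fun x => ‖‖x‖ ^ (-(2 / 3 : ℝ))‖ₑ) x ∂(gaussianReal 0 (1 / 2)) := by
        rw [lintegral_add_left measurable_const]; simp
    _ ≤ 1 + ∫⁻ x, (Metric.ball (0 : ℝ) 1).indicator (fun x => ‖‖x‖ ^ (-(2 / 3 : ℝ))‖ₑ) x := by
        gcongr 1 + ?_
        rw [gaussianReal_of_var_ne_zero _ (by norm_num),
          lintegral_withDensity_eq_lintegral_mul _ (by fun_prop) hmi]
        exact lintegral_mono fun x => mul_le_of_le_one_left zero_le (hpdf x)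
    _ < ∞ := by
        rw [lintegral_indicator measurableSet_ball]
        exact ENNReal.add_lt_top.2 ⟨ENNReal.one_lt_top, hint.2⟩

/-- The inequality between the arithmetic and the geometric mean, in inverted form. -/
lemma inv_sum_le_prod {ι : Type*} (T : Finset ι) (hT : T.Nonempty) (q : ι → ℝ≥0) :
    (∑ j ∈ T, (q j : ℝ≥0∞))⁻¹
      ≤ (T.card : ℝ≥0∞)⁻¹ * ∏ j ∈ T, ((q j : ℝ≥0∞)⁻¹) ^ (1 / (T.card : ℝ)) := by
  have hc : 0 < (T.card : ℝ) := by exact_mod_cast hT.card_pos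
  by_cases h0 : ∃ j ∈ T, q j = 0
  · obtain ⟨j, hj, hq⟩ := h0
    have : ∏ j ∈ T, ((q j : ℝ≥0∞)⁻¹) ^ (1 / (T.card : ℝ)) = ∞ := by
      classical
      rw [← Finset.mul_prod_erase T _ hj, hq]
      simp only [ENNReal.coe_zero, ENNReal.inv_zero]
      rw [ENNReal.top_rpow_of_pos (by positivity), ENNReal.top_mul]
      refine Finset.prod_ne_zero_iff.2 fun i _ => ?_
      simp [hc.le]
    rw [this, ENNReal.mul_top (by simp)]
    exact le_top
  · push Not at h0
    have h := NNReal.geom_mean_le_arith_mean_weighted T (fun _ => (T.card : ℝ≥0)⁻¹) q (by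
      rw [Finset.sum_const, nsmul_eq_mul, mul_inv_cancel₀]
      exact_mod_cast hT.card_pos.ne')
    rw [← Finset.mul_sum] at h
    have hpos : 0 < ∏ j ∈ T, q j ^ (((T.card : ℝ≥0)⁻¹ : ℝ≥0) : ℝ) :=
      Finset.prod_pos fun j hj => NNReal.rpow_pos (pos_iff_ne_zero.2 (h0 j hj))
    have hsum : 0 < ∑ j ∈ T, q j := Finset.sum_pos (fun j hj => pos_iff_ne_zero.2 (h0 j hj)) hT
    have e1 : (∑ j ∈ T, (q j : ℝ≥0∞))⁻¹ = ((∑ j ∈ T, q j)⁻¹ : ℝ≥0) := by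
      rw [ENNReal.coe_inv hsum.ne']; push_cast; rfl
    have e2 : (T.card : ℝ≥0∞)⁻¹ * ∏ j ∈ T, ((q j : ℝ≥0∞)⁻¹) ^ (1 / (T.card : ℝ))
        = ((T.card : ℝ≥0)⁻¹ * ∏ j ∈ T, (q j)⁻¹ ^ (1 / (T.card : ℝ)) : ℝ≥0) := by
      rw [ENNReal.coe_mul, ENNReal.coe_inv (by exact_mod_cast hT.card_pos.ne'),
        ENNReal.ofNNReal_finsetProd]
      congr 1
      refine Finset.prod_congr rfl fun j hj => ?_
      rw [← ENNReal.coe_inv (h0 j hj), ENNReal.coe_rpow_of_nonneg _ (by positivity)]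
    rw [e1, e2, ENNReal.coe_le_coe]
    simp only [NNReal.inv_rpow, Finset.prod_inv_distrib]
    rw [← mul_inv]
    have hcn : 0 < (T.card : ℝ≥0) := by exact_mod_cast hT.card_pos
    apply inv_anti₀ (mul_pos hcn (by simpa using hpos))
    calc _ ≤ (T.card : ℝ≥0) * ((T.card : ℝ≥0)⁻¹ * ∑ j ∈ T, q j) := by
          gcongr; simpa using h
      _ = _ := by rw [← mul_assoc, mul_inv_cancel₀ hcn.ne', one_mul]

/-- Jensen's inequality for a power at most one. -/
lemma lintegral_rpow_le_rpow {Ω : Type*} [MeasurableSpace Ω] {P : Measure Ω}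
    [IsProbabilityMeasure P] {f : Ω → ℝ≥0∞} (hf : Measurable f) {p q : ℝ} (hp : 0 < p)
    (hpq : p ≤ q) : ∫⁻ ω, f ω ^ p ∂P ≤ (∫⁻ ω, f ω ^ q ∂P) ^ (p / q) := by
  have h := eLpNorm'_le_eLpNorm'_of_exponent_le hp hpq P hf.aestronglyMeasurable
  simp only [eLpNorm', enorm_eq_self] at h
  calc _ = ((∫⁻ ω, f ω ^ p ∂P) ^ (1 / p)) ^ p := by
        rw [← ENNReal.rpow_mul, one_div_mul_cancel hp.ne', ENNReal.rpow_one]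
    _ ≤ ((∫⁻ ω, f ω ^ q ∂P) ^ (1 / q)) ^ p := ENNReal.rpow_le_rpow h hp.le
    _ = _ := by rw [← ENNReal.rpow_mul]; congr 1; ring

/-- The mean of the inverse of a sum of `m ≥ 3` squares of independent Gaussian variables is
`O(1 / m)`: the geometric mean of the squares, which is at most their arithmetic mean, has an
inverse whose mean factorizes into moments of order `-2 / m`, and `m ≥ 3` makes them finite. -/
lemma lintegral_inv_sum_sq_le {Ω ι : Type*} [MeasurableSpace Ω] {P : Measure Ω}
    [IsProbabilityMeasure P] {X : ι → Ω → ℝ} (hm : ∀ i, Measurable (X i)) (hX : iIndepFun X P)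
    (hl : ∀ i, P.map (X i) = gaussianReal 0 (1 / 2)) (T : Finset ι) (hT : 3 ≤ T.card) :
    ∫⁻ ω, (∑ j ∈ T, ENNReal.ofReal (X j ω ^ 2))⁻¹ ∂P ≤ (T.card : ℝ≥0∞)⁻¹ * negMoment ^ 3 := by
  have hne : T.Nonempty := Finset.card_pos.1 (by omega)
  have hc : 3 ≤ (T.card : ℝ) := by exact_mod_cast hT
  have hK : ∀ j, ∫⁻ ω, (ENNReal.ofReal (X j ω ^ 2))⁻¹ ^ (1 / 3 : ℝ) ∂P = negMoment := by
    intro j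
    rw [negMoment, ← hl j, lintegral_map (by fun_prop) (hm j)]
  calc _ ≤ ∫⁻ ω, (T.card : ℝ≥0∞)⁻¹ *
        ∏ j ∈ T, (ENNReal.ofReal (X j ω ^ 2))⁻¹ ^ (1 / (T.card : ℝ)) ∂P :=
        lintegral_mono fun ω => inv_sum_le_prod T hne (fun j => (X j ω ^ 2).toNNReal)
    _ = (T.card : ℝ≥0∞)⁻¹ *
        ∏ j ∈ T, ∫⁻ ω, (ENNReal.ofReal (X j ω ^ 2))⁻¹ ^ (1 / (T.card : ℝ)) ∂P := by
        rw [lintegral_const_mul _ (by fun_prop)]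
        congr 1
        exact lintegral_prod_eq_prod_lintegral_of_indepFun T
          (fun j ω => (ENNReal.ofReal (X j ω ^ 2))⁻¹ ^ (1 / (T.card : ℝ)))
          (hX.comp (fun _ x => (ENNReal.ofReal (x ^ 2))⁻¹ ^ (1 / (T.card : ℝ)))
            (fun _ => by fun_prop)) (fun j => by fun_prop)
    _ ≤ (T.card : ℝ≥0∞)⁻¹ * ∏ j ∈ T, negMoment ^ (3 / (T.card : ℝ)) := by
        gcongr with j hj
        refine (lintegral_rpow_le_rpow (q := 1 / 3) (by fun_prop) (by positivity)
          (one_div_le_one_div_of_le (by norm_num) hc)).trans_eq ?_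
        rw [hK]; congr 1; field_simp
    _ = _ := by
        rw [Finset.prod_const, ← ENNReal.rpow_natCast, ← ENNReal.rpow_mul,
          div_mul_cancel₀ _ (by positivity)]
        norm_num

/-- Expectations of functions of two independent variables are iterated expectations. -/
lemma lintegral_indepFun {Ω α β : Type*} [MeasurableSpace Ω] {P : Measure Ω}
    [IsProbabilityMeasure P] [MeasurableSpace α] [MeasurableSpace β] {X : Ω → α} {Y : Ω → β}
    (hX : Measurable X) (hY : Measurable Y) (h : IndepFun X Y P) {F : α × β → ℝ≥0∞}
    (hF : Measurable F) :
    ∫⁻ ω, F (X ω, Y ω) ∂P = ∫⁻ ω, ∫⁻ ω', F (X ω, Y ω') ∂P ∂P := by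
  have h1 := (indepFun_iff_map_prod_eq_prod_map_map hX.aemeasurable hY.aemeasurable).1 h
  have := Measure.isProbabilityMeasure_map (μ := P) hX.aemeasurable
  have := Measure.isProbabilityMeasure_map (μ := P) hY.aemeasurable
  rw [← lintegral_map (f := F) hF (hX.prodMk hY), h1, lintegral_prod _ hF.aemeasurable,
    lintegral_map hF.lintegral_prod_right' hX]
  refine lintegral_congr fun ω => ?_
  exact lintegral_map (f := fun y => F (X ω, y)) (hF.comp measurable_prodMk_left) hY

/-- A property of two independent variables holds almost surely if it holds almost surely with
an independent copy of the second one. -/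
lemma ae_of_indepFun {Ω α β : Type*} [MeasurableSpace Ω] {P : Measure Ω}
    [IsProbabilityMeasure P] [MeasurableSpace α] [MeasurableSpace β] {X : Ω → α} {Y : Ω → β}
    (hX : Measurable X) (hY : Measurable Y) (h : IndepFun X Y P) {p : α → β → Prop}
    (hp : MeasurableSet {q : α × β | p q.1 q.2}) (hae : ∀ᵐ ω ∂P, ∀ᵐ ω' ∂P, p (X ω) (Y ω')) :
    ∀ᵐ ω ∂P, p (X ω) (Y ω) := by
  have hm : Measurable ({q : α × β | p q.1 q.2}ᶜ.indicator (1 : α × β → ℝ≥0∞)) :=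
    measurable_one.indicator hp.compl
  have h1 := lintegral_indepFun hX hY h hm
  have h2 : ∫⁻ ω, ∫⁻ ω', {q : α × β | p q.1 q.2}ᶜ.indicator 1 (X ω, Y ω') ∂P ∂P
      = (0 : ℝ≥0∞) := by
    rw [← lintegral_zero (μ := P)]
    refine lintegral_congr_ae ?_
    filter_upwards [hae] with ω hω
    rw [← lintegral_zero (μ := P)]
    refine lintegral_congr_ae ?_
    filter_upwards [hω] with ω' hω'
    simp [hω']
  rw [h2] at h1
  have h3 := (lintegral_eq_zero_iff (hm.comp (hX.prodMk hY))).1 h1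
  filter_upwards [h3] with ω hω
  by_contra hn
  simp [Set.indicator, hn] at hω

/-! ### Gains after matched filtering -/

/-- The power of the channel `h` after projection on the direction of `v`
(equal to `0` if `v = 0`). -/
noncomputable def gain {N : ℕ} (v h : Fin N → ℂ) : ℝ := ‖herm v h‖ ^ 2 / nsq v

@[fun_prop]
lemma Measurable.gain {β : Type*} [MeasurableSpace β] {N : ℕ} {f g : β → Fin N → ℂ}
    (hf : Measurable f) (hg : Measurable g) : Measurable (fun b => gain (f b) (g b)) := by
  unfold _root_.gain; fun_prop

lemma gain_nonneg {N : ℕ} (v h : Fin N → ℂ) : 0 ≤ gain v h :=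
  div_nonneg (by positivity) (nsq_nonneg v)

lemma nsq_eq_zero {N : ℕ} {v : Fin N → ℂ} : nsq v = 0 ↔ v = 0 := by
  rw [nsq, Finset.sum_eq_zero_iff_of_nonneg fun _ _ => by positivity, funext_iff]
  simp

/-- The unit vector in the direction of `v`. -/
noncomputable def unitVec {N : ℕ} (v : Fin N → ℂ) : Fin N → ℂ := fun i => ((√(nsq v))⁻¹ : ℝ) * v i

lemma nsq_unitVec {N : ℕ} {v : Fin N → ℂ} (hv : v ≠ 0) : nsq (unitVec v) = 1 := by
  have h0 : 0 < nsq v := (nsq_nonneg v).lt_of_ne' (mt nsq_eq_zero.1 hv)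
  simp only [nsq, unitVec, norm_mul, mul_pow, ← Finset.mul_sum, Complex.norm_real, Real.norm_eq_abs,
    sq_abs, inv_pow]
  change (√(nsq v) ^ 2)⁻¹ * nsq v = 1
  rw [Real.sq_sqrt h0.le, inv_mul_cancel₀ h0.ne']

lemma gain_eq {N : ℕ} (v h : Fin N → ℂ) : gain v h = ‖herm (unitVec v) h‖ ^ 2 := by
  have : herm (unitVec v) h = ((√(nsq v))⁻¹ : ℝ) * herm v h := by
    simp only [herm, unitVec, Finset.mul_sum, star_mul', RCLike.star_def, Complex.conj_ofReal]
    exact Finset.sum_congr rfl fun i _ => by ring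
  rw [this, norm_mul, mul_pow, Complex.norm_real, Real.norm_eq_abs, sq_abs, inv_pow,
    Real.sq_sqrt (nsq_nonneg v), gain]
  field_simp

section
variable {Ω : Type*} [MeasurableSpace Ω] {P : Measure Ω} [IsProbabilityMeasure P] {N : ℕ}

lemma sq_norm_eq (z : ℂ) : ‖z‖ ^ 2 = z.re ^ 2 + z.im ^ 2 := by
  rw [← Complex.normSq_eq_norm_sq, Complex.normSq_apply]; ring

/-- The gain of a Gaussian channel has mean at most one, whatever the direction `v` (mean zero if
`v = 0`, mean one otherwise). -/
lemma IsGaussianVector.lintegral_gain_le {g : Ω → Fin N → ℂ} (hg : IsGaussianVector P g)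
    (v : Fin N → ℂ) : ∫⁻ ω, ENNReal.ofReal (gain v (g ω)) ∂P ≤ 1 := by
  have hm := hg.meas
  have hmh : Measurable (fun ω => herm (unitVec v) (g ω)) :=
    measurable_const.herm hm
  by_cases hv : v = 0
  · have : nsq v = 0 := nsq_eq_zero.2 hv
    simp [gain, this]
  simp only [gain_eq, sq_norm_eq]
  have h2 : ∫⁻ ω, ENNReal.ofReal ((herm (unitVec v) (g ω)).re ^ 2) ∂P = (1 / 2 : ℝ).toNNReal := by
    rw [← lintegral_sq_gaussianReal, ← nsq_unitVec hv, ← hg.map_re_herm,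
      lintegral_map (by fun_prop) (by fun_prop)]
  have h3 : ∫⁻ ω, ENNReal.ofReal ((herm (unitVec v) (g ω)).im ^ 2) ∂P = (1 / 2 : ℝ).toNNReal := by
    rw [← lintegral_sq_gaussianReal, ← nsq_unitVec hv, ← hg.map_im_herm,
      lintegral_map (by fun_prop) (by fun_prop)]
  simp only [ENNReal.ofReal_add (sq_nonneg _) (sq_nonneg _)]
  rw [lintegral_add_left (by fun_prop), h2, h3, ← ENNReal.coe_add,
    ← Real.toNNReal_add (by norm_num) (by norm_num)]
  norm_num

lemma IsGaussianVector.ae_gain_pos {g : Ω → Fin N → ℂ} (hg : IsGaussianVector P g)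
    {v : Fin N → ℂ} (hv : v ≠ 0) : ∀ᵐ ω ∂P, 0 < gain v (g ω) := by
  have hm := hg.meas
  have hmh : Measurable (fun ω => herm (unitVec v) (g ω)) :=
    measurable_const.herm hm
  have h := hg.map_re_herm (unitVec v)
  rw [nsq_unitVec hv] at h
  have := nullSingletonClass_gaussianReal (μ := 0) (v := (1 / 2 : ℝ).toNNReal) (by norm_num)
  have h0 := measure_singleton (μ := gaussianReal 0 (1 / 2 : ℝ).toNNReal) (0 : ℝ)
  rw [← h, Measure.map_apply (by fun_prop) (measurableSet_singleton _)] at h0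
  filter_upwards [measure_eq_zero_iff_ae_notMem.1 h0] with ω hω
  rw [gain_eq, sq_norm_eq]
  have : (herm (unitVec v) (g ω)).re ≠ 0 := by simpa using hω
  positivity

/-- The squared modulus of a standard complex Gaussian variable has mean one. -/
lemma lintegral_stdComplexGaussian : ∫⁻ z, ENNReal.ofReal (‖z‖ ^ 2) ∂stdComplexGaussian = 1 := by
  simp only [sq_norm_eq, ENNReal.ofReal_add (sq_nonneg _) (sq_nonneg _)]
  rw [lintegral_add_left (by fun_prop)]
  have h1 := map_stdComplexGaussian_linear 1 0
  have h2 := map_stdComplexGaussian_linear 0 1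
  simp only [one_mul, zero_mul, add_zero, zero_add] at h1 h2
  have e1 := lintegral_sq_gaussianReal ((1 ^ 2 + 0 ^ 2 : ℝ) / 2).toNNReal
  have e2 := lintegral_sq_gaussianReal ((0 ^ 2 + 1 ^ 2 : ℝ) / 2).toNNReal
  rw [← h1, lintegral_map (by fun_prop) (by fun_prop)] at e1
  rw [← h2, lintegral_map (by fun_prop) (by fun_prop)] at e2
  rw [e1, e2, ← ENNReal.coe_add, ← Real.toNNReal_add (by norm_num) (by norm_num)]
  norm_num

lemma stdComplexGaussian_singleton : stdComplexGaussian {0} = 0 := by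
  have h1 := map_stdComplexGaussian_linear 1 0
  have := nullSingletonClass_gaussianReal (μ := 0) (v := ((1 ^ 2 + 0 ^ 2 : ℝ) / 2).toNNReal)
    (by norm_num)
  have h0 := measure_singleton (μ := gaussianReal 0 ((1 ^ 2 + 0 ^ 2 : ℝ) / 2).toNNReal) (0 : ℝ)
  rw [← h1, Measure.map_apply (by fun_prop) (measurableSet_singleton _)] at h0
  refine measure_mono_null ?_ h0
  intro z hz
  simp_all

/-- A standard complex Gaussian variable is rarely small. -/
lemma exists_stdComplexGaussian_small {ε : ℝ≥0∞} (hε : 0 < ε) :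
    ∃ a : ℝ, 0 < a ∧ stdComplexGaussian {z | ‖z‖ ^ 2 < a} ≤ ε := by
  have ht := tendsto_measure_iInter_atTop (μ := stdComplexGaussian)
    (s := fun n : ℕ => {z : ℂ | ‖z‖ ^ 2 < 1 / ((n : ℝ) + 1)})
    (fun n => (measurableSet_lt (by fun_prop) (by fun_prop)).nullMeasurableSet)
    (fun m n hmn z hz => by
      simp only [Set.mem_ofPred_eq] at hz ⊢
      exact lt_of_lt_of_le hz (Nat.one_div_le_one_div hmn)) ⟨0, measure_ne_top _ _⟩
  have hI : (⋂ n : ℕ, {z : ℂ | ‖z‖ ^ 2 < 1 / ((n : ℝ) + 1)}) = {0} := by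
    ext z
    simp only [Set.mem_iInter, Set.mem_ofPred_eq, Set.mem_singleton_iff]
    constructor
    · intro h
      by_contra hz
      obtain ⟨n, hn⟩ := exists_nat_one_div_lt (show 0 < ‖z‖ ^ 2 by positivity)
      exact absurd (h n) (not_lt.2 hn.le)
    · rintro rfl n
      simp; positivity
  rw [hI, stdComplexGaussian_singleton] at ht
  obtain ⟨n, hn⟩ := (ht.eventually (gt_mem_nhds hε)).exists
  exact ⟨1 / ((n : ℝ) + 1), by positivity, hn.le⟩

/-- The fading vectors seen by one receiver: all entries are independent standard complex
Gaussian variables. -/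
structure IsFading (P : Measure Ω) (H : ℕ → Ω → Fin N → ℂ) : Prop where
  meas : ∀ l, Measurable (H l)
  law : ∀ l i, P.map (fun ω => H l ω i) = stdComplexGaussian
  indep : iIndepFun (fun (p : ℕ × Fin N) ω => H p.1 ω p.2) P

namespace IsFading
variable {H : ℕ → Ω → Fin N → ℂ}

omit [IsProbabilityMeasure P] in
lemma gaussianVector (hH : IsFading P H) (l : ℕ) : IsGaussianVector P (H l) where
  meas := hH.meas l
  law := hH.law l
  indep := hH.indep.precomp (g := fun i => (l, i)) (fun a b h => by simpa using h)

lemma iIndep (hH : IsFading P H) : iIndepFun H P := by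
  have hm := hH.meas
  exact iIndepFun_group (X := fun l i ω => H l ω i) (fun l i => by fun_prop) hH.indep

omit [IsProbabilityMeasure P] in
lemma lintegral_nsq (hH : IsFading P H) (l : ℕ) :
    ∫⁻ ω, ENNReal.ofReal (nsq (H l ω)) ∂P = N := by
  have hm := hH.meas
  simp only [nsq]
  have : ∀ ω, ENNReal.ofReal (∑ i, ‖H l ω i‖ ^ 2) = ∑ i, ENNReal.ofReal (‖H l ω i‖ ^ 2) :=
    fun ω => ENNReal.ofReal_sum_of_nonneg fun i _ => by positivity
  simp only [this]
  rw [lintegral_finsetSum _ fun i _ => by fun_prop]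
  have : ∀ i, ∫⁻ ω, ENNReal.ofReal (‖H l ω i‖ ^ 2) ∂P = 1 := by
    intro i
    rw [← lintegral_stdComplexGaussian, ← hH.law l i, lintegral_map (by fun_prop) (by fun_prop)]
  rw [Finset.sum_congr rfl fun i _ => this i]
  simp

omit [IsProbabilityMeasure P] in
lemma ae_ne_zero [NeZero N] (hH : IsFading P H) (l : ℕ) : ∀ᵐ ω ∂P, H l ω ≠ 0 := by
  have hm := hH.meas
  have h0 := stdComplexGaussian_singleton
  rw [← hH.law l 0, Measure.map_apply (by fun_prop) (measurableSet_singleton _)] at h0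
  filter_upwards [measure_eq_zero_iff_ae_notMem.1 h0] with ω hω h
  simp [h] at hω

lemma lintegral_gain_le (hH : IsFading P H) {k j : ℕ} (hkj : k ≠ j) :
    ∫⁻ ω, ENNReal.ofReal (gain (H k ω) (H j ω)) ∂P ≤ 1 := by
  rw [lintegral_indepFun (F := fun p => ENNReal.ofReal (gain p.1 p.2)) (hH.meas k) (hH.meas j)
    (hH.iIndep.indepFun hkj) (by fun_prop)]
  calc _ ≤ ∫⁻ _, 1 ∂P := lintegral_mono fun ω => (hH.gaussianVector j).lintegral_gain_le _
    _ = 1 := by simp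

lemma ae_gain_pos [NeZero N] (hH : IsFading P H) {k j : ℕ} (hkj : k ≠ j) :
    ∀ᵐ ω ∂P, 0 < gain (H k ω) (H j ω) := by
  refine ae_of_indepFun (p := fun v g => 0 < gain v g) (hH.meas k) (hH.meas j)
    (hH.iIndep.indepFun hkj) (measurableSet_lt measurable_const (by fun_prop)) ?_
  filter_upwards [hH.ae_ne_zero k] with ω hω
  exact (hH.gaussianVector j).ae_gain_pos hω

lemma indepFun_finset (hH : IsFading P H) {k : ℕ} {T : Finset ℕ} (hk : k ∉ T) :
    IndepFun (H k) (fun ω (j : T) => H j ω) P := by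
  have h := hH.iIndep.indepFun_finset {k} T (by simpa using hk) hH.meas
  have hφ : Measurable (fun f : ({k} : Finset ℕ) → Fin N → ℂ => f ⟨k, by simp⟩) :=
    measurable_pi_apply (⟨k, by simp⟩ : ({k} : Finset ℕ))
  exact h.comp hφ measurable_id

/-- The signal power over the total power of `m ≥ 3` interferers has mean `O(N / m)`. -/
lemma lintegral_nsq_mul_inv_le [NeZero N] (hH : IsFading P H) {k : ℕ} {T : Finset ℕ} (hk : k ∉ T)
    (hT : 3 ≤ T.card) :
    ∫⁻ ω, ENNReal.ofReal (nsq (H k ω)) * (∑ j ∈ T, ENNReal.ofReal (gain (H k ω) (H j ω)))⁻¹ ∂P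
      ≤ N * ((T.card : ℝ≥0∞)⁻¹ * negMoment ^ 3) := by
  have hm := hH.meas
  have hind := hH.indepFun_finset hk
  have hF : Measurable (fun p : (Fin N → ℂ) × (T → Fin N → ℂ) =>
      ENNReal.ofReal (nsq p.1) * (∑ j : T, ENNReal.ofReal (gain p.1 (p.2 j)))⁻¹) := by
    refine Measurable.mul (by fun_prop) (Measurable.inv ?_)
    refine Finset.measurable_sum _ fun j _ => ?_
    fun_prop
  have h := lintegral_indepFun (hm k) (by fun_prop) hind hF
  have e : ∀ v ω, ∑ j : T, ENNReal.ofReal (gain v (H j ω))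
      = ∑ j ∈ T, ENNReal.ofReal (gain v (H j ω)) := fun v ω =>
    Finset.sum_coe_sort T (fun j => ENNReal.ofReal (gain v (H j ω)))
  simp only [e] at h
  have hre : ∀ v, Measurable (fun x : Fin N → ℂ => (herm (unitVec v) x).re) := fun v => by
    fun_prop
  have hmX : ∀ v j, Measurable (fun ω => (herm (unitVec v) (H j ω)).re) := fun v j =>
    (hre v).comp (hm j)
  have hinner : ∀ v, v ≠ 0 → ∫⁻ ω, (∑ j ∈ T, ENNReal.ofReal (gain v (H j ω)))⁻¹ ∂P
      ≤ (T.card : ℝ≥0∞)⁻¹ * negMoment ^ 3 := by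
    intro v hv
    have h1 : iIndepFun (fun j ω => (herm (unitVec v) (H j ω)).re) P :=
      hH.iIndep.comp (fun _ x => (herm (unitVec v) x).re) (fun _ => hre v)
    have h2 : ∀ j, P.map (fun ω => (herm (unitVec v) (H j ω)).re) = gaussianReal 0 (1 / 2) := by
      intro j
      rw [(hH.gaussianVector j).map_re_herm, nsq_unitVec hv]
      congr 1
      ext
      rw [Real.coe_toNNReal _ (by norm_num)]
      norm_num
    refine le_trans (lintegral_mono fun ω => ENNReal.inv_le_inv.2 ?_)
      (lintegral_inv_sum_sq_le (hmX v) h1 h2 T hT)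
    refine Finset.sum_le_sum fun j _ => ENNReal.ofReal_le_ofReal ?_
    rw [gain_eq, sq_norm_eq]
    nlinarith [sq_nonneg (herm (unitVec v) (H j ω)).im]
  calc _ = _ := h
    _ ≤ ∫⁻ ω, ENNReal.ofReal (nsq (H k ω)) * ((T.card : ℝ≥0∞)⁻¹ * negMoment ^ 3) ∂P := by
        refine lintegral_mono_ae ?_
        filter_upwards [hH.ae_ne_zero k] with ω hω
        rw [lintegral_const_mul' _ _ ENNReal.ofReal_ne_top]
        exact mul_le_mul_right (hinner _ hω) _
    _ = _ := by
        rw [lintegral_mul_const _ (by fun_prop), hH.lintegral_nsq k]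

end IsFading
end

/-! ### Poisson counts -/

/-- The size-biasing identity of the Poisson law: `E[n f(n)] = μ E[f(n + 1)]`. -/
lemma lintegral_poisson_mul (μ : ℝ≥0) (f : ℕ → ℝ≥0∞) :
    ∫⁻ n, n * f n ∂(poissonMeasure μ) = μ * ∫⁻ n, f (n + 1) ∂(poissonMeasure μ) := by
  simp only [lintegral_countable', poissonMeasure_singleton]
  rw [tsum_eq_zero_add' ENNReal.summable, ← ENNReal.tsum_mul_left]
  simp only [Nat.cast_zero, zero_mul, zero_add]
  refine tsum_congr fun n => ?_
  have : ENNReal.ofReal (Real.exp (-μ) * μ ^ (n + 1) / (n + 1).factorial) * ((n + 1 : ℕ) : ℝ≥0∞)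
      = μ * ENNReal.ofReal (Real.exp (-μ) * μ ^ n / n.factorial) := by
    rw [← ENNReal.ofReal_natCast, ← ENNReal.ofReal_mul (by positivity), ← ENNReal.ofReal_coe_nnreal,
      ← ENNReal.ofReal_mul (by positivity)]
    congr 1
    rw [Nat.factorial_succ]
    push_cast
    rw [pow_succ]
    field_simp
  calc _ = f (n + 1) * (ENNReal.ofReal (Real.exp (-μ) * μ ^ (n + 1) / (n + 1).factorial)
        * ((n + 1 : ℕ) : ℝ≥0∞)) := by ring
    _ = _ := by rw [this]; ring

/-- The value at `1 / 2` of the probability generating function of the Poisson law. -/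
lemma lintegral_poisson_half_pow (μ : ℝ≥0) :
    ∫⁻ n, (2⁻¹ : ℝ≥0∞) ^ n ∂(poissonMeasure μ) = ENNReal.ofReal (Real.exp (-μ / 2)) := by
  have h1 : ∫⁻ _, 1 ∂(poissonMeasure (μ / 2)) = 1 := by simp
  simp only [lintegral_countable', poissonMeasure_singleton] at h1 ⊢
  rw [← mul_one (ENNReal.ofReal (Real.exp (-μ / 2))), ← h1, ← ENNReal.tsum_mul_left]
  refine tsum_congr fun n => ?_
  rw [one_mul, ← ENNReal.ofReal_mul (by positivity), show (2⁻¹ : ℝ≥0∞) = ENNReal.ofReal 2⁻¹ by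
    rw [ENNReal.ofReal_inv_of_pos (by norm_num)]; norm_num, ← ENNReal.ofReal_pow (by norm_num),
    ← ENNReal.ofReal_mul (by positivity)]
  congr 1
  have : Real.exp (-μ) = Real.exp (-μ / 2) * Real.exp (-(μ / 2)) := by
    rw [← Real.exp_add]; congr 1; ring
  rw [this]
  push_cast
  have h2 : (2⁻¹ : ℝ) ^ n = 1 / 2 ^ n := by rw [inv_pow, one_div]
  rw [div_pow, h2]
  field_simp

lemma pointCount_eq_tsum (x : ℕ → Plane) (B : Set Plane) :
    (pointCount x B : ℝ≥0∞) = ∑' k, B.indicator 1 (x k) := by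
  rw [pointCount, ← ENNReal.tsum_set_one, tsum_subtype {k | x k ∈ B} (fun _ => (1 : ℝ≥0∞))]
  rfl

namespace IsHomogeneousPPP
variable {Ω : Type*} [MeasurableSpace Ω] {P : Measure Ω} [IsProbabilityMeasure P] {lam : ℝ}
  {X : ℕ → Ω → Plane}

omit [IsProbabilityMeasure P] in
lemma measurable_pointCount (hX : IsHomogeneousPPP P lam X) {B : Set Plane}
    (hB : MeasurableSet B) : Measurable (fun ω => pointCount (fun k => X k ω) B) := by
  have hm : Measurable (fun ω => (pointCount (fun k => X k ω) B : ℝ≥0∞)) := by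
    simp only [pointCount_eq_tsum]
    exact Measurable.tsum fun k => (measurable_one.indicator hB).comp (hX.measurable k)
  refine measurable_to_countable' fun y => ?_
  have : (fun ω => pointCount (fun k => X k ω) B) ⁻¹' {y}
      = (fun ω => (pointCount (fun k => X k ω) B : ℝ≥0∞)) ⁻¹' {(y : ℝ≥0∞)} := by
    ext ω; simp
  rw [this]
  exact hm (measurableSet_singleton _)

/-- The mean number of points in `B`. -/
noncomputable def _root_.meanCount (lam : ℝ) (B : Set Plane) : ℝ≥0 :=
  (lam * (volume B).toReal).toNNReal

lemma lintegral_pointCount (hX : IsHomogeneousPPP P lam X) {B : Set Plane}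
    (hB : MeasurableSet B) (hB' : volume B ≠ ∞) (f : ℕ∞ → ℝ≥0∞) :
    ∫⁻ ω, f (pointCount (fun k => X k ω) B) ∂P
      = ∫⁻ n, f (n : ℕ∞) ∂(poissonMeasure (meanCount lam B)) := by
  have hm := hX.measurable_pointCount hB
  have hl : ∀ n : ℕ, P.map (fun ω => pointCount (fun k => X k ω) B) {(n : ℕ∞)}
      = (poissonMeasure (meanCount lam B)).map ((↑) : ℕ → ℕ∞) {(n : ℕ∞)} := by
    intro n
    rw [Measure.map_apply hm (measurableSet_singleton _),
      Measure.map_apply (by fun_prop) (measurableSet_singleton _)]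
    have e1 : ((↑) : ℕ → ℕ∞) ⁻¹' {(n : ℕ∞)} = {n} := by ext; simp
    rw [e1]
    exact hX.law_count B hB hB' n
  have := Measure.isProbabilityMeasure_map (μ := P) hm.aemeasurable
  have := Measure.isProbabilityMeasure_map (μ := poissonMeasure (meanCount lam B))
    (f := ((↑) : ℕ → ℕ∞)) (by fun_prop)
  have hfin : ∀ ν : Measure ℕ∞, ν (Set.range ((↑) : ℕ → ℕ∞)) = ∑' n : ℕ, ν {(n : ℕ∞)} := by
    intro ν
    rw [← measure_iUnion (fun i j hij => by simpa using hij) (fun _ => measurableSet_singleton _)]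
    congr 1
    ext; simp
  have hmap : P.map (fun ω => pointCount (fun k => X k ω) B)
      = (poissonMeasure (meanCount lam B)).map ((↑) : ℕ → ℕ∞) := by
    refine Measure.ext_of_singleton fun y => ?_
    induction y with
    | coe n => exact hl n
    | top =>
      have hc : (Set.range ((↑) : ℕ → ℕ∞))ᶜ = {⊤} := by
        ext y; induction y <;> simp
      rw [← hc, prob_compl_eq_one_sub MeasurableSet.of_discrete,
        prob_compl_eq_one_sub MeasurableSet.of_discrete, hfin, hfin]
      simp only [hl]
  rw [← lintegral_map (f := f) measurable_from_top hm, hmap,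
    lintegral_map measurable_from_top (by fun_prop)]

lemma _root_.coe_meanCount {lam : ℝ} (hlam : 0 < lam) {B : Set Plane} (hB' : volume B ≠ ∞) :
    (meanCount lam B : ℝ≥0∞) = ENNReal.ofReal lam * volume B := by
  rw [meanCount, ← ENNReal.ofReal, ENNReal.ofReal_mul hlam.le, ENNReal.ofReal_toReal hB']

lemma lintegral_count (hX : IsHomogeneousPPP P lam X) {B : Set Plane}
    (hB : MeasurableSet B) (hB' : volume B ≠ ∞) :
    ∫⁻ ω, (pointCount (fun k => X k ω) B : ℝ≥0∞) ∂P = meanCount lam B := by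
  rw [hX.lintegral_pointCount hB hB' (fun n => (n : ℝ≥0∞))]
  have := lintegral_poisson_mul (meanCount lam B) 1
  simpa using this

lemma lintegral_count_sq (hX : IsHomogeneousPPP P lam X) {B : Set Plane}
    (hB : MeasurableSet B) (hB' : volume B ≠ ∞) :
    ∫⁻ ω, (pointCount (fun k => X k ω) B : ℝ≥0∞) * (pointCount (fun k => X k ω) B : ℝ≥0∞) ∂P
      = meanCount lam B * (meanCount lam B + 1) := by
  rw [hX.lintegral_pointCount hB hB' (fun n => (n : ℝ≥0∞) * n)]
  have h1 := lintegral_poisson_mul (meanCount lam B) 1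
  have h2 := lintegral_poisson_mul (meanCount lam B) (fun n => n)
  simp only [ENat.toENNReal_coe]
  rw [h2]
  push_cast
  rw [lintegral_add_right _ measurable_const]
  simp only [Pi.one_apply, mul_one, lintegral_one, measure_univ] at h1 ⊢
  rw [h1]

omit [IsProbabilityMeasure P] in
/-- Counts in disjoint sets are independent. -/
lemma indepFun_pointCount (hX : IsHomogeneousPPP P lam X) {B C : Set Plane}
    (hB : MeasurableSet B) (hB' : volume B ≠ ∞) (hC : MeasurableSet C) (hC' : volume C ≠ ∞)
    (hd : Disjoint B C) :
    IndepFun (fun ω => pointCount (fun k => X k ω) B) (fun ω => pointCount (fun k => X k ω) C) P := by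
  have h := hX.indep_count 2 ![B, C] (by simp [Fin.forall_fin_two, hB, hC])
    (by simp [Fin.forall_fin_two, hB', hC']) (by
      intro i j hij
      fin_cases i <;> fin_cases j <;> simp_all [disjoint_comm])
  exact h.indepFun (i := 0) (j := 1) (by simp)

lemma lintegral_count_mul (hX : IsHomogeneousPPP P lam X) {B C : Set Plane}
    (hB : MeasurableSet B) (hB' : volume B ≠ ∞) (hC : MeasurableSet C) (hC' : volume C ≠ ∞)
    (hd : Disjoint B C) :
    ∫⁻ ω, (pointCount (fun k => X k ω) B : ℝ≥0∞) * (pointCount (fun k => X k ω) C : ℝ≥0∞) ∂P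
      = meanCount lam B * meanCount lam C := by
  rw [← hX.lintegral_count hB hB', ← hX.lintegral_count hC hC']
  have hm : Measurable (fun n : ℕ∞ => (n : ℝ≥0∞)) := measurable_from_top
  exact lintegral_mul_eq_lintegral_mul_lintegral_of_indepFun''
    (hm.comp (hX.measurable_pointCount hB)).aemeasurable
    (hm.comp (hX.measurable_pointCount hC)).aemeasurable
    ((hX.indepFun_pointCount hB hB' hC hC' hd).comp hm hm)

/-- A Chernoff bound: it is exponentially unlikely that there are few points in `B`. -/
lemma lintegral_few_le (hX : IsHomogeneousPPP P lam X) {B : Set Plane}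
    (hB : MeasurableSet B) (hB' : volume B ≠ ∞) (n : ℕ) :
    ∫⁻ ω, (if pointCount (fun k => X k ω) B < n then 1 else 0) ∂P
      ≤ ENNReal.ofReal (2 ^ n * Real.exp (-meanCount lam B / 2)) := by
  rw [hX.lintegral_pointCount hB hB' (fun m => if m < n then 1 else 0)]
  calc _ ≤ ∫⁻ m, 2 ^ n * (2⁻¹ : ℝ≥0∞) ^ m ∂(poissonMeasure (meanCount lam B)) := by
        refine lintegral_mono fun m => ?_
        dsimp only
        split_ifs with h
        · have hmn : m ≤ n := by exact_mod_cast h.le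
          have e : (2 : ℝ≥0∞) ^ m * 2⁻¹ ^ m = 1 := by
            rw [← mul_pow, ENNReal.mul_inv_cancel (by norm_num) (by norm_num), one_pow]
          calc 1 = (2 : ℝ≥0∞) ^ m * 2⁻¹ ^ m := e.symm
            _ ≤ _ := by gcongr; norm_num
        · exact zero_le
    _ = _ := by
        rw [lintegral_const_mul _ (by fun_prop), lintegral_poisson_half_pow,
          ENNReal.ofReal_mul (by positivity), ENNReal.ofReal_pow (by norm_num)]
        norm_num

end IsHomogeneousPPP

/-! ### Campbell formulas of first and second order -/

namespace IsHomogeneousPPP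
variable {Ω : Type*} [MeasurableSpace Ω] {P : Measure Ω} [IsProbabilityMeasure P] {lam : ℝ}
  {X : ℕ → Ω → Plane}

/-- The intensity measure is `lam` times Lebesgue measure. -/
lemma tsum_measure_eq (hX : IsHomogeneousPPP P lam X) (hlam : 0 < lam) {A : Set Plane}
    (hA : MeasurableSet A) (hA' : volume A ≠ ∞) :
    ∑' k, P (X k ⁻¹' A) = ENNReal.ofReal lam * volume A := by
  rw [← coe_meanCount hlam hA', ← hX.lintegral_count hA hA']
  simp only [pointCount_eq_tsum]
  have hmk : ∀ k, Measurable (fun ω => A.indicator (1 : Plane → ℝ≥0∞) (X k ω)) := fun k =>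
    (measurable_one.indicator hA).comp (hX.measurable k)
  rw [lintegral_tsum fun k => (hmk k).aemeasurable]
  refine tsum_congr fun k => ?_
  rw [← lintegral_indicator_one (hX.measurable k hA)]
  rfl

lemma _root_.pointCount_inter_add_diff (x : ℕ → Plane) (A B : Set Plane) :
    (pointCount x A : ℝ≥0∞) = pointCount x (A ∩ B) + pointCount x (A \ B) := by
  simp only [pointCount_eq_tsum]
  rw [← ENNReal.tsum_add]
  refine tsum_congr fun k => ?_
  by_cases h1 : x k ∈ A <;> by_cases h2 : x k ∈ B <;> simp [h1, h2]

/-- The mean of a product of counts, in arbitrary sets. -/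
lemma lintegral_count_mul_count (hX : IsHomogeneousPPP P lam X) (hlam : 0 < lam) {A B : Set Plane}
    (hA : MeasurableSet A) (hA' : volume A ≠ ∞) (hB : MeasurableSet B) (hB' : volume B ≠ ∞) :
    ∫⁻ ω, (pointCount (fun k => X k ω) A : ℝ≥0∞) * (pointCount (fun k => X k ω) B : ℝ≥0∞) ∂P
      = ENNReal.ofReal lam * volume A * (ENNReal.ofReal lam * volume B)
        + ENNReal.ofReal lam * volume (A ∩ B) := by
  have hi : volume (A ∩ B) ≠ ∞ := measure_ne_top_of_subset Set.inter_subset_left hA'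
  have ha : volume (A \ B) ≠ ∞ := measure_ne_top_of_subset Set.sdiff_subset hA'
  have hb : volume (B \ A) ≠ ∞ := measure_ne_top_of_subset Set.sdiff_subset hB'
  have hm : ∀ {C : Set Plane}, MeasurableSet C →
      Measurable (fun ω => (pointCount (fun k => X k ω) C : ℝ≥0∞)) := fun hC =>
    (measurable_from_top (f := fun n : ℕ∞ => (n : ℝ≥0∞))).comp (hX.measurable_pointCount hC)
  have e : ∀ ω, (pointCount (fun k => X k ω) A : ℝ≥0∞) * (pointCount (fun k => X k ω) B : ℝ≥0∞)
      = (pointCount (fun k => X k ω) (A ∩ B) : ℝ≥0∞) * (pointCount (fun k => X k ω) (A ∩ B) : ℝ≥0∞)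
      + ((pointCount (fun k => X k ω) (A ∩ B) : ℝ≥0∞) * (pointCount (fun k => X k ω) (B \ A) : ℝ≥0∞)
      + ((pointCount (fun k => X k ω) (A \ B) : ℝ≥0∞) * (pointCount (fun k => X k ω) (A ∩ B) : ℝ≥0∞)
      + (pointCount (fun k => X k ω) (A \ B) : ℝ≥0∞)
        * (pointCount (fun k => X k ω) (B \ A) : ℝ≥0∞))) := by
    intro ω
    rw [pointCount_inter_add_diff _ A B, pointCount_inter_add_diff _ B A, Set.inter_comm B A]
    ring
  simp only [e]
  have mi := hm (hA.inter hB)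
  have ma := hm (hA.diff hB)
  have mb := hm (hB.diff hA)
  rw [lintegral_add_left (by fun_prop), lintegral_add_left (by fun_prop),
    lintegral_add_left (by fun_prop), hX.lintegral_count_sq (hA.inter hB) hi,
    hX.lintegral_count_mul (hA.inter hB) hi (hB.diff hA) hb
      (Set.disjoint_sdiff_right.mono_left Set.inter_subset_left),
    hX.lintegral_count_mul (hA.diff hB) ha (hA.inter hB) hi
      (Set.disjoint_sdiff_left.mono_right Set.inter_subset_right),
    hX.lintegral_count_mul (hA.diff hB) ha (hB.diff hA) hb
      (Set.disjoint_sdiff_left.mono_right Set.sdiff_subset),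
    coe_meanCount hlam hi, coe_meanCount hlam ha, coe_meanCount hlam hb,
    ← measure_inter_add_sdiff A hB, ← measure_inter_add_sdiff B hA, Set.inter_comm B A]
  ring

/-- The second factorial moment measure is `lam ^ 2` times Lebesgue measure. On a rectangle `s × t` it
is the mean of the product of the counts, less the diagonal term, which is the mean count of
`s ∩ t`. -/
lemma factorial_moment (hX : IsHomogeneousPPP P lam X) (hlam : 0 < lam) :
    (ENNReal.ofReal lam • volume : Measure Plane).prod (ENNReal.ofReal lam • volume)
      = Measure.sum (fun p : {p : ℕ × ℕ // p.1 ≠ p.2} =>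
          P.map (fun ω => (X p.1.1 ω, X p.1.2 ω))) := by
  have hm := hX.measurable
  have hgen : MeasurableSpace.generateFrom {s : Set Plane | MeasurableSet s ∧ volume s ≠ ∞}
      = (inferInstance : MeasurableSpace Plane) := by
    refine le_antisymm (MeasurableSpace.generateFrom_le fun s hs => hs.1) ?_
    intro s hs
    have : s = ⋃ n : ℕ, s ∩ Metric.ball 0 n := by
      rw [← Set.inter_iUnion, Metric.iUnion_ball_nat, Set.inter_univ]
    rw [this]
    refine MeasurableSet.iUnion fun n => MeasurableSpace.measurableSet_generateFrom
      ⟨hs.inter measurableSet_ball, ?_⟩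
    exact measure_ne_top_of_subset Set.inter_subset_right measure_ball_lt_top.ne
  have hpi : IsPiSystem {s : Set Plane | MeasurableSet s ∧ volume s ≠ ∞} := fun s hs t ht _ =>
    ⟨hs.1.inter ht.1, measure_ne_top_of_subset Set.inter_subset_left hs.2⟩
  have hspan : (ENNReal.ofReal lam • volume : Measure Plane).FiniteSpanningSetsIn
      {s : Set Plane | MeasurableSet s ∧ volume s ≠ ∞} :=
    { set := fun n => Metric.ball 0 n
      set_mem := fun n => ⟨measurableSet_ball, measure_ball_lt_top.ne⟩
      finite := fun n => by
        rw [Measure.smul_apply, smul_eq_mul]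
        exact ENNReal.mul_lt_top ENNReal.ofReal_lt_top measure_ball_lt_top
      spanning := Metric.iUnion_ball_nat 0 }
  refine Measure.prod_eq_generateFrom hgen hgen hpi hpi hspan hspan ?_
  rintro s ⟨hs, hs'⟩ t ⟨ht, ht'⟩
  rw [Measure.sum_apply _ (hs.prod ht)]
  have h1 := hX.lintegral_count_mul_count hlam hs hs' ht ht'
  have h2 : ∫⁻ ω, (pointCount (fun k => X k ω) s : ℝ≥0∞) * (pointCount (fun k => X k ω) t : ℝ≥0∞) ∂P
      = ∑' p : ℕ × ℕ, P ((fun ω => (X p.1 ω, X p.2 ω)) ⁻¹' (s ×ˢ t)) := by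
    simp only [pointCount_eq_tsum]
    have e : ∀ ω, (∑' k, s.indicator (1 : Plane → ℝ≥0∞) (X k ω)) * (∑' k, t.indicator 1 (X k ω))
        = ∑' p : ℕ × ℕ, ((fun ω => (X p.1 ω, X p.2 ω)) ⁻¹' (s ×ˢ t)).indicator 1 ω := by
      intro ω
      rw [ENNReal.tsum_prod (f := fun i j =>
        ((fun ω => (X i ω, X j ω)) ⁻¹' (s ×ˢ t)).indicator (1 : Ω → ℝ≥0∞) ω),
        ← ENNReal.tsum_mul_right]
      refine tsum_congr fun i => ?_
      rw [← ENNReal.tsum_mul_left]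
      refine tsum_congr fun j => ?_
      by_cases h1 : X i ω ∈ s <;> by_cases h2 : X j ω ∈ t <;> simp [h1, h2]
    simp only [e]
    have hms : ∀ p : ℕ × ℕ, MeasurableSet ((fun ω => (X p.1 ω, X p.2 ω)) ⁻¹' (s ×ˢ t)) :=
      fun p => ((hm p.1).prodMk (hm p.2)) (hs.prod ht)
    rw [lintegral_tsum fun p => (measurable_one.indicator (hms p)).aemeasurable]
    exact tsum_congr fun p => lintegral_indicator_one (hms p)
  have h3 : ∑' p : ℕ × ℕ, P ((fun ω => (X p.1 ω, X p.2 ω)) ⁻¹' (s ×ˢ t))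
      = ENNReal.ofReal lam * volume (s ∩ t)
        + ∑' p : {p : ℕ × ℕ // p.1 ≠ p.2}, P ((fun ω => (X p.1.1 ω, X p.1.2 ω)) ⁻¹' (s ×ˢ t)) := by
    rw [← ENNReal.summable.tsum_add_tsum_compl (s := {p : ℕ × ℕ | p.1 = p.2}) ENNReal.summable,
      ← hX.tsum_measure_eq hlam (hs.inter ht) (measure_ne_top_of_subset Set.inter_subset_left hs')]
    congr 1
    let e : ℕ ≃ {p : ℕ × ℕ | p.1 = p.2} :=
      { toFun := fun k => ⟨(k, k), rfl⟩
        invFun := fun p => p.1.1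
        left_inv := fun k => rfl
        right_inv := by
          rintro ⟨⟨i, j⟩, h⟩
          have hij : i = j := h
          subst hij
          rfl }
    rw [← e.tsum_eq]
    rfl
  rw [h2, h3, add_comm] at h1
  have h4 := (ENNReal.add_left_inj (ENNReal.mul_ne_top ENNReal.ofReal_ne_top
    (measure_ne_top_of_subset Set.inter_subset_left hs'))).1 h1
  simp only [Measure.smul_apply, smul_eq_mul]
  rw [← h4]
  refine tsum_congr fun p => ?_
  rw [Measure.map_apply ((hm _).prodMk (hm _)) (hs.prod ht)]

/-- The Campbell formula for pairs of distinct points. -/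
lemma tsum_lintegral_pairs (hX : IsHomogeneousPPP P lam X) (hlam : 0 < lam)
    {f : Plane × Plane → ℝ≥0∞} (hf : Measurable f) :
    ∑' k, ∑' j, (if j = k then 0 else ∫⁻ ω, f (X k ω, X j ω) ∂P)
      = ENNReal.ofReal lam * (ENNReal.ofReal lam * ∫⁻ x, ∫⁻ y, f (x, y)) := by
  have hm := hX.measurable
  have h : ∫⁻ p, f p ∂((ENNReal.ofReal lam • volume : Measure Plane).prod
      (ENNReal.ofReal lam • volume)) = ∫⁻ p, f p ∂(Measure.sum
        (fun p : {p : ℕ × ℕ // p.1 ≠ p.2} => P.map (fun ω => (X p.1.1 ω, X p.1.2 ω)))) := by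
    rw [hX.factorial_moment hlam]
  rw [lintegral_prod _ hf.aemeasurable, lintegral_smul_measure] at h
  simp only [lintegral_smul_measure, smul_eq_mul] at h
  rw [lintegral_const_mul _ hf.lintegral_prod_right'] at h
  rw [h, lintegral_sum_measure, ← ENNReal.tsum_prod (f := fun k j =>
    if j = k then 0 else ∫⁻ ω, f (X k ω, X j ω) ∂P)]
  have : ∀ p : {p : ℕ × ℕ // p.1 ≠ p.2}, ∫⁻ q, f q ∂(P.map (fun ω => (X p.1.1 ω, X p.1.2 ω)))
      = ∫⁻ ω, f (X p.1.1 ω, X p.1.2 ω) ∂P := fun p =>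
    lintegral_map hf ((hm _).prodMk (hm _))
  simp only [this]
  rw [show (∑' p : {p : ℕ × ℕ // p.1 ≠ p.2}, ∫⁻ ω, f (X p.1.1 ω, X p.1.2 ω) ∂P)
    = ∑' p : ℕ × ℕ, Set.indicator {p : ℕ × ℕ | p.1 ≠ p.2}
      (fun p => ∫⁻ ω, f (X p.1 ω, X p.2 ω) ∂P) p from
    tsum_subtype {p : ℕ × ℕ | p.1 ≠ p.2} (fun p => ∫⁻ ω, f (X p.1 ω, X p.2 ω) ∂P)]
  refine tsum_congr fun p => ?_
  by_cases h : p.2 = p.1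
  · simp [h]
  · simp [h, Ne.symm h]

end IsHomogeneousPPP

/-! ### Links with few interferers near the receiver -/

/-- The labels `j ≠ k` of the points within distance `r` of the location `x k + o`. -/
def nearLabels (x : ℕ → Plane) (k : ℕ) (o : Plane) (r : ℝ) : Set ℕ :=
  {j | j ≠ k ∧ dist (x k + o) (x j) ≤ r}

/-- A countable measurable partition of the plane into cells of small diameter. -/
lemma exists_cells {δ : ℝ} (hδ : 0 < δ) : ∃ (c : ℕ → Plane) (C : ℕ → Set Plane),
    (∀ i, MeasurableSet (C i)) ∧ (∀ i, C i ⊆ Metric.ball (c i) δ) ∧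
    Pairwise (fun i j => Disjoint (C i) (C j)) ∧ ⋃ i, C i = Set.univ := by
  let c := TopologicalSpace.denseSeq Plane
  refine ⟨c, disjointed fun i => Metric.ball (c i) δ,
    fun i => MeasurableSet.disjointed (fun i => measurableSet_ball) i,
    fun i => disjointed_subset _ i, disjoint_disjointed _, ?_⟩
  rw [iUnion_disjointed]
  refine Set.eq_univ_of_forall fun x => ?_
  obtain ⟨i, hi⟩ := (TopologicalSpace.denseRange_denseSeq Plane).exists_dist_lt x hδ
  exact Set.mem_iUnion.2 ⟨i, hi⟩

namespace IsHomogeneousPPP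
variable {Ω : Type*} [MeasurableSpace Ω] {P : Measure Ω} [IsProbabilityMeasure P] {lam : ℝ}
  {X : ℕ → Ω → Plane}

/-- Under the Palm law it is exponentially unlikely that there are fewer than `n` interferers within
distance `r` of the receiver at displacement `o`. The window is cut into cells of diameter at
most `r / 2`: points outside a cell are independent of the points inside. -/
lemma lintegral_tsum_few_le (hX : IsHomogeneousPPP P lam X) (hlam : 0 < lam) {A : Set Plane}
    (hA : MeasurableSet A) (hA' : volume A ≠ ∞) (o : Plane) {r : ℝ} (hr : 0 < r) (n : ℕ) :
    ∫⁻ ω, ∑' k, A.indicator 1 (X k ω) *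
        (if (nearLabels (fun k => X k ω) k o r).encard < n then 1 else 0) ∂P
      ≤ ENNReal.ofReal lam * volume A *
        ENNReal.ofReal (2 ^ n * Real.exp (-(lam * (Real.pi * r ^ 2 / 2)) / 2)) := by
  obtain ⟨c, C, hCm, hCb, hCd, hCu⟩ := exists_cells (show 0 < r / 4 by positivity)
  let D : ℕ → Set Plane := fun i => Metric.ball (c i + o) (3 * r / 4) \ Metric.ball (c i) (r / 4)
  have hDm : ∀ i, MeasurableSet (D i) := fun i => measurableSet_ball.diff measurableSet_ball
  have hD' : ∀ i, volume (D i) ≠ ∞ := fun i =>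
    measure_ne_top_of_subset Set.sdiff_subset measure_ball_lt_top.ne
  have hACm : ∀ i, MeasurableSet (A ∩ C i) := fun i => hA.inter (hCm i)
  have hAC' : ∀ i, volume (A ∩ C i) ≠ ∞ := fun i =>
    measure_ne_top_of_subset Set.inter_subset_left hA'
  have hdisj : ∀ i, Disjoint (A ∩ C i) (D i) := fun i =>
    Set.disjoint_sdiff_right.mono_left (Set.inter_subset_right.trans (hCb i))
  have hDvol : ∀ i, ENNReal.ofReal (Real.pi * r ^ 2 / 2) ≤ volume (D i) := by
    intro i
    refine le_trans ?_ le_measure_sdiff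
    rw [EuclideanSpace.volume_ball_fin_two, EuclideanSpace.volume_ball_fin_two,
      ← ENNReal.ofReal_pow (by positivity), ← ENNReal.ofReal_pow (by positivity),
      ← ENNReal.ofReal_mul (by positivity), ← ENNReal.ofReal_mul (by positivity),
      ← ENNReal.ofReal_sub _ (by positivity)]
    apply ENNReal.ofReal_le_ofReal
    apply le_of_eq
    ring
  have hcell : ∀ ω k i, X k ω ∈ A ∩ C i →
      pointCount (fun k => X k ω) (D i) ≤ (nearLabels (fun k => X k ω) k o r).encard := by
    intro ω k i hk
    refine Set.encard_le_encard fun j hj => ⟨?_, ?_⟩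
    · rintro rfl
      exact Set.disjoint_left.1 (hdisj i) hk hj
    · have h1 : dist (X k ω) (c i) < r / 4 := hCb i hk.2
      have h2 : dist (X j ω) (c i + o) < 3 * r / 4 := hj.1
      have h3 : dist (X k ω + o) (c i + o) = dist (X k ω) (c i) := dist_add_right _ _ _
      have h4 := dist_triangle_right (X k ω + o) (X j ω) (c i + o)
      change dist (X k ω + o) (X j ω) ≤ r
      linarith
  have hpt : ∀ ω k, A.indicator (1 : Plane → ℝ≥0∞) (X k ω) *
        (if (nearLabels (fun k => X k ω) k o r).encard < n then 1 else 0)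
      ≤ ∑' i, (A ∩ C i).indicator 1 (X k ω) *
        (if pointCount (fun k => X k ω) (D i) < n then 1 else 0) := by
    intro ω k
    by_cases hk : X k ω ∈ A
    · obtain ⟨i, hi⟩ := Set.mem_iUnion.1 (hCu ▸ Set.mem_univ (X k ω))
      refine le_trans ?_ (ENNReal.le_tsum i)
      have hki : X k ω ∈ A ∩ C i := ⟨hk, hi⟩
      rw [Set.indicator_of_mem hk, Set.indicator_of_mem hki]
      gcongr
      split_ifs with h1 h2
      · exact le_rfl
      · exact absurd ((hcell ω k i hki).trans_lt h1) h2
      · exact zero_le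
      · exact le_rfl
    · simp [hk]
  have hmN : ∀ i, Measurable (fun ω => (pointCount (fun k => X k ω) (A ∩ C i) : ℝ≥0∞)) := fun i =>
    (measurable_from_top (f := fun n : ℕ∞ => (n : ℝ≥0∞))).comp (hX.measurable_pointCount (hACm i))
  have hmF : ∀ i, Measurable (fun ω => if pointCount (fun k => X k ω) (D i) < n
      then (1 : ℝ≥0∞) else 0) := fun i =>
    (measurable_from_top (f := fun m : ℕ∞ => if m < n then (1 : ℝ≥0∞) else 0)).comp
      (hX.measurable_pointCount (hDm i))
  have hmNF : ∀ i, Measurable (fun ω => (pointCount (fun k => X k ω) (A ∩ C i) : ℝ≥0∞) *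
      (if pointCount (fun k => X k ω) (D i) < n then (1 : ℝ≥0∞) else 0)) := fun i =>
    (hmN i).mul (hmF i)
  calc _ ≤ ∫⁻ ω, ∑' i, (pointCount (fun k => X k ω) (A ∩ C i) : ℝ≥0∞) *
        (if pointCount (fun k => X k ω) (D i) < n then 1 else 0) ∂P := by
        refine lintegral_mono fun ω => (ENNReal.tsum_le_tsum (hpt ω)).trans_eq ?_
        rw [ENNReal.tsum_comm]
        refine tsum_congr fun i => ?_
        rw [ENNReal.tsum_mul_right, pointCount_eq_tsum]
    _ = ∑' i, meanCount lam (A ∩ C i) *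
        ∫⁻ ω, (if pointCount (fun k => X k ω) (D i) < n then 1 else 0) ∂P := by
        rw [lintegral_tsum fun i => (hmNF i).aemeasurable]
        refine tsum_congr fun i => ?_
        rw [← hX.lintegral_count (hACm i) (hAC' i)]
        exact lintegral_mul_eq_lintegral_mul_lintegral_of_indepFun''
          (hmN i).aemeasurable (hmF i).aemeasurable
          ((hX.indepFun_pointCount (hACm i) (hAC' i) (hDm i) (hD' i) (hdisj i)).comp
            (φ := fun n : ℕ∞ => (n : ℝ≥0∞)) (ψ := fun m : ℕ∞ => if m < n then (1 : ℝ≥0∞) else 0)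
            measurable_from_top measurable_from_top)
    _ ≤ ∑' i, ENNReal.ofReal lam * volume (A ∩ C i) *
        ENNReal.ofReal (2 ^ n * Real.exp (-(lam * (Real.pi * r ^ 2 / 2)) / 2)) := by
        refine ENNReal.tsum_le_tsum fun i => ?_
        rw [coe_meanCount hlam (hAC' i)]
        gcongr
        refine (hX.lintegral_few_le (hDm i) (hD' i) n).trans ?_
        gcongr
        rw [meanCount, Real.coe_toNNReal _ (by positivity)]
        gcongr
        exact (ENNReal.ofReal_le_iff_le_toReal (hD' i)).1 (hDvol i)
    _ = _ := by
        rw [ENNReal.tsum_mul_right, ENNReal.tsum_mul_left]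
        congr 2
        rw [← measure_iUnion (fun i j hij => (hCd hij).mono Set.inter_subset_right
          Set.inter_subset_right) hACm, ← Set.inter_iUnion, hCu, Set.inter_univ]

end IsHomogeneousPPP

/-! ### Integrals of power laws over the plane -/

/-- The constant in the integral of `‖z‖ ^ (-α)` over the complement of a disc. -/
noncomputable def tailConst (α : ℝ) : ℝ≥0∞ :=
  ∑' i : ℕ, ENNReal.ofReal (4 * Real.pi * (2 ^ (2 - α)) ^ i)

lemma tailConst_lt_top {α : ℝ} (hα : 2 < α) : tailConst α < ∞ := by
  have hq : (2 : ℝ) ^ (2 - α) < 1 := Real.rpow_lt_one_of_one_lt_of_neg (by norm_num) (by linarith)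
  have hs : Summable fun i : ℕ => 4 * Real.pi * ((2 : ℝ) ^ (2 - α)) ^ i :=
    (summable_geometric_of_lt_one (by positivity) hq).mul_left _
  rw [tailConst, ← ENNReal.ofReal_tsum_of_nonneg (fun i => by positivity) hs]
  exact ENNReal.ofReal_lt_top

/-- The mean power received from outside a disc, up to the density: it is finite because `α > 2`. -/
lemma lintegral_tail_le {α : ℝ} (hα : 2 < α) {ρ : ℝ} (hρ : 0 < ρ) (y : Plane) :
    ∫⁻ z, (if dist y z ≤ ρ then 0 else ENNReal.ofReal (dist y z ^ (-α)))
      ≤ tailConst α * ENNReal.ofReal (ρ ^ (2 - α)) := by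
  -- dyadic annuli
  have hpt : ∀ z : Plane, (if dist y z ≤ ρ then 0 else ENNReal.ofReal (dist y z ^ (-α)))
      ≤ ∑' i : ℕ, (Metric.closedBall y (2 ^ (i + 1) * ρ)).indicator
          (fun _ => ENNReal.ofReal ((2 ^ i * ρ) ^ (-α))) z := by
    intro z
    split_ifs with h
    · exact zero_le
    push Not at h
    obtain ⟨i, hi1, hi2⟩ := exists_nat_pow_near (show 1 ≤ dist y z / ρ by
      rw [le_div_iff₀ hρ]; linarith) (show (1 : ℝ) < 2 by norm_num)
    rw [le_div_iff₀ hρ] at hi1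
    rw [div_lt_iff₀ hρ] at hi2
    refine le_trans ?_ (ENNReal.le_tsum i)
    rw [Set.indicator_of_mem (by rw [Metric.mem_closedBall, dist_comm]; exact hi2.le)]
    apply ENNReal.ofReal_le_ofReal
    exact Real.rpow_le_rpow_of_nonpos (by positivity) hi1 (by linarith)
  calc _ ≤ ∫⁻ z, ∑' i : ℕ, (Metric.closedBall y (2 ^ (i + 1) * ρ)).indicator
          (fun _ => ENNReal.ofReal ((2 ^ i * ρ) ^ (-α))) z := lintegral_mono hpt
    _ = ∑' i : ℕ, ENNReal.ofReal ((2 ^ i * ρ) ^ (-α))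
          * volume (Metric.closedBall y (2 ^ (i + 1) * ρ)) := by
        rw [lintegral_tsum fun i =>
          (measurable_const.indicator measurableSet_closedBall).aemeasurable]
        exact tsum_congr fun i => lintegral_indicator_const measurableSet_closedBall _
    _ = _ := by
        rw [tailConst, ← ENNReal.tsum_mul_right]
        refine tsum_congr fun i => ?_
        rw [EuclideanSpace.volume_closedBall_fin_two, ← ENNReal.ofReal_pow (by positivity),
          ← ENNReal.ofReal_mul (by positivity), ← ENNReal.ofReal_mul (by positivity),
          ← ENNReal.ofReal_mul (by positivity)]
        congr 1
        have h2 : ((2 : ℝ) ^ (2 - α)) ^ i = (2 ^ i) ^ (2 - α) := by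
          rw [← Real.rpow_natCast, ← Real.rpow_mul (by norm_num), mul_comm,
            Real.rpow_mul (by norm_num), Real.rpow_natCast]
        have h3 : ∀ x : ℝ, 0 < x → x ^ (2 - α) = x ^ (-α) * x ^ 2 := by
          intro x hx
          rw [← Real.rpow_natCast x 2, ← Real.rpow_add hx]
          congr 1; push_cast; ring
        rw [h2, h3 _ (by positivity), h3 _ hρ, Real.mul_rpow (by positivity) hρ.le]
        ring

/-! ### The set of cancelled interferers -/

/-- Distance between the point `x j` and the receiver at displacement `o` from `x k`. -/
noncomputable def rxDist (x : ℕ → Plane) (k : ℕ) (o : Plane) (j : ℕ) : ℝ := dist (x k + o) (x j)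

/-- The set `LinkNetwork.cancelled` as a function of the configuration: the `L` nearest interferers
of link `k`, whose receiver has displacement `o`. -/
noncomputable def cancelledOf (x : ℕ → Plane) (k : ℕ) (o : Plane) (L : ℕ) : Set ℕ :=
  {j | ∃ ℓ : ℕ, ℓ < L ∧
    j = sInf {j : ℕ | j ≠ k ∧ {i : ℕ | i ≠ k ∧ rxDist x k o i < rxDist x k o j}.encard = (ℓ : ℕ∞)}}

lemma encard_cancelledOf_le (x : ℕ → Plane) (k : ℕ) (o : Plane) (L : ℕ) :
    (cancelledOf x k o L).encard ≤ L := by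
  have : cancelledOf x k o L = (fun ℓ : ℕ => sInf {j : ℕ | j ≠ k ∧
      {i : ℕ | i ≠ k ∧ rxDist x k o i < rxDist x k o j}.encard = (ℓ : ℕ∞)}) '' (Finset.range L) := by
    ext j
    simp [cancelledOf, eq_comm]
  rw [this]
  refine (Set.encard_image_le _ _).trans ?_
  rw [Set.encard_coe_eq_coe_finsetCard, Finset.card_range]

/-- In the absence of ties, all interferers in a disc that contains at most `L` of them are
cancelled. -/
lemma nearLabels_subset_cancelledOf {x : ℕ → Plane} {k : ℕ} {o : Plane} {L : ℕ} {r : ℝ}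
    (hinj : ∀ i j, i ≠ k → j ≠ k → rxDist x k o i = rxDist x k o j → i = j)
    (hr : (nearLabels x k o r).encard < (L + 1 : ℕ)) : nearLabels x k o r ⊆ cancelledOf x k o L := by
  intro j hj
  have hsub : ∀ j ∈ nearLabels x k o r,
      insert j {i : ℕ | i ≠ k ∧ rxDist x k o i < rxDist x k o j} ⊆ nearLabels x k o r := by
    intro j hj i hi
    rcases hi with rfl | hi
    · exact hj
    · exact ⟨hi.1, hi.2.le.trans hj.2⟩
  have hfin : (nearLabels x k o r).Finite := Set.finite_of_encard_le_coe hr.le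
  have hjfin : {i : ℕ | i ≠ k ∧ rxDist x k o i < rxDist x k o j}.Finite :=
    hfin.subset ((Set.subset_insert _ _).trans (hsub j hj))
  have hcard : {i : ℕ | i ≠ k ∧ rxDist x k o i < rxDist x k o j}.encard + 1 < (L + 1 : ℕ) := by
    rw [← Set.encard_insert_of_notMem (a := j) (by simp)]
    exact (Set.encard_le_encard (hsub j hj)).trans_lt hr
  obtain ⟨ℓ, hℓ⟩ := ENat.ne_top_iff_exists.1 (Set.encard_ne_top_iff.2 hjfin)
  rw [← hℓ] at hcard
  have hℓL : ℓ < L := by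
    have : ((ℓ + 1 : ℕ) : ℕ∞) < ((L + 1 : ℕ) : ℕ∞) := by exact_mod_cast hcard
    have := Nat.cast_lt.1 this
    omega
  refine ⟨ℓ, hℓL, ?_⟩
  have : {j : ℕ | j ≠ k ∧
      {i : ℕ | i ≠ k ∧ rxDist x k o i < rxDist x k o j}.encard = (ℓ : ℕ∞)} = {j} := by
    ext j'
    simp only [Set.mem_ofPred_eq, Set.mem_singleton_iff]
    constructor
    · rintro ⟨hk', hc⟩
      have key : ∀ a b, a ≠ k → rxDist x k o a < rxDist x k o b →
          {i : ℕ | i ≠ k ∧ rxDist x k o i < rxDist x k o a}.encard = (ℓ : ℕ∞) →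
          {i : ℕ | i ≠ k ∧ rxDist x k o i < rxDist x k o b}.encard = (ℓ : ℕ∞) → False := by
        intro a b ha hab h1 h2
        have hss : insert a {i : ℕ | i ≠ k ∧ rxDist x k o i < rxDist x k o a}
            ⊆ {i : ℕ | i ≠ k ∧ rxDist x k o i < rxDist x k o b} := by
          rintro i (rfl | hi)
          · exact ⟨ha, hab⟩
          · exact ⟨hi.1, hi.2.trans hab⟩
        have := Set.encard_le_encard hss
        rw [Set.encard_insert_of_notMem (by simp), h1, h2] at this
        have h3 : ((ℓ + 1 : ℕ) : ℕ∞) ≤ (ℓ : ℕ∞) := by exact_mod_cast this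
        have := Nat.cast_le.1 h3
        omega
      rcases lt_trichotomy (rxDist x k o j) (rxDist x k o j') with h | h | h
      · exact (key j j' hj.1 h hℓ.symm hc).elim
      · exact (hinj _ _ hj.1 hk' h).symm
      · exact (key j' j hk' h hc hℓ.symm).elim
    · rintro rfl
      exact ⟨hj.1, hℓ.symm⟩
  rw [this, csInf_singleton]

@[fun_prop]
lemma measurable_rxDist (k j : ℕ) :
    Measurable (fun p : (ℕ → Plane) × Plane => rxDist p.1 k p.2 j) := by
  unfold rxDist
  exact (((measurable_pi_apply k).comp measurable_fst).add measurable_snd).dist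
    ((measurable_pi_apply j).comp measurable_fst)

/-- The cardinality of a measurable random set of labels is measurable. -/
lemma measurable_encard_labels {α : Type*} [MeasurableSpace α] {S : α → Set ℕ}
    (hS : ∀ i, MeasurableSet {a | i ∈ S a}) : Measurable (fun a => (S a).encard) := by
  have hm : Measurable (fun a => ((S a).encard : ℝ≥0∞)) := by
    have : ∀ a, ((S a).encard : ℝ≥0∞) = ∑' i, {a | i ∈ S a}.indicator 1 a := by
      intro a
      rw [← ENNReal.tsum_set_one, tsum_subtype (S a) (fun _ => (1 : ℝ≥0∞))]
      rfl
    simp only [this]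
    exact Measurable.tsum fun i => measurable_one.indicator (hS i)
  refine measurable_to_countable' fun y => ?_
  have : (fun a => (S a).encard) ⁻¹' {y}
      = (fun a => ((S a).encard : ℝ≥0∞)) ⁻¹' {(y : ℝ≥0∞)} := by
    ext a; simp
  rw [this]
  exact hm (measurableSet_singleton _)

/-- The least element of a measurable random set of labels is measurable. -/
lemma measurableSet_sInf_eq {α : Type*} [MeasurableSpace α] {S : α → Set ℕ}
    (hS : ∀ i, MeasurableSet {a | i ∈ S a}) (j : ℕ) : MeasurableSet {a | j = sInf (S a)} := by
  have : {a | j = sInf (S a)} = ({a | j ∈ S a} ∩ ⋂ i ∈ Finset.range j, {a | i ∈ S a}ᶜ)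
      ∪ ({a | j = 0} ∩ ⋂ i, {a | i ∈ S a}ᶜ) := by
    ext a
    simp only [Set.mem_ofPred_eq, Set.mem_union, Set.mem_inter_iff, Set.mem_iInter, Set.mem_compl_iff,
      Finset.mem_range]
    constructor
    · rintro rfl
      by_cases h : (S a).Nonempty
      · exact Or.inl ⟨Nat.sInf_mem h, fun i hi => Nat.notMem_of_lt_sInf hi⟩
      · rw [Set.not_nonempty_iff_eq_empty] at h
        right
        simp [h]
    · rintro (⟨h1, h2⟩ | ⟨rfl, h2⟩)
      · refine le_antisymm ?_ (Nat.sInf_le h1)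
        by_contra hlt
        exact h2 _ (not_le.1 hlt) (Nat.sInf_mem ⟨j, h1⟩)
      · have : S a = ∅ := Set.eq_empty_of_forall_notMem h2
        simp [this]
  rw [this]
  refine ((hS j).inter (Finset.measurableSet_biInter _ fun i _ => (hS i).compl)).union
    ((MeasurableSet.const _).inter (MeasurableSet.iInter fun i => (hS i).compl))

lemma measurableSet_mem_cancelledOf (k L j : ℕ) :
    MeasurableSet {p : (ℕ → Plane) × Plane | j ∈ cancelledOf p.1 k p.2 L} := by
  have h1 : ∀ ℓ : ℕ, MeasurableSet {p : (ℕ → Plane) × Plane |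
      j = sInf {j : ℕ | j ≠ k ∧
        {i : ℕ | i ≠ k ∧ rxDist p.1 k p.2 i < rxDist p.1 k p.2 j}.encard = (ℓ : ℕ∞)}} := by
    intro ℓ
    refine measurableSet_sInf_eq (fun j => ?_) j
    refine (MeasurableSet.const (j ≠ k)).inter ?_
    have h2 : Measurable (fun p : (ℕ → Plane) × Plane =>
        {i : ℕ | i ≠ k ∧ rxDist p.1 k p.2 i < rxDist p.1 k p.2 j}.encard) :=
      measurable_encard_labels fun i => (MeasurableSet.const (i ≠ k)).inter
        (measurableSet_lt (measurable_rxDist k i) (measurable_rxDist k j))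
    exact h2 (measurableSet_singleton _)
  have : {p : (ℕ → Plane) × Plane | j ∈ cancelledOf p.1 k p.2 L}
      = ⋃ ℓ ∈ Finset.range L, {p : (ℕ → Plane) × Plane |
      j = sInf {j : ℕ | j ≠ k ∧
        {i : ℕ | i ≠ k ∧ rxDist p.1 k p.2 i < rxDist p.1 k p.2 j}.encard = (ℓ : ℕ∞)}} := by
    ext p
    simp [cancelledOf]
  rw [this]
  exact Finset.measurableSet_biUnion _ fun ℓ _ => h1 ℓ

lemma measurableSet_mem_nearLabels (k j : ℕ) (r : ℝ) :
    MeasurableSet {p : (ℕ → Plane) × Plane | j ∈ nearLabels p.1 k p.2 r} :=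
  (MeasurableSet.const (j ≠ k)).inter (measurableSet_le (measurable_rxDist k j) measurable_const)

/-! ### The first stream of a QR receiver -/

namespace IsQRDecomposition
variable {N M : ℕ} [NeZero N] [NeZero M] {H : Matrix (Fin N) (Fin M) ℂ}
  {Q : Matrix (Fin N) (Fin N) ℂ} {R : Matrix (Fin N) (Fin M) ℂ}

lemma col_zero (h : IsQRDecomposition H Q R) (i : Fin N) : H i 0 = Q i 0 * R 0 0 := by
  rw [h.2.2, Matrix.mul_apply, Finset.sum_eq_single 0]
  · intro j _ hj
    rw [h.2.1 j 0 (by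
      rw [Fin.val_zero]
      exact Nat.pos_of_ne_zero fun h0 => hj (Fin.ext (by simpa using h0))), mul_zero]
  · simp

omit [NeZero M] in
lemma nsq_col_zero (h : IsQRDecomposition H Q R) : nsq (fun i => Q i 0) = 1 := by
  have h1 := (Matrix.mem_unitaryGroup_iff'.1 h.1)
  have h2 := congrFun (congrFun h1 0) 0
  rw [Matrix.mul_apply, Matrix.one_apply_eq] at h2
  have h3 : ((nsq (fun i => Q i 0) : ℝ) : ℂ) = 1 := by
    rw [← h2, nsq, Complex.ofReal_sum]
    refine Finset.sum_congr rfl fun i _ => ?_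
    rw [Matrix.star_apply, RCLike.star_def, Complex.conj_mul']
    push_cast
    rfl
  exact_mod_cast h3

lemma norm_sq_R (h : IsQRDecomposition H Q R) : ‖R 0 0‖ ^ 2 = nsq (fun i => H i 0) := by
  have : nsq (fun i => H i 0) = nsq (fun i => Q i 0) * ‖R 0 0‖ ^ 2 := by
    simp only [nsq, h.col_zero, norm_mul, mul_pow, Finset.sum_mul]
  rw [this, h.nsq_col_zero, one_mul]

/-- The first row of `Q*` is a matched filter for the first column of `H`. -/
lemma norm_sq_mulVec (h : IsQRDecomposition H Q R) (hH : (fun i => H i 0) ≠ 0) (g : Fin N → ℂ) :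
    ‖(Q.conjTranspose.mulVec g) 0‖ ^ 2 = gain (fun i => H i 0) g := by
  have hn : nsq (fun i => H i 0) ≠ 0 := mt nsq_eq_zero.1 hH
  have e : herm (fun i => H i 0) g = star (R 0 0) * (Q.conjTranspose.mulVec g) 0 := by
    simp only [herm, h.col_zero, Matrix.mulVec, dotProduct, Matrix.conjTranspose_apply,
      Finset.mul_sum, star_mul']
    exact Finset.sum_congr rfl fun i _ => by ring
  rw [gain, e, norm_mul, mul_pow, norm_star, h.norm_sq_R, mul_div_cancel_left₀ _ hn]

end IsQRDecomposition

namespace ZFSIC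
variable {Ω : Type*} [MeasurableSpace Ω] {P : Measure Ω} {lam Rd : ℝ} {N L : ℕ} [NeZero N]
  {net : LinkNetwork P lam Rd N}

lemma signalGain_eq (rec : ZFSIC net L) (k : ℕ) (ω : Ω) :
    rec.signalGain k ω = nsq (net.h k k ω) :=
  (rec.isQR k ω).norm_sq_R

lemma interferenceGain_eq (rec : ZFSIC net L) {k : ℕ} {ω : Ω} (h : net.h k k ω ≠ 0) (j : ℕ) :
    rec.interferenceGain k j ω = gain (net.h k k ω) (net.h k j ω) :=
  (rec.isQR k ω).norm_sq_mulVec (show (fun i => net.channelMatrix L k ω i 0) ≠ 0 from h) _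

end ZFSIC

/-! ### Deterministic bounds on the SINR -/

lemma rxDist_nonneg (x : ℕ → Plane) (k : ℕ) (o : Plane) (j : ℕ) : 0 ≤ rxDist x k o j :=
  dist_nonneg

open Classical in
/-- The interference after cancellation, as a function with values in `[0, ∞]` of the configuration
and of the fading vectors at receiver `k`. -/
noncomputable def residualPower {N : ℕ} (x : ℕ → Plane) (k : ℕ) (o : Plane) (L : ℕ) (α : ℝ)
    (H : ℕ → Fin N → ℂ) : ℝ≥0∞ :=
  ∑' j, if j = k ∨ j ∈ cancelledOf x k o L then 0
    else ENNReal.ofReal (gain (H k) (H j)) * ENNReal.ofReal (rxDist x k o j ^ (-α))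

open Classical in
/-- The interference from outside a disc of radius `ρ` about receiver `k`. -/
noncomputable def farInterference {N : ℕ} (x : ℕ → Plane) (k : ℕ) (o : Plane) (ρ : ℝ) (α : ℝ)
    (H : ℕ → Fin N → ℂ) : ℝ≥0∞ :=
  ∑' j, if j = k then 0 else (if rxDist x k o j ≤ ρ then 0
    else ENNReal.ofReal (rxDist x k o j ^ (-α))) * ENNReal.ofReal (gain (H k) (H j))

namespace ZFSIC
variable {Ω : Type*} [MeasurableSpace Ω] {P : Measure Ω} {lam Rd : ℝ} {N L : ℕ} [NeZero N]
  {net : LinkNetwork P lam Rd N}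

open Classical in
/-- If the series diverges, then both sides are `0`. -/
lemma interference_eq (rec : ZFSIC net L) {k : ℕ} {ω : Ω} (h : net.h k k ω ≠ 0) (α : ℝ) :
    rec.interference α k ω =
      (residualPower (fun j => net.tx j ω) k (net.offset k ω) L α (fun j => net.h k j ω)).toReal := by
  rw [interference, residualPower, ENNReal.tsum_toReal_eq]
  · refine tsum_congr fun j => ?_
    rw [rec.interferenceGain_eq h]
    change (if j = k ∨ j ∈ cancelledOf (fun j => net.tx j ω) k (net.offset k ω) L then _ else
      _ * rxDist (fun j => net.tx j ω) k (net.offset k ω) j ^ (-α)) = _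
    split_ifs
    · simp
    · rw [ENNReal.toReal_mul, ENNReal.toReal_ofReal (gain_nonneg _ _), ENNReal.toReal_ofReal
        (Real.rpow_nonneg (rxDist_nonneg _ _ _ _) _)]
  · intro j
    split_ifs
    · simp
    · exact ENNReal.mul_ne_top ENNReal.ofReal_ne_top ENNReal.ofReal_ne_top

omit [NeZero N] in
lemma d_self (k : ℕ) (ω : Ω) : net.d k k ω = ‖net.offset k ω‖ := by
  simp [LinkNetwork.d, LinkNetwork.rx]

/-- The offset has norm at least `1`, so the path loss of the direct link is at most `1`. If the
residual power is `0` or `∞`, the SINR is `0`. -/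
lemma sinr_le (rec : ZFSIC net L) {k : ℕ} {ω : Ω} (h : net.h k k ω ≠ 0) {α : ℝ} (hα : 0 ≤ α)
    (ho : net.offset k ω ∈ annulus Rd) :
    ENNReal.ofReal (rec.sinr α 0 k ω) ≤ ENNReal.ofReal (nsq (net.h k k ω)) *
      (residualPower (fun j => net.tx j ω) k (net.offset k ω) L α (fun j => net.h k j ω))⁻¹ := by
  set I := residualPower (fun j => net.tx j ω) k (net.offset k ω) L α (fun j => net.h k j ω) with hI
  rw [sinr, rec.interference_eq h, add_zero, ← hI, rec.signalGain_eq, d_self]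
  have hd : ‖net.offset k ω‖ ^ (-α) ≤ 1 :=
    Real.rpow_le_one_of_one_le_of_nonpos ho.1 (by linarith)
  have hn : 0 < nsq (net.h k k ω) := (nsq_nonneg _).lt_of_ne' (mt nsq_eq_zero.1 h)
  by_cases h0 : I = 0
  · rw [h0, ENNReal.inv_zero, ENNReal.mul_top (by simpa using hn)]
    exact le_top
  by_cases ht : I = ∞
  · simp [ht]
  rw [ENNReal.ofReal_div_of_pos (ENNReal.toReal_pos h0 ht), ENNReal.ofReal_toReal ht,
    div_eq_mul_inv]
  gcongr
  exact mul_le_of_le_one_right hn.le hd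

/-- If few interferers are close to the receiver and the others have little total power, then the
SINR is large. -/
lemma le_sinr (rec : ZFSIC net L) {k : ℕ} {ω : Ω} (h : net.h k k ω ≠ 0) {α : ℝ} (hα : 0 ≤ α)
    (ho : net.offset k ω ∈ annulus Rd)
    (hinj : ∀ i j, i ≠ k → j ≠ k → net.d k i ω = net.d k j ω → i = j)
    (hpos : ∀ j, j ≠ k → 0 < net.d k j ω)
    (hgain : ∀ j, j ≠ k → 0 < gain (net.h k k ω) (net.h k j ω)) {ρ S M : ℝ} (hM : 0 < M)
    (hS : S ≤ nsq (net.h k k ω))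
    (hnear : (nearLabels (fun j => net.tx j ω) k (net.offset k ω) ρ).encard < (L + 1 : ℕ))
    (hfar : farInterference (fun j => net.tx j ω) k (net.offset k ω) ρ α (fun j => net.h k j ω)
      ≤ ENNReal.ofReal M) :
    S * Rd ^ (-α) / M ≤ rec.sinr α 0 k ω := by
  set x := fun j => net.tx j ω
  set o := net.offset k ω
  set I := residualPower x k o L α (fun j => net.h k j ω) with hI
  have hsub := nearLabels_subset_cancelledOf (x := x) (k := k) (o := o) hinj hnear
  have hIM : I ≤ ENNReal.ofReal M := by
    refine le_trans (ENNReal.tsum_le_tsum fun j => ?_) hfar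
    by_cases hjk : j = k
    · simp [hjk]
    by_cases hj : rxDist x k o j ≤ ρ
    · have : j ∈ cancelledOf x k o L := hsub ⟨hjk, hj⟩
      simp [this]
    · simp only [hjk, hj, if_false, false_or]
      split_ifs
      · exact zero_le
      · rw [mul_comm]
  -- a vanishing interference would make the quotient `0`; some interferer is not cancelled
  have hI0 : I ≠ 0 := by
    have hfin : (insert k (cancelledOf x k o L)).Finite :=
      (Set.finite_of_encard_le_coe (encard_cancelledOf_le x k o L)).insert k
    obtain ⟨j, hj⟩ := hfin.exists_notMem
    have hjk : j ≠ k := fun h => hj (Or.inl h)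
    have hjc : j ∉ cancelledOf x k o L := fun h => hj (Or.inr h)
    intro h0
    have := ENNReal.tsum_eq_zero.1 h0 j
    rw [if_neg (by tauto), ← ENNReal.ofReal_mul (gain_nonneg _ _), ENNReal.ofReal_eq_zero] at this
    have h1 : 0 < gain (net.h k k ω) (net.h k j ω) * rxDist x k o j ^ (-α) :=
      mul_pos (hgain j hjk) (Real.rpow_pos_of_pos (hpos j hjk) _)
    linarith
  have hIt : I ≠ ∞ := (hIM.trans_lt ENNReal.ofReal_lt_top).ne
  have hIr : I.toReal ≤ M := ENNReal.toReal_le_of_le_ofReal hM.le hIM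
  rw [sinr, rec.interference_eq h, add_zero, rec.signalGain_eq, d_self]
  have hd : Rd ^ (-α) ≤ ‖o‖ ^ (-α) :=
    Real.rpow_le_rpow_of_nonpos (by linarith [ho.1]) ho.2 (by linarith)
  have hR : 0 ≤ Rd ^ (-α) := Real.rpow_nonneg (by linarith [ho.1, ho.2]) _
  change _ ≤ nsq (net.h k k ω) * ‖o‖ ^ (-α) / I.toReal
  have hIp := ENNReal.toReal_pos hI0 hIt
  gcongr
  · exact mul_nonneg (nsq_nonneg _) (Real.rpow_nonneg (norm_nonneg _) _)
  · exact nsq_nonneg _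

end ZFSIC

/-- The residual interference is at least the power of any family of interferers that are not
cancelled, computed at the largest distance. -/
lemma le_residualPower {N : ℕ} {x : ℕ → Plane} {k : ℕ} {o : Plane} {L : ℕ} {α r : ℝ} (hα : 0 ≤ α)
    (H : ℕ → Fin N → ℂ) {T : Finset ℕ}
    (hT : ∀ j ∈ T, j ∈ nearLabels x k o r ∧ j ∉ cancelledOf x k o L)
    (hpos : ∀ j ∈ T, 0 < rxDist x k o j) :
    ENNReal.ofReal (r ^ (-α)) * ∑ j ∈ T, ENNReal.ofReal (gain (H k) (H j))
      ≤ residualPower x k o L α H := by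
  refine le_trans ?_ (ENNReal.sum_le_tsum T)
  rw [Finset.mul_sum]
  refine Finset.sum_le_sum fun j hj => ?_
  rw [if_neg (not_or.2 ⟨(hT j hj).1.1, (hT j hj).2⟩), mul_comm]
  exact mul_le_mul_right (ENNReal.ofReal_le_ofReal
    (Real.rpow_le_rpow_of_nonpos (hpos j hj) (hT j hj).1.2 (by linarith))) _

/-! ### Independence and general position in the network -/

/-- If `X` is independent of `(Y, Z)` and `Y` of `Z`, then `(X, Y)` is independent of `Z`. -/
lemma indepFun_assoc {Ω α β γ : Type*} [MeasurableSpace Ω] {P : Measure Ω}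
    [IsProbabilityMeasure P] [MeasurableSpace α] [MeasurableSpace β] [MeasurableSpace γ]
    {X : Ω → α} {Y : Ω → β} {Z : Ω → γ} (hX : Measurable X) (hY : Measurable Y) (hZ : Measurable Z)
    (h1 : IndepFun X (fun ω => (Y ω, Z ω)) P) (h2 : IndepFun Y Z P) :
    IndepFun (fun ω => (X ω, Y ω)) Z P := by
  have := Measure.isProbabilityMeasure_map (μ := P) hX.aemeasurable
  have := Measure.isProbabilityMeasure_map (μ := P) hY.aemeasurable
  have := Measure.isProbabilityMeasure_map (μ := P) hZ.aemeasurable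
  have h3 : IndepFun X Y P := h1.comp measurable_id measurable_fst
  rw [indepFun_iff_map_prod_eq_prod_map_map (hX.prodMk hY).aemeasurable hZ.aemeasurable]
  rw [indepFun_iff_map_prod_eq_prod_map_map hX.aemeasurable (hY.prodMk hZ).aemeasurable,
    (indepFun_iff_map_prod_eq_prod_map_map hY.aemeasurable hZ.aemeasurable).1 h2] at h1
  rw [(indepFun_iff_map_prod_eq_prod_map_map hX.aemeasurable hY.aemeasurable).1 h3]
  rw [← (MeasurableEquiv.prodAssoc).map_measurableEquiv_injective.eq_iff, Measure.prodAssoc_prod,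
    ← h1, Measure.map_map (MeasurableEquiv.measurable _) ((hX.prodMk hY).prodMk hZ)]
  rfl

lemma annulus_measurableSet (Rd : ℝ) : MeasurableSet (annulus Rd) :=
  (measurableSet_le measurable_const measurable_norm).inter
    (measurableSet_le measurable_norm measurable_const)

namespace LinkNetwork
variable {Ω : Type*} [MeasurableSpace Ω] {P : Measure Ω} [IsProbabilityMeasure P] {lam Rd : ℝ}
  {N : ℕ} (net : LinkNetwork P lam Rd N)

omit [IsProbabilityMeasure P] in
lemma isFading (k : ℕ) : IsFading P (fun l => net.h k l) where
  meas := net.measurable_h k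
  law := net.law_h k
  indep := net.indep_h.precomp (g := fun p : ℕ × Fin N => (k, p)) (fun a b h => by simpa using h)

omit [IsProbabilityMeasure P] in
lemma measurable_tx : Measurable (fun ω k => net.tx k ω) :=
  measurable_pi_iff.2 net.ppp.measurable

omit [IsProbabilityMeasure P] in
lemma measurable_fading (k : ℕ) : Measurable (fun ω l => net.h k l ω) :=
  measurable_pi_iff.2 (net.measurable_h k)

omit [IsProbabilityMeasure P] in
lemma indep_tx_offset (k : ℕ) : IndepFun (fun ω k => net.tx k ω) (net.offset k) P :=
  net.indep_tx_marks.comp measurable_id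
    ((measurable_pi_apply k).comp measurable_fst)

lemma indep_config_fading (k : ℕ) :
    IndepFun (fun ω => ((fun j => net.tx j ω), net.offset k ω)) (fun ω l => net.h k l ω) P := by
  refine indepFun_assoc net.measurable_tx (net.measurable_offset k) (net.measurable_fading k) ?_ ?_
  · exact net.indep_tx_marks.comp measurable_id
      (((measurable_pi_apply k).comp measurable_fst).prodMk
        ((measurable_pi_apply k).comp measurable_snd))
  · exact net.indep_offset_h.comp (measurable_pi_apply k) (measurable_pi_apply k)

omit [IsProbabilityMeasure P] in
/-- The law of the offsets is absolutely continuous. -/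
lemma ae_offset_notMem (k : ℕ) {S : Set Plane} (hS : volume S = 0) :
    ∀ᵐ ω ∂P, net.offset k ω ∉ S := by
  have h1 : P.map (net.offset k) S = 0 := by
    rw [net.law_offset k]
    exact cond_absolutelyContinuous hS
  exact ae_of_ae_map (net.measurable_offset k).aemeasurable (measure_eq_zero_iff_ae_notMem.1 h1)

lemma ae_offset_mem (k : ℕ) : ∀ᵐ ω ∂P, net.offset k ω ∈ annulus Rd := by
  have := Measure.isProbabilityMeasure_map (μ := P) (net.measurable_offset k).aemeasurable
  have h1 : P.map (net.offset k) (annulus Rd)ᶜ = 0 := by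
    rw [net.law_offset k, cond_apply (annulus_measurableSet Rd)]
    simp
  filter_upwards [ae_of_ae_map (net.measurable_offset k).aemeasurable
    (measure_eq_zero_iff_ae_notMem.1 h1)] with ω hω
  exact not_not.1 hω

/-- Almost surely no two transmitters coincide. -/
lemma ae_tx_ne (hlam : 0 < lam) {i j : ℕ} (hij : j ≠ i) : ∀ᵐ ω ∂P, net.tx i ω ≠ net.tx j ω := by
  have hm := net.ppp.measurable
  have hD : MeasurableSet {p : Plane × Plane | p.1 = p.2} :=
    measurableSet_eq_fun measurable_fst measurable_snd
  have h := net.ppp.tsum_lintegral_pairs hlam (f := {p : Plane × Plane | p.1 = p.2}.indicator 1)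
    (measurable_one.indicator hD)
  have h0 : ∀ x : Plane, ∫⁻ y, {p : Plane × Plane | p.1 = p.2}.indicator 1 (x, y) = (0 : ℝ≥0∞) := by
    intro x
    have : ∀ y, {p : Plane × Plane | p.1 = p.2}.indicator (1 : Plane × Plane → ℝ≥0∞) (x, y)
        = ({x} : Set Plane).indicator 1 y := by
      intro y
      by_cases hxy : x = y
      · simp [hxy]
      · simp [hxy, Ne.symm hxy]
    simp only [this]
    rw [lintegral_indicator_one (measurableSet_singleton x), measure_singleton]
  simp only [h0, lintegral_zero, mul_zero] at h
  have h1 := ENNReal.tsum_eq_zero.1 (ENNReal.tsum_eq_zero.1 h i) j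
  rw [if_neg hij] at h1
  have h2 := (lintegral_eq_zero_iff
    ((measurable_one.indicator hD).comp ((hm i).prodMk (hm j)))).1 h1
  filter_upwards [h2] with ω hω he
  simp [he] at hω

/-- Almost surely no interferer sits exactly at a receiver. -/
lemma ae_d_pos (k j : ℕ) : ∀ᵐ ω ∂P, 0 < net.d k j ω := by
  refine ae_of_indepFun (p := fun (x : ℕ → Plane) o => 0 < rxDist x k o j) net.measurable_tx
    (net.measurable_offset k) (net.indep_tx_offset k)
    (measurableSet_lt measurable_const (measurable_rxDist k j)) (ae_of_all _ fun ω => ?_)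
  filter_upwards [net.ae_offset_notMem k (measure_singleton (net.tx j ω - net.tx k ω))] with ω' hω'
  rw [rxDist, dist_pos]
  intro he
  exact hω' (eq_sub_of_add_eq' he)

/-- Almost surely there are no ties between the distances to a receiver. -/
lemma ae_d_ne (hlam : 0 < lam) (k : ℕ) {i j : ℕ} (hij : j ≠ i) :
    ∀ᵐ ω ∂P, net.d k i ω ≠ net.d k j ω := by
  refine ae_of_indepFun (p := fun (x : ℕ → Plane) o => rxDist x k o i ≠ rxDist x k o j)
    net.measurable_tx (net.measurable_offset k) (net.indep_tx_offset k)
    (measurableSet_eq_fun (measurable_rxDist k i) (measurable_rxDist k j)).compl ?_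
  filter_upwards [net.ae_tx_ne hlam hij] with ω hω
  -- a tie means that the receiver lies on a perpendicular bisector, a null set
  have h0 : volume (AffineSubspace.perpBisector (net.tx i ω - net.tx k ω)
      (net.tx j ω - net.tx k ω) : Set Plane) = 0 := by
    refine Measure.addHaar_affineSubspace _ _ fun htop => hω ?_
    rw [AffineSubspace.perpBisector_eq_top] at htop
    exact sub_left_injective htop
  filter_upwards [net.ae_offset_notMem k h0] with ω' hω' he
  refine hω' (AffineSubspace.mem_perpBisector_iff_dist_eq.2 ?_)
  have e : ∀ l, rxDist (fun k => net.tx k ω) k (net.offset k ω') l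
      = dist (net.offset k ω') (net.tx l ω - net.tx k ω) := by
    intro l
    rw [rxDist, dist_eq_norm, dist_eq_norm]
    congr 1
    abel
  rw [← e, ← e]
  exact he

/-- The properties that hold almost surely and make the SINR well defined. -/
lemma ae_generalPosition [NeZero N] (hlam : 0 < lam) : ∀ᵐ ω ∂P, ∀ k,
    net.h k k ω ≠ 0 ∧ net.offset k ω ∈ annulus Rd ∧
    (∀ i j, i ≠ k → j ≠ k → net.d k i ω = net.d k j ω → i = j) ∧
    (∀ j, 0 < net.d k j ω) ∧
    (∀ j, j ≠ k → 0 < gain (net.h k k ω) (net.h k j ω)) := by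
  refine ae_all_iff.2 fun k => ?_
  have h1 : ∀ᵐ ω ∂P, ∀ i j, j ≠ i → net.d k i ω ≠ net.d k j ω :=
    ae_all_iff.2 fun i => ae_all_iff.2 fun j => ae_all_iff.2 fun hij => net.ae_d_ne hlam k hij
  have h2 : ∀ᵐ ω ∂P, ∀ j, 0 < net.d k j ω := ae_all_iff.2 fun j => net.ae_d_pos k j
  have h3 : ∀ᵐ ω ∂P, ∀ j, j ≠ k → 0 < gain (net.h k k ω) (net.h k j ω) :=
    ae_all_iff.2 fun j => ae_all_iff.2 fun hj => (net.isFading k).ae_gain_pos hj.symm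
  filter_upwards [(net.isFading k).ae_ne_zero k, net.ae_offset_mem k, h1, h2, h3]
    with ω g1 g2 g3 g4 g5
  refine ⟨g1, g2, fun i j _ _ hd => ?_, g4, g5⟩
  by_contra hne
  exact g3 i j (Ne.symm hne) hd

end LinkNetwork

/-! ### The Palm mean of the SINR -/

lemma measurable_residualPower {N : ℕ} (k L : ℕ) (α : ℝ) :
    Measurable (fun p : ((ℕ → Plane) × Plane) × (ℕ → Fin N → ℂ) =>
      residualPower p.1.1 k p.1.2 L α p.2) := by
  unfold residualPower
  refine Measurable.tsum fun j => ?_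
  refine Measurable.ite ?_ measurable_const ?_
  · exact (MeasurableSet.const (j = k)).union
      (measurable_fst (measurableSet_mem_cancelledOf k L j))
  · exact (show Measurable fun p : ((ℕ → Plane) × Plane) × (ℕ → Fin N → ℂ) =>
        gain (p.2 k) (p.2 j) by fun_prop).ennreal_ofReal.mul
      (((measurable_rxDist k j).comp measurable_fst).pow_const _).ennreal_ofReal

section
variable {Ω : Type*} [MeasurableSpace Ω] {P : Measure Ω} [IsProbabilityMeasure P] {N : ℕ}
  [NeZero N]

/-- Given the locations, if there are at least `4 N` interferers within distance `r` then at least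
`3 N` of them are not cancelled, and they bound the mean of the SINR. -/
lemma IsFading.lintegral_nsq_div_residualPower_le {H : ℕ → Ω → Fin N → ℂ} (hH : IsFading P H)
    {x : ℕ → Plane} {k : ℕ} {o : Plane} {L : ℕ} (hL : L ≤ N) {α r : ℝ} (hα : 0 ≤ α) (hr : 0 < r)
    (hpos : ∀ j, 0 < rxDist x k o j) (hnear : ((4 * N : ℕ) : ℕ∞) ≤ (nearLabels x k o r).encard) :
    ∫⁻ ω, ENNReal.ofReal (nsq (H k ω)) * (residualPower x k o L α (fun j => H j ω))⁻¹ ∂P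
      ≤ ENNReal.ofReal (r ^ α) * negMoment ^ 3 := by
  have hN : 0 < N := Nat.pos_of_ne_zero (NeZero.ne N)
  have h1 : ((3 * N : ℕ) : ℕ∞) ≤ (nearLabels x k o r \ cancelledOf x k o L).encard := by
    have h2 := Set.encard_le_encard_sdiff_add_encard (nearLabels x k o r) (cancelledOf x k o L)
    have h3 := encard_cancelledOf_le x k o L
    have h4 : ((4 * N : ℕ) : ℕ∞) ≤ (nearLabels x k o r \ cancelledOf x k o L).encard + (N : ℕ) :=
      hnear.trans (h2.trans (by gcongr; exact h3.trans (by exact_mod_cast hL)))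
    have h5 : ((3 * N : ℕ) : ℕ∞) + (N : ℕ) ≤
        (nearLabels x k o r \ cancelledOf x k o L).encard + (N : ℕ) := by
      refine le_trans (le_of_eq ?_) h4
      rw [← Nat.cast_add]
      congr 1
      ring
    exact (ENat.add_le_add_iff_right (ENat.natCast_ne_top N)).1 h5
  obtain ⟨T', hT', hcard⟩ := Set.exists_subset_encard_eq h1
  have hfin : T'.Finite := Set.finite_of_encard_eq_coe hcard
  set T := hfin.toFinset with hTdef
  have hTc : T.card = 3 * N := by
    rw [hfin.encard_eq_coe_toFinset_card] at hcard
    exact_mod_cast hcard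
  have hT : ∀ j ∈ T, j ∈ nearLabels x k o r ∧ j ∉ cancelledOf x k o L := fun j hj =>
    hT' (hfin.mem_toFinset.1 hj)
  have hk : k ∉ T := fun h => (hT k h).1.1 rfl
  have hr1 : (ENNReal.ofReal (r ^ (-α)))⁻¹ = ENNReal.ofReal (r ^ α) := by
    rw [← ENNReal.ofReal_inv_of_pos (by positivity), ← Real.rpow_neg hr.le, neg_neg]
  calc _ ≤ ∫⁻ ω, ENNReal.ofReal (r ^ α) * (ENNReal.ofReal (nsq (H k ω)) *
        (∑ j ∈ T, ENNReal.ofReal (gain (H k ω) (H j ω)))⁻¹) ∂P := by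
        refine lintegral_mono fun ω => ?_
        have h2 := le_residualPower hα (fun j => H j ω) hT fun j _ => hpos j
        have h3 := ENNReal.inv_le_inv.2 h2
        rw [ENNReal.mul_inv (Or.inr (by simp)) (Or.inl ENNReal.ofReal_ne_top), hr1] at h3
        calc _ ≤ ENNReal.ofReal (nsq (H k ω)) * _ := mul_le_mul_right h3 _
          _ = _ := by ring
    _ = ENNReal.ofReal (r ^ α) * ∫⁻ ω, (ENNReal.ofReal (nsq (H k ω)) *
        (∑ j ∈ T, ENNReal.ofReal (gain (H k ω) (H j ω)))⁻¹) ∂P :=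
        lintegral_const_mul' _ _ ENNReal.ofReal_ne_top
    _ ≤ ENNReal.ofReal (r ^ α) * (N * ((T.card : ℝ≥0∞)⁻¹ * negMoment ^ 3)) := by
        gcongr
        exact hH.lintegral_nsq_mul_inv_le hk (by omega)
    _ ≤ _ := by
        gcongr
        rw [hTc, ← mul_assoc]
        refine mul_le_of_le_one_left zero_le ?_
        rw [← div_eq_mul_inv]
        refine ENNReal.div_le_of_le_mul ?_
        rw [one_mul]
        exact_mod_cast (by omega : N ≤ 3 * N)

/-- The conditional mean of the SINR given the locations, bounded through the first of the radii
`2 ^ i * r` at which there are at least `4 N` interferers. -/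
lemma IsFading.lintegral_nsq_div_residualPower_le_tsum {H : ℕ → Ω → Fin N → ℂ} (hH : IsFading P H)
    {x : ℕ → Plane} {k : ℕ} {o : Plane} {L : ℕ} (hL : L ≤ N) {α r : ℝ} (hα : 0 ≤ α) (hr : 0 < r)
    (hpos : ∀ j, 0 < rxDist x k o j) :
    ∫⁻ ω, ENNReal.ofReal (nsq (H k ω)) * (residualPower x k o L α (fun j => H j ω))⁻¹ ∂P
      ≤ (negMoment ^ 3 + 1) * (ENNReal.ofReal (r ^ α) +
        ∑' i : ℕ, ENNReal.ofReal ((2 ^ (i + 1) * r) ^ α) *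
          (if (nearLabels x k o (2 ^ i * r)).encard < (4 * N : ℕ) then 1 else 0)) := by
  have hK : negMoment ^ 3 ≤ negMoment ^ 3 + 1 := le_self_add
  by_cases hex : ∃ i : ℕ, ((4 * N : ℕ) : ℕ∞) ≤ (nearLabels x k o (2 ^ i * r)).encard
  · classical
    have hi := Nat.find_spec hex
    have hmin := fun m => Nat.find_min hex (m := m)
    generalize Nat.find hex = i at hi hmin
    refine (hH.lintegral_nsq_div_residualPower_le hL hα (by positivity) hpos hi).trans ?_
    rw [mul_comm]
    refine mul_le_mul' hK ?_
    cases i with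
    | zero => simp
    | succ m =>
      refine le_trans ?_ le_add_self
      refine le_trans ?_ (ENNReal.le_tsum m)
      rw [if_pos (not_le.1 (hmin m (Nat.lt_succ_self m))), mul_one]
  · push Not at hex
    have : ∑' i : ℕ, ENNReal.ofReal ((2 ^ (i + 1) * r) ^ α) *
          (if (nearLabels x k o (2 ^ i * r)).encard < (4 * N : ℕ) then 1 else 0) = ∞ := by
      rw [eq_top_iff, ← ENNReal.tsum_const_eq_top_of_ne_zero (α := ℕ) (c := ENNReal.ofReal (r ^ α))
        (by rw [Ne, ENNReal.ofReal_eq_zero, not_le]; positivity)]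
      refine ENNReal.tsum_le_tsum fun i => ?_
      rw [if_pos (hex i), mul_one]
      apply ENNReal.ofReal_le_ofReal
      gcongr
      exact le_mul_of_one_le_left hr.le (one_le_pow₀ (by norm_num))
    rw [this, add_top, ENNReal.mul_top (by simp)]
    exact le_top

end

namespace LinkNetwork
variable {Ω : Type*} [MeasurableSpace Ω] {P : Measure Ω} [IsProbabilityMeasure P] {lam Rd : ℝ}
  {N : ℕ} (net : LinkNetwork P lam Rd N)

/-- A bound that holds for every common deterministic offset also holds for the random offsets:
these are independent of the transmitters and all have the same law. -/
lemma tsum_lintegral_offset_le {g : ℕ → (ℕ → Plane) × Plane → ℝ≥0∞} (hg : ∀ k, Measurable (g k))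
    {C : ℝ≥0∞} (hC : ∀ o, ∑' k, ∫⁻ ω, g k ((fun j => net.tx j ω), o) ∂P ≤ C) :
    ∑' k, ∫⁻ ω, g k ((fun j => net.tx j ω), net.offset k ω) ∂P ≤ C := by
  have hφ : ∀ k, Measurable (fun o => ∫⁻ ω, g k ((fun j => net.tx j ω), o) ∂P) := fun k =>
    Measurable.lintegral_prod_right' (f := fun p : Plane × Ω => g k ((fun j => net.tx j p.2), p.1))
      ((hg k).comp ((net.measurable_tx.comp measurable_snd).prodMk measurable_fst))
  have h1 : ∀ k, ∫⁻ ω, g k ((fun j => net.tx j ω), net.offset k ω) ∂P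
      = ∫⁻ o, ∫⁻ ω, g k ((fun j => net.tx j ω), o) ∂P ∂(cond volume (annulus Rd)) := by
    intro k
    rw [← net.law_offset k, lintegral_map (hφ k) (net.measurable_offset k)]
    exact lintegral_indepFun (F := fun p : Plane × (ℕ → Plane) => g k (p.2, p.1))
      (net.measurable_offset k) net.measurable_tx (net.indep_tx_offset k).symm
      ((hg k).comp (measurable_snd.prodMk measurable_fst))
  have := Measure.isProbabilityMeasure_map (μ := P) (net.measurable_offset 0).aemeasurable
  rw [net.law_offset 0] at this
  simp only [h1]
  rw [← lintegral_tsum fun k => (hφ k).aemeasurable]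
  calc _ ≤ ∫⁻ _, C ∂(cond volume (annulus Rd)) := lintegral_mono hC
    _ = C := by simp

lemma measurable_few (k n : ℕ) (r : ℝ) :
    Measurable (fun p : (ℕ → Plane) × Plane =>
      if (nearLabels p.1 k p.2 r).encard < n then (1 : ℝ≥0∞) else 0) :=
  (measurable_from_top (f := fun m : ℕ∞ => if m < n then (1 : ℝ≥0∞) else 0)).comp
    (measurable_encard_labels fun j => measurableSet_mem_nearLabels k j r)

lemma measurable_indicator_tx {A : Set Plane} (hA : MeasurableSet A) (k : ℕ) :
    Measurable (fun p : (ℕ → Plane) × Plane => A.indicator (1 : Plane → ℝ≥0∞) (p.1 k)) :=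
  (measurable_one.indicator hA).comp ((measurable_pi_apply k).comp measurable_fst)

omit [IsProbabilityMeasure P] in
lemma measurable_indicator_mul_few {A : Set Plane} (hA : MeasurableSet A) (k n : ℕ) (r : ℝ) :
    Measurable (fun ω => A.indicator (1 : Plane → ℝ≥0∞) (net.tx k ω) *
      (if (nearLabels (fun j => net.tx j ω) k (net.offset k ω) r).encard < n
        then (1 : ℝ≥0∞) else 0)) :=
  ((measurable_indicator_tx hA k).mul (measurable_few k n r)).comp
    (net.measurable_tx.prodMk (net.measurable_offset k))

lemma tsum_few_le (hlam : 0 < lam) {A : Set Plane} (hA : MeasurableSet A) (hA' : volume A ≠ ∞)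
    {r : ℝ} (hr : 0 < r) (n : ℕ) :
    ∑' k, ∫⁻ ω, A.indicator 1 (net.tx k ω) *
        (if (nearLabels (fun j => net.tx j ω) k (net.offset k ω) r).encard < n then 1 else 0) ∂P
      ≤ ENNReal.ofReal lam * volume A *
        ENNReal.ofReal (2 ^ n * Real.exp (-(lam * (Real.pi * r ^ 2 / 2)) / 2)) := by
  have hm : ∀ k, Measurable (fun p : (ℕ → Plane) × Plane =>
      A.indicator (1 : Plane → ℝ≥0∞) (p.1 k) *
      (if (nearLabels p.1 k p.2 r).encard < n then (1 : ℝ≥0∞) else 0)) := fun k =>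
    (measurable_indicator_tx hA k).mul (measurable_few k n r)
  refine net.tsum_lintegral_offset_le hm fun o => ?_
  have hmo : ∀ k, Measurable (fun ω => A.indicator (1 : Plane → ℝ≥0∞) (net.tx k ω) *
      (if (nearLabels (fun j => net.tx j ω) k o r).encard < n then (1 : ℝ≥0∞) else 0)) := fun k =>
    (hm k).comp (net.measurable_tx.prodMk measurable_const)
  rw [← lintegral_tsum fun k => (hmo k).aemeasurable]
  exact net.ppp.lintegral_tsum_few_le hlam hA hA' o hr n

lemma tsum_indicator_tx (hlam : 0 < lam) {A : Set Plane} (hA : MeasurableSet A)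
    (hA' : volume A ≠ ∞) :
    ∑' k, ∫⁻ ω, A.indicator (1 : Plane → ℝ≥0∞) (net.tx k ω) ∂P
      = ENNReal.ofReal lam * volume A := by
  rw [← net.ppp.tsum_measure_eq hlam hA hA']
  exact tsum_congr fun k => lintegral_indicator_one (net.ppp.measurable k hA)

end LinkNetwork

lemma lintegral_mul_add_tsum {Ω : Type*} [MeasurableSpace Ω] {P : Measure Ω} {f : Ω → ℝ≥0∞}
    {g : ℕ → Ω → ℝ≥0∞} (hf : Measurable f) (hg : ∀ i, Measurable (g i)) (K a : ℝ≥0∞)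
    (b : ℕ → ℝ≥0∞) :
    ∫⁻ ω, K * (a * f ω + ∑' i, b i * g i ω) ∂P
      = K * (a * ∫⁻ ω, f ω ∂P + ∑' i, b i * ∫⁻ ω, g i ω ∂P) := by
  have hmt : ∀ i, Measurable (fun ω => b i * g i ω) := fun i => (hg i).const_mul _
  have hm : Measurable (fun ω => a * f ω + ∑' i, b i * g i ω) :=
    (hf.const_mul _).add (Measurable.tsum hmt)
  rw [lintegral_const_mul _ hm, lintegral_add_left (hf.const_mul _), lintegral_const_mul _ hf,
    lintegral_tsum fun i => (hmt i).aemeasurable]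
  simp only [lintegral_const_mul _ (hg _)]

/-- The constant that bounds the contribution of the radii `2 ^ i * r`. -/
noncomputable def radiiConst (α : ℝ) : ℝ≥0∞ :=
  ∑' i : ℕ, ENNReal.ofReal ((2 ^ (i + 1)) ^ α * Real.exp (-4 ^ i))

lemma radiiConst_lt_top (α : ℝ) : radiiConst α < ∞ := by
  obtain ⟨m, hm⟩ := exists_nat_gt (α / 2)
  have hq : (2 : ℝ) ^ α / 4 ^ m < 1 := by
    rw [div_lt_one (by positivity), show (4 : ℝ) = 2 ^ (2 : ℝ) by norm_num, ← Real.rpow_natCast,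
      ← Real.rpow_mul (by norm_num)]
    exact Real.rpow_lt_rpow_of_exponent_lt (by norm_num) (by linarith)
  have hs : Summable fun i : ℕ => 2 ^ α * m.factorial * ((2 : ℝ) ^ α / 4 ^ m) ^ i :=
    (summable_geometric_of_lt_one (by positivity) hq).mul_left _
  have hle : ∀ i : ℕ, ((2 : ℝ) ^ (i + 1)) ^ α * Real.exp (-4 ^ i)
      ≤ 2 ^ α * m.factorial * ((2 : ℝ) ^ α / 4 ^ m) ^ i := by
    intro i
    have h1 := Real.pow_div_factorial_le_exp (x := 4 ^ i) (by positivity) m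
    have h2 : Real.exp (-4 ^ i) ≤ m.factorial / (4 ^ i) ^ m := by
      rw [Real.exp_neg, ← inv_div]
      exact inv_anti₀ (by positivity) h1
    have h3 : ((2 : ℝ) ^ (i + 1)) ^ α = 2 ^ α * (2 ^ α) ^ i := by
      rw [← Real.rpow_natCast, ← Real.rpow_natCast, ← Real.rpow_mul (by norm_num),
        ← Real.rpow_mul (by norm_num), ← Real.rpow_add (by norm_num)]
      congr 1
      push_cast
      ring
    calc _ ≤ ((2 : ℝ) ^ (i + 1)) ^ α * (m.factorial / (4 ^ i) ^ m) := by gcongr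
      _ = _ := by rw [h3, div_pow, ← pow_mul, ← pow_mul, mul_comm m i]; ring
  refine lt_of_le_of_lt (ENNReal.tsum_le_tsum fun i => ENNReal.ofReal_le_ofReal (hle i)) ?_
  rw [← ENNReal.ofReal_tsum_of_nonneg (fun i => by positivity) hs]
  exact ENNReal.ofReal_lt_top

namespace LinkNetwork
variable {Ω : Type*} [MeasurableSpace Ω] {P : Measure Ω} [IsProbabilityMeasure P] {lam Rd : ℝ}
  {N : ℕ} [NeZero N] (net : LinkNetwork P lam Rd N)

/-- The Palm mean of the SINR is `O((N / lam) ^ (α / 2))`. -/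
lemma tsum_lintegral_sinr_le {L : ℕ} (hL : L ≤ N) (hlam : 0 < lam) {α : ℝ} (hα : 0 < α)
    {A : Set Plane} (hA : MeasurableSet A) (hA' : volume A ≠ ∞) :
    ∑' k, ∫⁻ ω, A.indicator 1 (net.tx k ω) * (ENNReal.ofReal (nsq (net.h k k ω)) *
        (residualPower (fun j => net.tx j ω) k (net.offset k ω) L α (fun j => net.h k j ω))⁻¹) ∂P
      ≤ ENNReal.ofReal lam * volume A * ((negMoment ^ 3 + 1) * (1 + radiiConst α)
        * ENNReal.ofReal ((8 * N / lam) ^ (α / 2))) := by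
  have hN : (1 : ℝ) ≤ N := by exact_mod_cast Nat.pos_of_ne_zero (NeZero.ne N)
  -- the mean number of interferers within distance `r` is `8 π N`, well above `4 N`
  set r : ℝ := √(8 * N / lam) with hrdef
  have hr : 0 < r := Real.sqrt_pos.2 (by positivity)
  have hr2 : r ^ 2 = 8 * N / lam := Real.sq_sqrt (by positivity)
  have hrα : r ^ α = (8 * N / lam) ^ (α / 2) := by
    rw [← hr2, ← Real.rpow_natCast, ← Real.rpow_mul hr.le]
    congr 1; push_cast; ring
  -- first integrate over the fading
  have h1 : ∀ k, ∫⁻ ω, A.indicator 1 (net.tx k ω) * (ENNReal.ofReal (nsq (net.h k k ω)) *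
        (residualPower (fun j => net.tx j ω) k (net.offset k ω) L α (fun j => net.h k j ω))⁻¹) ∂P
      ≤ (negMoment ^ 3 + 1) * (ENNReal.ofReal (r ^ α) *
          ∫⁻ ω, A.indicator 1 (net.tx k ω) ∂P + ∑' i : ℕ, ENNReal.ofReal ((2 ^ (i + 1) * r) ^ α) *
          ∫⁻ ω, A.indicator 1 (net.tx k ω) * (if (nearLabels (fun j => net.tx j ω) k
            (net.offset k ω) (2 ^ i * r)).encard < (4 * N : ℕ) then 1 else 0) ∂P) := by
    intro k
    have hcfg := net.measurable_tx.prodMk (net.measurable_offset k)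
    have hF : Measurable (fun p : ((ℕ → Plane) × Plane) × (ℕ → Fin N → ℂ) =>
        A.indicator (1 : Plane → ℝ≥0∞) (p.1.1 k) * (ENNReal.ofReal (nsq (p.2 k)) *
          (residualPower p.1.1 k p.1.2 L α p.2)⁻¹)) :=
      ((measurable_indicator_tx hA k).comp measurable_fst).mul
        ((show Measurable fun p : ((ℕ → Plane) × Plane) × (ℕ → Fin N → ℂ) =>
            nsq (p.2 k) by fun_prop).ennreal_ofReal.mul
          (measurable_residualPower k L α).inv)
    have hmi : ∀ i : ℕ, Measurable (fun ω => A.indicator (1 : Plane → ℝ≥0∞) (net.tx k ω) *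
        (if (nearLabels (fun j => net.tx j ω) k (net.offset k ω) (2 ^ i * r)).encard < (4 * N : ℕ)
          then (1 : ℝ≥0∞) else 0)) := fun i =>
      net.measurable_indicator_mul_few hA k (4 * N) (2 ^ i * r)
    have hm0 : Measurable (fun ω => A.indicator (1 : Plane → ℝ≥0∞) (net.tx k ω)) :=
      (measurable_one.indicator hA).comp (net.ppp.measurable k)
    calc _ = ∫⁻ ω, ∫⁻ ω', A.indicator 1 (net.tx k ω) * (ENNReal.ofReal (nsq (net.h k k ω')) *
          (residualPower (fun j => net.tx j ω) k (net.offset k ω) L α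
            (fun j => net.h k j ω'))⁻¹) ∂P ∂P :=
          lintegral_indepFun hcfg (net.measurable_fading k) (net.indep_config_fading k) hF
      _ ≤ ∫⁻ ω, (negMoment ^ 3 + 1) * (ENNReal.ofReal (r ^ α) * A.indicator 1 (net.tx k ω) +
          ∑' i : ℕ, ENNReal.ofReal ((2 ^ (i + 1) * r) ^ α) * (A.indicator 1 (net.tx k ω) *
          (if (nearLabels (fun j => net.tx j ω) k (net.offset k ω) (2 ^ i * r)).encard
            < (4 * N : ℕ) then 1 else 0))) ∂P := by
          have hd : ∀ᵐ ω ∂P, ∀ j, 0 < net.d k j ω := ae_all_iff.2 fun j => net.ae_d_pos k j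
          refine lintegral_mono_ae ?_
          filter_upwards [hd] with ω hω
          by_cases hk : net.tx k ω ∈ A
          · simp only [Set.indicator_of_mem hk, Pi.one_apply, one_mul, mul_one]
            exact (net.isFading k).lintegral_nsq_div_residualPower_le_tsum hL hα.le hr hω
          · simp [Set.indicator_of_notMem hk]
      _ = _ := lintegral_mul_add_tsum hm0 hmi _ _ _
  -- then apply the Palm bounds for the number of interferers
  have h2 : ∀ i : ℕ, ENNReal.ofReal (2 ^ (4 * N) *
      Real.exp (-(lam * (Real.pi * (2 ^ i * r) ^ 2 / 2)) / 2))
      ≤ ENNReal.ofReal (Real.exp (-4 ^ i)) := by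
    intro i
    apply ENNReal.ofReal_le_ofReal
    have h3 : (2 : ℝ) ^ (4 * N) ≤ Real.exp (4 * N) := by
      have : (2 : ℝ) ≤ Real.exp 1 := by
        have := Real.add_one_le_exp (1 : ℝ)
        linarith
      calc (2 : ℝ) ^ (4 * N) ≤ Real.exp 1 ^ (4 * N) := by gcongr
        _ = _ := by rw [← Real.exp_nat_mul]; push_cast; ring_nf
    calc _ ≤ Real.exp (4 * N) * Real.exp (-(lam * (Real.pi * (2 ^ i * r) ^ 2 / 2)) / 2) := by gcongr
      _ = Real.exp (4 * N - 2 * Real.pi * N * 4 ^ i) := by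
          rw [← Real.exp_add]
          congr 1
          rw [mul_pow, hr2, ← pow_mul, mul_comm i 2, pow_mul]
          field_simp
          norm_num
          ring
      _ ≤ _ := by
          apply Real.exp_le_exp.2
          have h4 : (1 : ℝ) ≤ 4 ^ i := one_le_pow₀ (by norm_num)
          have h5 := Real.pi_gt_three
          have h6 : (N : ℝ) ≤ N * 4 ^ i := le_mul_of_one_le_right (by positivity) h4
          have h7 : (4 : ℝ) ^ i ≤ N * 4 ^ i := le_mul_of_one_le_left (by positivity) hN
          nlinarith
  calc _ ≤ ∑' k, (negMoment ^ 3 + 1) * (ENNReal.ofReal (r ^ α) *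
          ∫⁻ ω, A.indicator 1 (net.tx k ω) ∂P + ∑' i : ℕ, ENNReal.ofReal ((2 ^ (i + 1) * r) ^ α) *
          ∫⁻ ω, A.indicator 1 (net.tx k ω) * (if (nearLabels (fun j => net.tx j ω) k
            (net.offset k ω) (2 ^ i * r)).encard < (4 * N : ℕ) then 1 else 0) ∂P) :=
        ENNReal.tsum_le_tsum h1
    _ = (negMoment ^ 3 + 1) * (ENNReal.ofReal (r ^ α) * (ENNReal.ofReal lam * volume A) +
          ∑' i : ℕ, ENNReal.ofReal ((2 ^ (i + 1) * r) ^ α) * ∑' k,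
          ∫⁻ ω, A.indicator 1 (net.tx k ω) * (if (nearLabels (fun j => net.tx j ω) k
            (net.offset k ω) (2 ^ i * r)).encard < (4 * N : ℕ) then 1 else 0) ∂P) := by
        rw [ENNReal.tsum_mul_left, ENNReal.tsum_add, ENNReal.tsum_mul_left,
          net.tsum_indicator_tx hlam hA hA', ENNReal.tsum_comm]
        simp only [ENNReal.tsum_mul_left]
    _ ≤ (negMoment ^ 3 + 1) * (ENNReal.ofReal (r ^ α) * (ENNReal.ofReal lam * volume A) +
          ∑' i : ℕ, ENNReal.ofReal ((2 ^ (i + 1)) ^ α * Real.exp (-4 ^ i)) *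
            (ENNReal.ofReal (r ^ α) * (ENNReal.ofReal lam * volume A))) := by
        gcongr _ * (_ + ?_)
        refine ENNReal.tsum_le_tsum fun i => ?_
        refine (mul_le_mul_right ((net.tsum_few_le hlam hA hA' (by positivity) (4 * N)).trans
          (mul_le_mul_right (h2 i) _)) _).trans_eq ?_
        rw [Real.mul_rpow (by positivity) hr.le, ENNReal.ofReal_mul (by positivity),
          ENNReal.ofReal_mul (by positivity)]
        ring
    _ = _ := by
        rw [ENNReal.tsum_mul_right, ← radiiConst, hrα]
        ring

end LinkNetwork

/-! ### A lower bound for the Palm mean of the spectral efficiency -/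

/-- The sum over the interferers of link `k` of a function of their distance to receiver `k`. -/
noncomputable def radialSum (φ : ℝ → ℝ≥0∞) (x : ℕ → Plane) (k : ℕ) (o : Plane) : ℝ≥0∞ :=
  ∑' j, if j = k then 0 else φ (rxDist x k o j)

lemma measurable_radialSum {φ : ℝ → ℝ≥0∞} (hφ : Measurable φ) (k : ℕ) :
    Measurable (fun p : (ℕ → Plane) × Plane => radialSum φ p.1 k p.2) := by
  unfold radialSum
  refine Measurable.tsum fun j => ?_
  split_ifs
  · exact measurable_const
  · exact hφ.comp (measurable_rxDist k j)

lemma encard_nearLabels (x : ℕ → Plane) (k : ℕ) (o : Plane) (ρ : ℝ) :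
    ((nearLabels x k o ρ).encard : ℝ≥0∞) = radialSum (fun t => if t ≤ ρ then 1 else 0) x k o := by
  rw [← ENNReal.tsum_set_one, tsum_subtype (nearLabels x k o ρ) (fun _ => (1 : ℝ≥0∞)), radialSum]
  refine tsum_congr fun j => ?_
  by_cases h1 : j = k <;> by_cases h2 : rxDist x k o j ≤ ρ
  · simp [Set.indicator, nearLabels, h1]
  · simp [Set.indicator, nearLabels, h1]
  · simp only [h1, h2, if_true, if_false]
    exact Set.indicator_of_mem (show j ∈ nearLabels x k o ρ from ⟨h1, h2⟩) _
  · simp only [h1, h2, if_false]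
    exact Set.indicator_of_notMem (fun h : j ∈ nearLabels x k o ρ => h2 h.2) _

lemma measurable_discWeight (ρ : ℝ) :
    Measurable (fun t : ℝ => if t ≤ ρ then (1 : ℝ≥0∞) else 0) :=
  Measurable.ite measurableSet_Iic measurable_const measurable_const

lemma measurable_encard_nearLabels (k : ℕ) (ρ : ℝ) :
    Measurable (fun p : (ℕ → Plane) × Plane => ((nearLabels p.1 k p.2 ρ).encard : ℝ≥0∞)) := by
  simp only [encard_nearLabels]
  exact measurable_radialSum (measurable_discWeight ρ) k

section
variable {Ω : Type*} [MeasurableSpace Ω] {P : Measure Ω} [IsProbabilityMeasure P] {N : ℕ}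

lemma measurable_tailWeight (ρ α : ℝ) :
    Measurable (fun t : ℝ => if t ≤ ρ then 0 else ENNReal.ofReal (t ^ (-α))) :=
  Measurable.ite measurableSet_Iic measurable_const (by fun_prop)

lemma measurable_farInterference (k : ℕ) (ρ α : ℝ) :
    Measurable (fun p : ((ℕ → Plane) × Plane) × (ℕ → Fin N → ℂ) =>
      farInterference p.1.1 k p.1.2 ρ α p.2) := by
  unfold farInterference
  refine Measurable.tsum fun j => ?_
  split_ifs
  · exact measurable_const
  · exact ((measurable_tailWeight ρ α).comp ((measurable_rxDist k j).comp measurable_fst)).mul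
      (show Measurable fun p : ((ℕ → Plane) × Plane) × (ℕ → Fin N → ℂ) =>
        gain (p.2 k) (p.2 j) by fun_prop).ennreal_ofReal

lemma IsFading.lintegral_farInterference_le {H : ℕ → Ω → Fin N → ℂ} (hH : IsFading P H)
    (x : ℕ → Plane) (k : ℕ) (o : Plane) (ρ α : ℝ) :
    ∫⁻ ω, farInterference x k o ρ α (fun j => H j ω) ∂P
      ≤ radialSum (fun t => if t ≤ ρ then 0 else ENNReal.ofReal (t ^ (-α))) x k o := by
  have hm := hH.meas
  have hg : ∀ j, Measurable fun ω => ENNReal.ofReal (gain (H k ω) (H j ω)) := fun j => by fun_prop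
  unfold farInterference radialSum
  rw [lintegral_tsum]
  · refine ENNReal.tsum_le_tsum fun j => ?_
    by_cases hj : j = k
    · simp [hj]
    · simp only [hj, if_false]
      rw [lintegral_const_mul _ (hg j)]
      exact mul_le_of_le_one_right zero_le (hH.lintegral_gain_le (Ne.symm hj))
  · intro j
    by_cases hj : j = k
    · simp [hj]
    · simp only [hj, if_false]
      exact ((hg j).const_mul _).aemeasurable

/-- The number of entries of a vector with squared modulus less than `a`. -/
noncomputable def smallCount (a : ℝ) (v : Fin N → ℂ) : ℝ≥0∞ :=
  ∑ i, {z : ℂ | ‖z‖ ^ 2 < a}.indicator 1 (v i)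

lemma measurableSet_normSq_lt (a : ℝ) : MeasurableSet {z : ℂ | ‖z‖ ^ 2 < a} :=
  measurableSet_lt (by fun_prop) measurable_const

lemma measurable_smallCount (a : ℝ) : Measurable (smallCount a : (Fin N → ℂ) → ℝ≥0∞) :=
  Finset.measurable_sum _ fun i _ =>
    (measurable_one.indicator (measurableSet_normSq_lt a)).comp (measurable_pi_apply i)

omit [IsProbabilityMeasure P] in
lemma IsFading.lintegral_smallCount {H : ℕ → Ω → Fin N → ℂ} (hH : IsFading P H) (k : ℕ)
    (a : ℝ) : ∫⁻ ω, smallCount a (H k ω) ∂P = N * stdComplexGaussian {z | ‖z‖ ^ 2 < a} := by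
  have hm : ∀ i, Measurable fun ω => H k ω i := fun i =>
    (measurable_pi_apply i).comp (hH.meas k)
  unfold smallCount
  have hmi : ∀ i, Measurable fun ω =>
      {z : ℂ | ‖z‖ ^ 2 < a}.indicator (1 : ℂ → ℝ≥0∞) (H k ω i) := fun i =>
    (measurable_one.indicator (measurableSet_normSq_lt a)).comp (hm i)
  rw [lintegral_finsetSum _ fun i _ => hmi i]
  have : ∀ i, ∫⁻ ω, {z : ℂ | ‖z‖ ^ 2 < a}.indicator (1 : ℂ → ℝ≥0∞) (H k ω i) ∂P
      = stdComplexGaussian {z | ‖z‖ ^ 2 < a} := fun i => by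
    rw [← lintegral_map (f := {z : ℂ | ‖z‖ ^ 2 < a}.indicator (1 : ℂ → ℝ≥0∞))
      (measurable_one.indicator (measurableSet_normSq_lt a)) (hm i), hH.law k i,
      lintegral_indicator_one (measurableSet_normSq_lt a)]
  simp [this]

/-- If at most half of the entries are small, then the norm is large. -/
lemma le_nsq_of_smallCount_le {a : ℝ} (ha : 0 ≤ a) {v : Fin N → ℂ}
    (hv : 2 * smallCount a v ≤ N) : a * N / 2 ≤ nsq v := by
  classical
  set c : ℕ := (Finset.univ.filter fun i => ‖v i‖ ^ 2 < a).card with hc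
  have h1 : smallCount a v = c := by
    simp [smallCount, Set.indicator, hc]
  have h2 : 2 * c ≤ N := by
    rw [h1] at hv
    exact_mod_cast hv
  have h2' : (2 : ℝ) * c ≤ N := by exact_mod_cast h2
  have h3 : (∑ i, (a - a * if ‖v i‖ ^ 2 < a then 1 else 0)) ≤ nsq v := by
    refine Finset.sum_le_sum fun i _ => ?_
    split_ifs with h
    · simp
    · simpa using not_lt.1 h
  rw [Finset.sum_sub_distrib, ← Finset.mul_sum, Finset.sum_boole, ← hc] at h3
  simp at h3
  nlinarith
end

namespace LinkNetwork
variable {Ω : Type*} [MeasurableSpace Ω] {P : Measure Ω} [IsProbabilityMeasure P] {lam Rd : ℝ}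
  {N : ℕ} (net : LinkNetwork P lam Rd N)

/-- Campbell's formula for the sums over interferers under the Palm measure. -/
lemma tsum_lintegral_radialSum_le (hlam : 0 < lam) {A : Set Plane} (hA : MeasurableSet A)
    {φ : ℝ → ℝ≥0∞} (hφ : Measurable φ) {C : ℝ≥0∞} (hC : ∀ y : Plane, ∫⁻ z, φ (dist y z) ≤ C) :
    ∑' k, ∫⁻ ω, A.indicator 1 (net.tx k ω) *
        radialSum φ (fun j => net.tx j ω) k (net.offset k ω) ∂P
      ≤ ENNReal.ofReal lam * volume A * (ENNReal.ofReal lam * C) := by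
  have hm : ∀ k, Measurable (fun p : (ℕ → Plane) × Plane =>
      A.indicator (1 : Plane → ℝ≥0∞) (p.1 k) * radialSum φ p.1 k p.2) := fun k =>
    (measurable_indicator_tx hA k).mul (measurable_radialSum hφ k)
  refine net.tsum_lintegral_offset_le hm fun o => ?_
  set f : Plane × Plane → ℝ≥0∞ := fun p => A.indicator 1 p.1 * φ (dist (p.1 + o) p.2) with hfdef
  have hf : Measurable f :=
    ((measurable_one.indicator hA).comp measurable_fst).mul
      (hφ.comp ((measurable_fst.add_const o).dist measurable_snd))
  have htx := net.ppp.measurable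
  have h1 : ∀ k, ∫⁻ ω, A.indicator 1 (net.tx k ω) * radialSum φ (fun j => net.tx j ω) k o ∂P
      = ∑' j, (if j = k then 0 else ∫⁻ ω, f (net.tx k ω, net.tx j ω) ∂P) := by
    intro k
    have h2 : ∀ ω, A.indicator 1 (net.tx k ω) * radialSum φ (fun j => net.tx j ω) k o
        = ∑' j, (if j = k then 0 else f (net.tx k ω, net.tx j ω)) := fun ω => by
      rw [radialSum, ← ENNReal.tsum_mul_left]
      exact tsum_congr fun j => by split_ifs <;> simp [hfdef, rxDist]
    simp only [h2]
    rw [lintegral_tsum]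
    · refine tsum_congr fun j => ?_
      split_ifs <;> simp
    · intro j
      split_ifs
      · exact aemeasurable_const
      · exact (hf.comp ((htx k).prodMk (htx j))).aemeasurable
  simp only [h1]
  rw [net.ppp.tsum_lintegral_pairs hlam hf]
  calc _ ≤ ENNReal.ofReal lam * (ENNReal.ofReal lam * ∫⁻ x, C * A.indicator 1 x) := by
        gcongr with x
        simp only [hfdef]
        rw [lintegral_const_mul _ (by
          exact hφ.comp (measurable_const.dist measurable_id)), mul_comm]
        gcongr
        exact hC _
    _ = _ := by
        rw [lintegral_const_mul _ (measurable_one.indicator hA), lintegral_indicator_one hA]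
        ring

lemma tsum_lintegral_encard_nearLabels_le (hlam : 0 < lam) {A : Set Plane} (hA : MeasurableSet A)
    {ρ : ℝ} (hρ : 0 ≤ ρ) :
    ∑' k, ∫⁻ ω, A.indicator 1 (net.tx k ω) *
        ((nearLabels (fun j => net.tx j ω) k (net.offset k ω) ρ).encard : ℝ≥0∞) ∂P
      ≤ ENNReal.ofReal lam * volume A * (ENNReal.ofReal lam * ENNReal.ofReal (Real.pi * ρ ^ 2)) := by
  simp only [encard_nearLabels]
  refine net.tsum_lintegral_radialSum_le hlam hA
    (measurable_discWeight ρ) fun y => ?_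
  refine le_of_eq ?_
  calc _ = ∫⁻ z, (Metric.closedBall y ρ).indicator 1 z := by
        refine lintegral_congr fun z => ?_
        simp [Set.indicator, Metric.mem_closedBall, dist_comm]
    _ = _ := by
        rw [lintegral_indicator_one Metric.isClosed_closedBall.measurableSet,
          EuclideanSpace.volume_closedBall_fin_two, ENNReal.ofReal_mul Real.pi_pos.le,
          ENNReal.ofReal_pow hρ, mul_comm]

lemma tsum_lintegral_farInterference_le (hlam : 0 < lam) {A : Set Plane} (hA : MeasurableSet A)
    {ρ α : ℝ} (hρ : 0 < ρ) (hα : 2 < α) :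
    ∑' k, ∫⁻ ω, A.indicator 1 (net.tx k ω) * farInterference (fun j => net.tx j ω) k
        (net.offset k ω) ρ α (fun j => net.h k j ω) ∂P
      ≤ ENNReal.ofReal lam * volume A *
        (ENNReal.ofReal lam * (tailConst α * ENNReal.ofReal (ρ ^ (2 - α)))) := by
  refine le_trans (ENNReal.tsum_le_tsum fun k => ?_) (net.tsum_lintegral_radialSum_le hlam hA
    (measurable_tailWeight ρ α) fun y => lintegral_tail_le hα hρ y)
  have hcfg := net.measurable_tx.prodMk (net.measurable_offset k)
  have hF : Measurable (fun p : ((ℕ → Plane) × Plane) × (ℕ → Fin N → ℂ) =>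
      A.indicator (1 : Plane → ℝ≥0∞) (p.1.1 k) * farInterference p.1.1 k p.1.2 ρ α p.2) :=
    ((measurable_indicator_tx hA k).comp measurable_fst).mul (measurable_farInterference k ρ α)
  calc _ = ∫⁻ ω, ∫⁻ ω', A.indicator 1 (net.tx k ω) * farInterference (fun j => net.tx j ω) k
        (net.offset k ω) ρ α (fun j => net.h k j ω') ∂P ∂P :=
        lintegral_indepFun hcfg (net.measurable_fading k) (net.indep_config_fading k) hF
    _ ≤ _ := by
        refine lintegral_mono fun ω => ?_
        rw [lintegral_const_mul' _ _ (by by_cases h : net.tx k ω ∈ A <;> simp [h])]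
        exact mul_le_mul_right ((net.isFading k).lintegral_farInterference_le _ _ _ _ _) _

lemma tsum_lintegral_smallCount (hlam : 0 < lam) {A : Set Plane} (hA : MeasurableSet A)
    (hA' : volume A ≠ ∞) (a : ℝ) :
    ∑' k, ∫⁻ ω, A.indicator 1 (net.tx k ω) * smallCount a (net.h k k ω) ∂P
      = ENNReal.ofReal lam * volume A * (N * stdComplexGaussian {z | ‖z‖ ^ 2 < a}) := by
  rw [← net.tsum_indicator_tx hlam hA hA', ← ENNReal.tsum_mul_right]
  refine tsum_congr fun k => ?_
  have hm0 : Measurable (fun ω => A.indicator (1 : Plane → ℝ≥0∞) (net.tx k ω)) :=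
    (measurable_one.indicator hA).comp (net.ppp.measurable k)
  have hi : IndepFun (net.tx k) (net.h k k) P :=
    (net.indep_config_fading k).comp ((measurable_pi_apply k).comp measurable_fst)
      (measurable_pi_apply k)
  have hF : Measurable (fun p : Plane × (Fin N → ℂ) =>
      A.indicator (1 : Plane → ℝ≥0∞) p.1 * smallCount a p.2) :=
    ((measurable_one.indicator hA).comp measurable_fst).mul
      ((measurable_smallCount a).comp measurable_snd)
  rw [lintegral_indepFun (F := fun p : Plane × (Fin N → ℂ) =>
      A.indicator (1 : Plane → ℝ≥0∞) p.1 * smallCount a p.2)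
    (net.ppp.measurable k) (net.measurable_h k k) hi hF, ← lintegral_mul_const _ hm0]
  refine lintegral_congr fun ω => ?_
  rw [← (net.isFading k).lintegral_smallCount k a]
  have hs : Measurable fun ω' => smallCount a (net.h k k ω') :=
    (measurable_smallCount a).comp (net.measurable_h k k)
  exact lintegral_const_mul (μ := P) (A.indicator (1 : Plane → ℝ≥0∞) (net.tx k ω)) hs

end LinkNetwork

namespace LinkNetwork
variable {Ω : Type*} [MeasurableSpace Ω] {P : Measure Ω} {lam Rd : ℝ} {N : ℕ}
  (net : LinkNetwork P lam Rd N)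

/-- A quantity that is at least `1` if at least half of the entries of the direct channel are small, or
there are `N` interferers within distance `ρ`, or the power of the interferers at distance more than
`ρ` is at least `M`. -/
noncomputable def badness (a ρ M α : ℝ) (k : ℕ) (ω : Ω) : ℝ≥0∞ :=
  2 * (N : ℝ≥0∞)⁻¹ * smallCount a (net.h k k ω) +
  (N : ℝ≥0∞)⁻¹ * (nearLabels (fun j => net.tx j ω) k (net.offset k ω) ρ).encard +
  (ENNReal.ofReal M)⁻¹ * farInterference (fun j => net.tx j ω) k (net.offset k ω) ρ α
    (fun j => net.h k j ω)

lemma measurable_config_nearLabels (k : ℕ) (ρ : ℝ) : Measurable fun ω =>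
    ((nearLabels (fun j => net.tx j ω) k (net.offset k ω) ρ).encard : ℝ≥0∞) := by
  have h := (measurable_encard_nearLabels k ρ).comp
    (net.measurable_tx.prodMk (net.measurable_offset k))
  exact h

lemma measurable_badness (a ρ M α : ℝ) (k : ℕ) : Measurable (net.badness a ρ M α k) := by
  have h1 := (measurable_smallCount a).comp (net.measurable_h k k)
  have h2 := net.measurable_config_nearLabels k ρ
  have h3 := (measurable_farInterference (N := N) k ρ α).comp
    ((net.measurable_tx.prodMk (net.measurable_offset k)).prodMk (net.measurable_fading k))
  have h := ((h1.const_mul (2 * (N : ℝ≥0∞)⁻¹)).add (h2.const_mul (N : ℝ≥0∞)⁻¹)).add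
    (h3.const_mul (ENNReal.ofReal M)⁻¹)
  exact h

/-- Each of the three terms contributes at most `1 / 6`. -/
lemma tsum_lintegral_badness_le [IsProbabilityMeasure P] [NeZero N] (hlam : 0 < lam) {A : Set Plane}
    (hA : MeasurableSet A) (hA' : volume A ≠ ∞) {a ρ M α : ℝ} (hρ : 0 < ρ) (hα : 2 < α)
    (hM : 0 < M) (ha : stdComplexGaussian {z | ‖z‖ ^ 2 < a} ≤ 12⁻¹)
    (hρN : ENNReal.ofReal lam * ENNReal.ofReal (Real.pi * ρ ^ 2) ≤ N * 6⁻¹)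
    (hρM : ENNReal.ofReal lam * (tailConst α * ENNReal.ofReal (ρ ^ (2 - α)))
      ≤ ENNReal.ofReal M * 6⁻¹) :
    ∑' k, ∫⁻ ω, A.indicator 1 (net.tx k ω) * net.badness a ρ M α k ω ∂P
      ≤ ENNReal.ofReal lam * volume A * 2⁻¹ := by
  have hN : (N : ℝ≥0∞) ≠ 0 := by exact_mod_cast NeZero.ne N
  have hN' : (N : ℝ≥0∞) ≠ ∞ := ENNReal.natCast_ne_top N
  have hM0 : ENNReal.ofReal M ≠ 0 := by simpa using hM
  have hm0 : ∀ k, Measurable (fun ω => A.indicator (1 : Plane → ℝ≥0∞) (net.tx k ω)) := fun k =>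
    (measurable_one.indicator hA).comp (net.ppp.measurable k)
  have hm1 : ∀ k, Measurable fun ω =>
      A.indicator (1 : Plane → ℝ≥0∞) (net.tx k ω) * smallCount a (net.h k k ω) := fun k =>
    (hm0 k).mul ((measurable_smallCount a).comp (net.measurable_h k k))
  have hm2 : ∀ k, Measurable fun ω => A.indicator (1 : Plane → ℝ≥0∞) (net.tx k ω) *
      ((nearLabels (fun j => net.tx j ω) k (net.offset k ω) ρ).encard : ℝ≥0∞) := fun k =>
    (hm0 k).mul (net.measurable_config_nearLabels k ρ)
  have hm12 : ∀ k, Measurable fun ω =>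
      2 * (N : ℝ≥0∞)⁻¹ * (A.indicator (1 : Plane → ℝ≥0∞) (net.tx k ω) *
        smallCount a (net.h k k ω)) +
      (N : ℝ≥0∞)⁻¹ * (A.indicator (1 : Plane → ℝ≥0∞) (net.tx k ω) *
        ((nearLabels (fun j => net.tx j ω) k (net.offset k ω) ρ).encard : ℝ≥0∞)) := fun k =>
    ((hm1 k).const_mul _).add ((hm2 k).const_mul _)
  have h0 : ∀ k, ∫⁻ ω, A.indicator 1 (net.tx k ω) * net.badness a ρ M α k ω ∂P
      = 2 * (N : ℝ≥0∞)⁻¹ * ∫⁻ ω, A.indicator 1 (net.tx k ω) * smallCount a (net.h k k ω) ∂P +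
      (N : ℝ≥0∞)⁻¹ * ∫⁻ ω, A.indicator 1 (net.tx k ω) *
        ((nearLabels (fun j => net.tx j ω) k (net.offset k ω) ρ).encard : ℝ≥0∞) ∂P +
      (ENNReal.ofReal M)⁻¹ * ∫⁻ ω, A.indicator 1 (net.tx k ω) *
        farInterference (fun j => net.tx j ω) k (net.offset k ω) ρ α
          (fun j => net.h k j ω) ∂P := by
    intro k
    rw [← lintegral_const_mul _ (hm1 k), ← lintegral_const_mul _ (hm2 k),
      ← lintegral_const_mul' _ _ (ENNReal.inv_ne_top.2 hM0),
      ← lintegral_add_left ((hm1 k).const_mul _), ← lintegral_add_left (hm12 k)]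
    refine lintegral_congr fun ω => ?_
    simp only [badness]
    ring
  simp only [h0]
  rw [ENNReal.tsum_add, ENNReal.tsum_add, ENNReal.tsum_mul_left, ENNReal.tsum_mul_left,
    ENNReal.tsum_mul_left, net.tsum_lintegral_smallCount hlam hA hA']
  set V := ENNReal.ofReal lam * volume A
  have b1 : 2 * (N : ℝ≥0∞)⁻¹ * (V * (N * stdComplexGaussian {z | ‖z‖ ^ 2 < a})) ≤ V * 6⁻¹ := by
    calc _ ≤ 2 * (N : ℝ≥0∞)⁻¹ * (V * (N * 12⁻¹)) := by gcongr
      _ = ((N : ℝ≥0∞)⁻¹ * N) * (V * (2 * 12⁻¹)) := by ring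
      _ = V * (2 * 12⁻¹) := by rw [ENNReal.inv_mul_cancel hN hN', one_mul]
      _ = V * 6⁻¹ := by
        rw [show (12 : ℝ≥0∞) = 2 * 6 by norm_num, ENNReal.mul_inv (by simp) (by simp), ← mul_assoc 2,
          ENNReal.mul_inv_cancel (by simp) (by simp), one_mul]
  have b2 : (N : ℝ≥0∞)⁻¹ * (V * (N * 6⁻¹)) = V * 6⁻¹ := by
    calc _ = ((N : ℝ≥0∞)⁻¹ * N) * (V * 6⁻¹) := by ring
      _ = _ := by rw [ENNReal.inv_mul_cancel hN hN', one_mul]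
  have b3 : (ENNReal.ofReal M)⁻¹ * (V * (ENNReal.ofReal M * 6⁻¹)) = V * 6⁻¹ := by
    calc _ = ((ENNReal.ofReal M)⁻¹ * ENNReal.ofReal M) * (V * 6⁻¹) := by ring
      _ = _ := by rw [ENNReal.inv_mul_cancel hM0 ENNReal.ofReal_ne_top, one_mul]
  calc _ ≤ V * 6⁻¹ + V * 6⁻¹ + V * 6⁻¹ := by
        refine add_le_add (add_le_add b1 ?_) ?_
        · rw [← b2]
          exact mul_le_mul_right ((net.tsum_lintegral_encard_nearLabels_le hlam hA hρ.le).trans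
            (mul_le_mul_right hρN _)) _
        · rw [← b3]
          exact mul_le_mul_right ((net.tsum_lintegral_farInterference_le hlam hA hρ hα).trans
            (mul_le_mul_right hρM _)) _
    _ = V * (3 * 6⁻¹) := by ring
    _ = _ := by
        rw [show (6 : ℝ≥0∞) = 3 * 2 by norm_num, ENNReal.mul_inv (by simp) (by simp), ← mul_assoc 3,
          ENNReal.mul_inv_cancel (by simp) (by simp), one_mul]

end LinkNetwork

namespace ZFSIC
variable {Ω : Type*} [MeasurableSpace Ω] {P : Measure Ω} {lam Rd : ℝ} {N : ℕ} [NeZero N]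
  {net : LinkNetwork P lam Rd N}

/-- In general position, the SINR is as large as expected unless the link is bad. -/
lemma le_sinr_of_badness_lt (rec : ZFSIC net (N - 1)) {k : ℕ} {ω : Ω} (h : net.h k k ω ≠ 0) {α : ℝ}
    (hα : 0 ≤ α) (ho : net.offset k ω ∈ annulus Rd)
    (hinj : ∀ i j, i ≠ k → j ≠ k → net.d k i ω = net.d k j ω → i = j)
    (hpos : ∀ j, j ≠ k → 0 < net.d k j ω)
    (hgain : ∀ j, j ≠ k → 0 < gain (net.h k k ω) (net.h k j ω)) {a ρ M : ℝ} (ha : 0 ≤ a)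
    (hM : 0 < M) (hbad : net.badness a ρ M α k ω < 1) :
    a * N / 2 * Rd ^ (-α) / M ≤ rec.sinr α 0 k ω := by
  have hN : (N : ℝ≥0∞) ≠ 0 := by exact_mod_cast NeZero.ne N
  have hN' : (N : ℝ≥0∞) ≠ ∞ := ENNReal.natCast_ne_top N
  have hM0 : ENNReal.ofReal M ≠ 0 := by simpa using hM
  unfold LinkNetwork.badness at hbad
  have h1 := lt_of_le_of_lt (le_self_add.trans le_self_add) hbad
  have h2 := lt_of_le_of_lt (le_add_self.trans le_self_add) hbad
  have h3 := lt_of_le_of_lt le_add_self hbad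
  have hmul : ∀ {c x : ℝ≥0∞}, c ≠ 0 → c ≠ ∞ → c⁻¹ * x < 1 → x < c := fun hc hc' hx => by
    rwa [mul_comm, ← div_eq_mul_inv, ENNReal.div_lt_iff (Or.inl hc) (Or.inl hc'), one_mul] at hx
  refine rec.le_sinr h hα ho hinj hpos hgain hM (S := a * N / 2) (ρ := ρ) ?_ ?_ ?_
  · refine le_nsq_of_smallCount_le ha (hmul hN hN' ?_).le
    rwa [mul_assoc, mul_left_comm] at h1
  · have := hmul hN hN' h2
    rw [Nat.sub_add_cancel (Nat.pos_of_ne_zero (NeZero.ne N))]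
    exact_mod_cast this
  · exact (hmul hM0 ENNReal.ofReal_ne_top h3).le

/-- At least half of the links have a SINR of the expected order. The spectral efficiencies need not
be measurable, since the QR decompositions are arbitrary; only `badness` has to be. -/
lemma le_lintegral_tsum_logb [IsProbabilityMeasure P] (rec : ZFSIC net (N - 1)) (hlam : 0 < lam)
    {A : Set Plane} (hA : MeasurableSet A) (hA' : volume A ≠ ∞) {a ρ M α : ℝ} (hρ : 0 < ρ)
    (hα : 2 < α) (hM : 0 < M) (hRd : 0 < Rd) (ha0 : 0 ≤ a)
    (ha : stdComplexGaussian {z | ‖z‖ ^ 2 < a} ≤ 12⁻¹)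
    (hρN : ENNReal.ofReal lam * ENNReal.ofReal (Real.pi * ρ ^ 2) ≤ N * 6⁻¹)
    (hρM : ENNReal.ofReal lam * (tailConst α * ENNReal.ofReal (ρ ^ (2 - α)))
      ≤ ENNReal.ofReal M * 6⁻¹) :
    ENNReal.ofReal (Real.logb 2 (1 + a * N / 2 * Rd ^ (-α) / M)) *
        (ENNReal.ofReal lam * volume A) * 2⁻¹
      ≤ ∫⁻ ω, ∑' k, (net.tx k ⁻¹' A).indicator
          (fun ω => ENNReal.ofReal (Real.logb 2 (1 + rec.sinr α 0 k ω))) ω ∂P := by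
  set t := ENNReal.ofReal (Real.logb 2 (1 + a * N / 2 * Rd ^ (-α) / M)) with ht
  set V := ENNReal.ofReal lam * volume A with hV
  set X := ∫⁻ ω, ∑' k, (net.tx k ⁻¹' A).indicator
          (fun ω => ENNReal.ofReal (Real.logb 2 (1 + rec.sinr α 0 k ω))) ω ∂P with hX
  have hm0 : ∀ k, Measurable (fun ω => A.indicator (1 : Plane → ℝ≥0∞) (net.tx k ω)) := fun k =>
    (measurable_one.indicator hA).comp (net.ppp.measurable k)
  have hmb : ∀ k, Measurable fun ω =>
      A.indicator (1 : Plane → ℝ≥0∞) (net.tx k ω) * net.badness a ρ M α k ω := fun k =>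
    (hm0 k).mul (net.measurable_badness a ρ M α k)
  have hmt : Measurable fun ω => ∑' k, t * (A.indicator (1 : Plane → ℝ≥0∞) (net.tx k ω) *
      net.badness a ρ M α k ω) := Measurable.tsum fun k => (hmb k).const_mul _
  have hpt : ∀ᵐ ω ∂P, ∑' k, t * A.indicator (1 : Plane → ℝ≥0∞) (net.tx k ω)
      ≤ ∑' k, (net.tx k ⁻¹' A).indicator
          (fun ω => ENNReal.ofReal (Real.logb 2 (1 + rec.sinr α 0 k ω))) ω +
        ∑' k, t * (A.indicator 1 (net.tx k ω) * net.badness a ρ M α k ω) := by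
    filter_upwards [net.ae_generalPosition hlam] with ω hω
    rw [← ENNReal.tsum_add]
    refine ENNReal.tsum_le_tsum fun k => ?_
    obtain ⟨g1, g2, g3, g4, g5⟩ := hω k
    by_cases hk : net.tx k ω ∈ A
    · rw [Set.indicator_of_mem hk, Set.indicator_of_mem (show ω ∈ net.tx k ⁻¹' A from hk)]
      simp only [Pi.one_apply, mul_one, one_mul]
      by_cases hb : net.badness a ρ M α k ω < 1
      · refine le_trans (ENNReal.ofReal_le_ofReal ?_) le_self_add
        have := rec.le_sinr_of_badness_lt g1 (by linarith) g2 g3 (fun j _ => g4 j) g5 ha0 hM hb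
        have h0 : 0 ≤ a * N / 2 * Rd ^ (-α) / M := by positivity
        exact Real.logb_le_logb_of_le (by norm_num) (by linarith) (by linarith)
      · refine le_trans ?_ le_add_self
        exact le_mul_of_one_le_right zero_le (not_lt.1 hb)
    · simp [Set.indicator_of_notMem hk]
  have hmain : t * V ≤ X + t * (V * 2⁻¹) := by
    calc t * V = ∫⁻ ω, ∑' k, t * A.indicator (1 : Plane → ℝ≥0∞) (net.tx k ω) ∂P := by
          rw [lintegral_tsum fun k => ((hm0 k).const_mul _).aemeasurable, hV,
            ← net.tsum_indicator_tx hlam hA hA', ← ENNReal.tsum_mul_left]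
          exact tsum_congr fun k => (lintegral_const_mul _ (hm0 k)).symm
      _ ≤ _ := lintegral_mono_ae hpt
      _ = X + ∑' k, t * ∫⁻ ω, A.indicator 1 (net.tx k ω) * net.badness a ρ M α k ω ∂P := by
          rw [lintegral_add_right _ hmt,
            lintegral_tsum fun k => ((hmb k).const_mul _).aemeasurable]
          congr 1
          exact tsum_congr fun k => lintegral_const_mul _ (hmb k)
      _ ≤ _ := by
          rw [ENNReal.tsum_mul_left]
          gcongr
          exact net.tsum_lintegral_badness_le hlam hA hA' hρ hα hM ha hρN hρM
  have hfin : t * V * 2⁻¹ ≠ ∞ := by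
    refine ENNReal.mul_ne_top (ENNReal.mul_ne_top ENNReal.ofReal_ne_top
      (ENNReal.mul_ne_top ENNReal.ofReal_ne_top hA')) (by simp)
  refine (ENNReal.add_le_add_iff_right hfin).1 ?_
  calc t * V * 2⁻¹ + t * V * 2⁻¹ = t * V * (2⁻¹ + 2⁻¹) := by ring
    _ = t * V := by rw [ENNReal.inv_two_add_inv_two, mul_one]
    _ ≤ X + t * V * 2⁻¹ := by rw [mul_assoc]; exact hmain

end ZFSIC

/-! ### Scaling of the spectral efficiency -/

/-- The logarithm lies below its tangent at `1 + s`. -/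
lemma logb_one_add_le {s x : ℝ} (hs : 0 ≤ s) (hx : 0 ≤ x) :
    Real.logb 2 (1 + x) ≤ Real.logb 2 (1 + s) + 1 / ((1 + s) * Real.log 2) * x := by
  have h2 : 0 < Real.log 2 := Real.log_pos (by norm_num)
  have h1 : Real.log (1 + x) ≤ Real.log (1 + s) + x / (1 + s) := by
    have h3 := Real.log_le_sub_one_of_pos (show 0 < (1 + x) / (1 + s) by positivity)
    rw [Real.log_div (by positivity) (by positivity)] at h3
    have h4 : (1 + x) / (1 + s) ≤ 1 + x / (1 + s) := by
      rw [add_div]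
      gcongr
      exact div_le_one_of_le₀ (by linarith) (by linarith)
    linarith
  calc Real.logb 2 (1 + x) = Real.log (1 + x) / Real.log 2 := rfl
    _ ≤ (Real.log (1 + s) + x / (1 + s)) / Real.log 2 := by gcongr
    _ = _ := by rw [Real.logb]; field_simp

lemma div_one_add_le_logb {s : ℝ} (hs : 0 ≤ s) :
    1 / ((1 + s) * Real.log 2) * s ≤ Real.logb 2 (1 + s) := by
  have h2 : 0 < Real.log 2 := Real.log_pos (by norm_num)
  have h1 := Real.one_sub_inv_le_log_of_pos (show 0 < 1 + s by linarith)
  have h3 : s / (1 + s) = 1 - (1 + s)⁻¹ := by field_simp; ring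
  calc _ = s / (1 + s) / Real.log 2 := by field_simp
    _ ≤ Real.log (1 + s) / Real.log 2 := by rw [h3]; gcongr
    _ = _ := rfl

/-- Bernoulli's inequality, in logarithmic form. -/
lemma min_mul_logb_le {q s : ℝ} (hq : 0 ≤ q) (hs : 0 ≤ s) :
    min q 1 * Real.logb 2 (1 + s) ≤ Real.logb 2 (1 + q * s) := by
  have hp : 0 ≤ min q 1 := le_min hq zero_le_one
  have h1 := rpow_one_add_le_one_add_mul_self (by linarith : -1 ≤ s) hp (min_le_right q 1)
  have h2 : 1 + min q 1 * s ≤ 1 + q * s := by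
    gcongr
    exact min_le_left _ _
  rw [← Real.logb_rpow_eq_mul_logb_of_pos (by linarith)]
  exact Real.logb_le_logb_of_le (by norm_num) (Real.rpow_pos_of_pos (by linarith) _) (h1.trans h2)

namespace ZFSIC

/-- The lower bound. The radius `ρ` is such that the mean number of interferers within distance `ρ` is
`N / 6`, and `M` is at least six times the mean interference from outside that disc. -/
lemma exists_le_palmExpectation {α Rd : ℝ} (hα : 2 < α) (hRd : 0 < Rd) : ∃ κ : ℝ, 0 < κ ∧
    ∀ (lam : ℝ) (N : ℕ) [NeZero N], 0 < lam →
    ∀ (Ω : Type*) [MeasurableSpace Ω] (P : Measure Ω) [IsProbabilityMeasure P]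
      (net : LinkNetwork P lam Rd N) (rec : ZFSIC net (N - 1)) (A : Set Plane),
      MeasurableSet A → volume A ≠ 0 → volume A ≠ ∞ →
      ENNReal.ofReal (Real.logb 2 (1 + κ * (N / lam) ^ (α / 2)) / 2) ≤
        palmExpectation net A (fun k ω => ENNReal.ofReal (Real.logb 2 (1 + rec.sinr α 0 k ω))) := by
  obtain ⟨a, ha0, ha⟩ := exists_stdComplexGaussian_small (ε := 12⁻¹) (by simp)
  -- adding `1` makes the constant positive
  set T : ℝ := (tailConst α).toReal + 1 with hT
  have hT0 : 0 < T := by positivity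
  have hTle : tailConst α ≤ ENNReal.ofReal T := by
    rw [← ENNReal.ofReal_toReal (tailConst_lt_top hα).ne]
    exact ENNReal.ofReal_le_ofReal (by simp [hT])
  have hπ := Real.pi_pos
  refine ⟨a * Rd ^ (-α) * Real.pi / (2 * T) * (1 / (6 * Real.pi)) ^ (α / 2), by positivity, ?_⟩
  intro lam N _ hlam Ω _ P _ net rec A hA hA0 hA'
  have hN : (0 : ℝ) < N := by exact_mod_cast Nat.pos_of_ne_zero (NeZero.ne N)
  have hV0 : ENNReal.ofReal lam * volume A ≠ 0 := mul_ne_zero (by simpa using hlam) hA0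
  have hV1 : ENNReal.ofReal lam * volume A ≠ ∞ := ENNReal.mul_ne_top ENNReal.ofReal_ne_top hA'
  set ρ : ℝ := √(N / lam * (1 / (6 * Real.pi))) with hρdef
  have hρ : 0 < ρ := Real.sqrt_pos.2 (by positivity)
  have hρ2 : ρ ^ 2 = N / lam * (1 / (6 * Real.pi)) := Real.sq_sqrt (by positivity)
  have hρα : ρ ^ α = (N / lam) ^ (α / 2) * (1 / (6 * Real.pi)) ^ (α / 2) := by
    rw [← Real.mul_rpow (by positivity) (by positivity), ← hρ2, ← Real.rpow_natCast,
      ← Real.rpow_mul hρ.le]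
    congr 1; push_cast; ring
  have h6 : ENNReal.ofReal (1 / 6) = 6⁻¹ := by
    rw [one_div, ENNReal.ofReal_inv_of_pos (by norm_num)]
    norm_num
  set M : ℝ := 6 * lam * T * ρ ^ (2 - α) with hMdef
  have hM : 0 < M := by positivity
  have hbound := rec.le_lintegral_tsum_logb hlam hA hA' hρ hα hM hRd ha0.le ha
    (by
      rw [← h6, ← ENNReal.ofReal_natCast, ← ENNReal.ofReal_mul hlam.le,
        ← ENNReal.ofReal_mul hN.le]
      refine ENNReal.ofReal_le_ofReal (le_of_eq ?_)
      rw [hρ2]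
      field_simp)
    (by
      rw [← h6, ← ENNReal.ofReal_mul hM.le]
      calc _ ≤ ENNReal.ofReal lam * (ENNReal.ofReal T * ENNReal.ofReal (ρ ^ (2 - α))) := by gcongr
        _ = ENNReal.ofReal (M * (1 / 6)) := by
          rw [← ENNReal.ofReal_mul hT0.le, ← ENNReal.ofReal_mul hlam.le]
          congr 1
          rw [hMdef]
          ring)
  have hval : a * N / 2 * Rd ^ (-α) / M = a * Rd ^ (-α) * Real.pi / (2 * T) *
      (1 / (6 * Real.pi)) ^ (α / 2) * (N / lam) ^ (α / 2) := by
    have h1 : (N : ℝ) = 6 * Real.pi * lam * ρ ^ 2 := by rw [hρ2]; field_simp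
    have h2 : ρ ^ (2 - α) = ρ ^ 2 / ρ ^ α := by
      rw [Real.rpow_sub hρ, Real.rpow_two]
    have h3 : 0 < ρ ^ α := by positivity
    rw [mul_assoc _ (_ ^ (α / 2)), mul_comm (_ ^ (α / 2)), ← hρα, hMdef, h2, h1]
    field_simp
  rw [hval] at hbound
  rw [palmExpectation, ENNReal.le_div_iff_mul_le (Or.inl hV0) (Or.inl hV1)]
  refine le_trans (le_of_eq ?_) hbound
  rw [ENNReal.ofReal_div_of_pos (by norm_num), ENNReal.ofReal_ofNat, div_eq_mul_inv]
  ring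

/-- The upper bound: the logarithm lies below its tangent at `s`, and the Palm mean of the SINR is
`O((N / lam) ^ (α / 2))`. -/
lemma exists_palmExpectation_le {α : ℝ} (hα : 0 < α) : ∃ κ : ℝ, 0 ≤ κ ∧
    ∀ (lam Rd : ℝ) (N : ℕ) [NeZero N], 0 < lam →
    ∀ (Ω : Type*) [MeasurableSpace Ω] (P : Measure Ω) [IsProbabilityMeasure P]
      (net : LinkNetwork P lam Rd N) (rec : ZFSIC net (N - 1)) (A : Set Plane),
      MeasurableSet A → volume A ≠ 0 → volume A ≠ ∞ → ∀ s : ℝ, 0 ≤ s →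
      palmExpectation net A (fun k ω => ENNReal.ofReal (Real.logb 2 (1 + rec.sinr α 0 k ω))) ≤
        ENNReal.ofReal (Real.logb 2 (1 + s) +
          1 / ((1 + s) * Real.log 2) * (κ * (N / lam) ^ (α / 2))) := by
  set K : ℝ≥0∞ := (negMoment ^ 3 + 1) * (1 + radiiConst α) with hK
  have hKt : K ≠ ∞ := ENNReal.mul_ne_top
    (ENNReal.add_ne_top.2 ⟨ENNReal.pow_ne_top negMoment_lt_top.ne, ENNReal.one_ne_top⟩)
    (ENNReal.add_ne_top.2 ⟨ENNReal.one_ne_top, (radiiConst_lt_top α).ne⟩)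
  refine ⟨K.toReal * 8 ^ (α / 2), by positivity, ?_⟩
  intro lam Rd N _ hlam Ω _ P _ net rec A hA hA0 hA' s hs
  have hV0 : ENNReal.ofReal lam * volume A ≠ 0 := mul_ne_zero (by simpa using hlam) hA0
  have hV1 : ENNReal.ofReal lam * volume A ≠ ∞ := ENNReal.mul_ne_top ENNReal.ofReal_ne_top hA'
  have hlog : 0 < Real.log 2 := Real.log_pos (by norm_num)
  have hlogb : 0 ≤ Real.logb 2 (1 + s) := Real.logb_nonneg (by norm_num) (by linarith)
  set c : ℝ := 1 / ((1 + s) * Real.log 2) with hc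
  have hc0 : 0 ≤ c := by positivity
  set F : ℕ → Ω → ℝ≥0∞ := fun k ω => A.indicator 1 (net.tx k ω) *
    (ENNReal.ofReal (nsq (net.h k k ω)) * (residualPower (fun j => net.tx j ω) k (net.offset k ω)
      (N - 1) α (fun j => net.h k j ω))⁻¹) with hFdef
  have hF : ∀ k, Measurable (F k) := by
    intro k
    have h1 : Measurable (fun p : ((ℕ → Plane) × Plane) × (ℕ → Fin N → ℂ) =>
        A.indicator (1 : Plane → ℝ≥0∞) (p.1.1 k) * (ENNReal.ofReal (nsq (p.2 k)) *
          (residualPower p.1.1 k p.1.2 (N - 1) α p.2)⁻¹)) :=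
      ((LinkNetwork.measurable_indicator_tx hA k).comp measurable_fst).mul
        ((show Measurable fun p : ((ℕ → Plane) × Plane) × (ℕ → Fin N → ℂ) =>
            nsq (p.2 k) by fun_prop).ennreal_ofReal.mul
          (measurable_residualPower k (N - 1) α).inv)
    have h2 := h1.comp
      ((net.measurable_tx.prodMk (net.measurable_offset k)).prodMk (net.measurable_fading k))
    exact h2
  have hm0 : ∀ k, Measurable (fun ω => A.indicator (1 : Plane → ℝ≥0∞) (net.tx k ω)) := fun k =>
    (measurable_one.indicator hA).comp (net.ppp.measurable k)
  have hpt : ∀ᵐ ω ∂P, ∀ k, (net.tx k ⁻¹' A).indicator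
      (fun ω => ENNReal.ofReal (Real.logb 2 (1 + rec.sinr α 0 k ω))) ω
      ≤ ENNReal.ofReal (Real.logb 2 (1 + s)) * A.indicator 1 (net.tx k ω) +
        ENNReal.ofReal c * F k ω := by
    filter_upwards [net.ae_generalPosition hlam] with ω hω k
    obtain ⟨g1, g2, -, -, -⟩ := hω k
    by_cases hk : net.tx k ω ∈ A
    · rw [Set.indicator_of_mem (show ω ∈ net.tx k ⁻¹' A from hk)]
      simp only [hFdef, Set.indicator_of_mem hk, Pi.one_apply, mul_one, one_mul]
      have hx : 0 ≤ rec.sinr α 0 k ω := by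
        rw [sinr, rec.interference_eq g1, add_zero, rec.signalGain_eq, LinkNetwork.d]
        exact div_nonneg (mul_nonneg (nsq_nonneg _) (Real.rpow_nonneg dist_nonneg _))
          ENNReal.toReal_nonneg
      calc _ ≤ ENNReal.ofReal (Real.logb 2 (1 + s) + c * rec.sinr α 0 k ω) :=
            ENNReal.ofReal_le_ofReal (logb_one_add_le hs hx)
        _ = ENNReal.ofReal (Real.logb 2 (1 + s)) +
            ENNReal.ofReal c * ENNReal.ofReal (rec.sinr α 0 k ω) := by
            rw [ENNReal.ofReal_add hlogb (by positivity), ENNReal.ofReal_mul hc0]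
        _ ≤ _ := by
            gcongr
            exact rec.sinr_le g1 hα.le g2
    · rw [Set.indicator_of_notMem (show ω ∉ net.tx k ⁻¹' A from hk)]
      exact zero_le
  rw [palmExpectation]
  refine ENNReal.div_le_of_le_mul ?_
  calc _ ≤ ∫⁻ ω, ∑' k, (ENNReal.ofReal (Real.logb 2 (1 + s)) * A.indicator 1 (net.tx k ω) +
        ENNReal.ofReal c * F k ω) ∂P := by
        refine lintegral_mono_ae ?_
        filter_upwards [hpt] with ω hω
        exact ENNReal.tsum_le_tsum hω
    _ = ENNReal.ofReal (Real.logb 2 (1 + s)) * (ENNReal.ofReal lam * volume A) +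
        ENNReal.ofReal c * ∑' k, ∫⁻ ω, F k ω ∂P := by
        have hsum : ∀ k, Measurable fun ω => ENNReal.ofReal (Real.logb 2 (1 + s)) *
            A.indicator (1 : Plane → ℝ≥0∞) (net.tx k ω) + ENNReal.ofReal c * F k ω := fun k =>
          ((hm0 k).const_mul _).add ((hF k).const_mul _)
        rw [lintegral_tsum fun k => (hsum k).aemeasurable,
          ← net.tsum_indicator_tx hlam hA hA', ← ENNReal.tsum_mul_left, ← ENNReal.tsum_mul_left,
          ← ENNReal.tsum_add]
        refine tsum_congr fun k => ?_
        rw [lintegral_add_left ((hm0 k).const_mul _), lintegral_const_mul _ (hm0 k),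
          lintegral_const_mul _ (hF k)]
    _ ≤ ENNReal.ofReal (Real.logb 2 (1 + s)) * (ENNReal.ofReal lam * volume A) +
        ENNReal.ofReal c * (ENNReal.ofReal lam * volume A *
          (K * ENNReal.ofReal ((8 * N / lam) ^ (α / 2)))) := by
        gcongr
        exact net.tsum_lintegral_sinr_le (Nat.sub_le N 1) hlam hα hA hA'
    _ = _ := by
        have h8 : (8 * N / lam) ^ (α / 2) = 8 ^ (α / 2) * (N / lam) ^ (α / 2) := by
          rw [mul_div_assoc, Real.mul_rpow (by norm_num) (by positivity)]
        rw [h8, ENNReal.ofReal_add hlogb (by positivity), ENNReal.ofReal_mul hc0, mul_assoc K.toReal,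
          ENNReal.ofReal_mul ENNReal.toReal_nonneg, ENNReal.ofReal_toReal hKt]
        ring

/-- Scaling of the Palm mean of the spectral efficiency of a link. -/
lemma exists_palmExpectation_scaling {α Rd c : ℝ} (hα : 2 < α) (hRd : 1 < Rd) (hc : 0 < c) (β : ℝ)
    (hβ : 0 ≤ β) : ∃ k₁ k₂ : ℝ, 0 < k₁ ∧ 0 < k₂ ∧
    ∀ (lam : ℝ) (N : ℕ) [NeZero N], 1 ≤ lam → |(N : ℝ) - c * lam ^ β| < 1 →
    ∀ (Ω : Type*) [MeasurableSpace Ω] (P : Measure Ω) [IsProbabilityMeasure P]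
      (net : LinkNetwork P lam Rd N) (rec : ZFSIC net (N - 1))
      (A : Set Plane), MeasurableSet A → volume A ≠ 0 → volume A ≠ ∞ →
      ENNReal.ofReal (k₁ * Real.logb 2 (1 + lam ^ (α / 2 * (β - 1)))) ≤
        palmExpectation net A (fun k ω => ENNReal.ofReal (Real.logb 2 (1 + rec.sinr α 0 k ω))) ∧
      palmExpectation net A (fun k ω => ENNReal.ofReal (Real.logb 2 (1 + rec.sinr α 0 k ω))) ≤
        ENNReal.ofReal (k₂ * Real.logb 2 (1 + lam ^ (α / 2 * (β - 1)))) := by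
  obtain ⟨κ₁, hκ₁, hlow⟩ := exists_le_palmExpectation hα (by linarith : 0 < Rd)
  obtain ⟨κ₂, hκ₂, hupp⟩ := exists_palmExpectation_le (by linarith : 0 < α)
  refine ⟨min (κ₁ * (c / 2) ^ (α / 2)) 1 / 2, 1 + κ₂ * (c + 1) ^ (α / 2), by positivity,
    by positivity, ?_⟩
  intro lam N _ hlam hN Ω _ P _ net rec A hA hA0 hA'
  have hlam0 : 0 < lam := by linarith
  have hN1 : (1 : ℝ) ≤ N := by exact_mod_cast Nat.pos_of_ne_zero (NeZero.ne N)
  have hβ1 : 1 ≤ lam ^ β := Real.one_le_rpow hlam hβ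
  have hab := abs_lt.1 hN
  set s := lam ^ (α / 2 * (β - 1)) with hs
  have hs0 : 0 < s := by positivity
  have hβ2 : lam ^ (β - 1) = lam ^ β / lam := by rw [Real.rpow_sub hlam0, Real.rpow_one]
  have hsr : s = (lam ^ (β - 1)) ^ (α / 2) := by
    rw [hs, ← Real.rpow_mul hlam0.le, mul_comm]
  have hN_upper : (N : ℝ) / lam ≤ (c + 1) * lam ^ (β - 1) := by
    rw [hβ2, ← mul_div_assoc]
    gcongr
    nlinarith
  have hN_lower : c / 2 * lam ^ (β - 1) ≤ (N : ℝ) / lam := by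
    rw [hβ2, ← mul_div_assoc]
    gcongr
    -- `N ≥ c lam ^ β - 1`, or `N ≥ 1` if `c lam ^ β ≤ 2`
    rcases le_total 2 (c * lam ^ β) with h | h <;> nlinarith
  have hq_upper : (N / lam) ^ (α / 2) ≤ (c + 1) ^ (α / 2) * s := by
    rw [hsr, ← Real.mul_rpow (by positivity) (by positivity)]
    gcongr
  have hq_lower : (c / 2) ^ (α / 2) * s ≤ (N / lam) ^ (α / 2) := by
    rw [hsr, ← Real.mul_rpow (by positivity) (by positivity)]
    gcongr
  constructor
  · refine le_trans (ENNReal.ofReal_le_ofReal ?_) (hlow lam N hlam0 Ω P net rec A hA hA0 hA')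
    have h1 := min_mul_logb_le (q := κ₁ * (c / 2) ^ (α / 2)) (by positivity) hs0.le
    have h2 : Real.logb 2 (1 + κ₁ * (c / 2) ^ (α / 2) * s)
        ≤ Real.logb 2 (1 + κ₁ * (N / lam) ^ (α / 2)) := by
      refine Real.logb_le_logb_of_le (by norm_num) (by positivity) ?_
      rw [mul_assoc]
      gcongr
    linarith
  · refine le_trans (hupp lam Rd N hlam0 Ω P net rec A hA hA0 hA' s hs0.le)
      (ENNReal.ofReal_le_ofReal ?_)
    have hlog : 0 < Real.log 2 := Real.log_pos (by norm_num)
    have h1 := div_one_add_le_logb hs0.le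
    calc Real.logb 2 (1 + s) + 1 / ((1 + s) * Real.log 2) * (κ₂ * (N / lam) ^ (α / 2))
        ≤ Real.logb 2 (1 + s) +
          1 / ((1 + s) * Real.log 2) * (κ₂ * ((c + 1) ^ (α / 2) * s)) := by gcongr
      _ = Real.logb 2 (1 + s) +
          κ₂ * (c + 1) ^ (α / 2) * (1 / ((1 + s) * Real.log 2) * s) := by ring
      _ ≤ Real.logb 2 (1 + s) + κ₂ * (c + 1) ^ (α / 2) * Real.logb 2 (1 + s) := by gcongr
      _ = _ := by ring

end ZFSIC

theorem theorem4 (α Rd c : ℝ) (hα : 2 < α) (hRd : 1 < Rd) (hc : 0 < c) :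
    (∀ β : ℝ, 0 ≤ β →
      ∃ k₁ k₂ lam₀ : ℝ, 0 < k₁ ∧ 0 < k₂ ∧ 0 < lam₀ ∧
        ∀ (lam : ℝ) (N : ℕ) [NeZero N], lam₀ ≤ lam → |(N : ℝ) - c * lam ^ β| < 1 →
        ∀ (Ω : Type*) [MeasurableSpace Ω] (P : Measure Ω) [IsProbabilityMeasure P]
          (net : LinkNetwork P lam Rd N) (rec : ZFSIC net (N - 1))
          (A : Set Plane), MeasurableSet A → volume A ≠ 0 → volume A ≠ ∞ →
          ENNReal.ofReal (k₁ * Real.logb 2 (1 + lam ^ (α / 2 * (β - 1))))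
              ≤ sumSpectralEfficiency rec α 0 A / ENNReal.ofReal lam ∧
            sumSpectralEfficiency rec α 0 A / ENNReal.ofReal lam
              ≤ ENNReal.ofReal (k₂ * Real.logb 2 (1 + lam ^ (α / 2 * (β - 1))))) ∧
    (∃ k₁ k₂ lam₀ : ℝ, 0 < k₁ ∧ 0 < k₂ ∧ 0 < lam₀ ∧
        ∀ (lam : ℝ) (N : ℕ) [NeZero N], lam₀ ≤ lam → |(N : ℝ) - c * lam| < 1 →
        ∀ (Ω : Type*) [MeasurableSpace Ω] (P : Measure Ω) [IsProbabilityMeasure P]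
          (net : LinkNetwork P lam Rd N) (rec : ZFSIC net (N - 1))
          (A : Set Plane), MeasurableSet A → volume A ≠ 0 → volume A ≠ ∞ →
          ENNReal.ofReal (k₁ * lam) ≤ sumSpectralEfficiency rec α 0 A ∧
            sumSpectralEfficiency rec α 0 A ≤ ENNReal.ofReal (k₂ * lam)) := by
  refine ⟨fun β hβ => ?_, ?_⟩
  · obtain ⟨k₁, k₂, hk₁, hk₂, h⟩ := ZFSIC.exists_palmExpectation_scaling hα hRd hc β hβ
    refine ⟨k₁, k₂, 1, hk₁, hk₂, one_pos, fun lam N _ hlam hN Ω _ P _ net rec A hA hA0 hA' => ?_⟩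
    have hl0 : ENNReal.ofReal lam ≠ 0 := by simpa using (by linarith : 0 < lam)
    rw [sumSpectralEfficiency, mul_comm (ENNReal.ofReal lam),
      ENNReal.mul_div_cancel_right hl0 ENNReal.ofReal_ne_top]
    exact h lam N hlam hN Ω P net rec A hA hA0 hA'
  · obtain ⟨k₁, k₂, hk₁, hk₂, h⟩ := ZFSIC.exists_palmExpectation_scaling hα hRd hc 1 zero_le_one
    refine ⟨k₁, k₂, 1, hk₁, hk₂, one_pos, fun lam N _ hlam hN Ω _ P _ net rec A hA hA0 hA' => ?_⟩
    have hl : 0 ≤ lam := by linarith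
    have h1 := h lam N hlam (by simpa using hN) Ω P net rec A hA hA0 hA'
    -- for `β = 1` the comparison function is `log₂ 2 = 1`
    rw [show (1 : ℝ) + lam ^ (α / 2 * (1 - 1)) = 2 by norm_num, Real.logb_self_eq_one (by norm_num),
      mul_one, mul_one] at h1
    rw [sumSpectralEfficiency, mul_comm k₁, mul_comm k₂, ENNReal.ofReal_mul hl,
      ENNReal.ofReal_mul hl]
    exact ⟨mul_le_mul_right h1.1 _, mul_le_mul_right h1.2 _⟩
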